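/- Let $n\ge 3$. Let $W(n-1)$ be the complex span of the words $a=a(1)\cdots a(n-1)$ in the letters $1,\dots,n-1$, each used once, with the bilinear form for which the words are orthonormal; let $Lie(n-1)\subset W(n-1)$ be the span of the Lie monomials (iterated commutators using each letter once), equivalently oriented rooted trivalent trees $\Gamma$ with leaves $1,\dots,n-1$ and root $n$. A word $a$ defines the functional $\Gamma\mapsto(\Gamma,a)$ (the coefficient of $a$ in $\Gamma$) in $Lie(n-1)^*$. Let $\mathcal K_n$ be the real vector space of symmetric $(s_{ij})_{1\le i,j\le n}$ with $s_{ii}=0$ and $\sum_j s_{ij}=0$. Use the coordinates $\sigma_2,\dots,\sigma_{n-2}$, $(\sigma_1,\sigma_{n-1},\sigma_n)=(0,1,\infty)$, on the open stratum $\mathcal M^{\#}_{0,n}=\mathcal M_{0,n}-D$ of the moduli space of $n$ distinct points on $\mathbb{CP}^1$, and the coordinates $(\tau_i,\sigma_i)_{2\le i\le n-2}$ on its cotangent bundle, with symplectic form $\omega=\sum_{i=2}^{n-2}d\tau_i\wedge d\sigma_i$. Write $\sigma_{ij}=\sigma_i-\sigma_j$. Let $q$ be the map from $\mathcal K_n\times\mathcal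 M^{\#}_{0,n}$ to the cotangent bundle given by $q(s,\sigma)=(\tau,\sigma)$, $\tau_i=\sum_{j\ne i,\,j<n}s_{ij}/\sigma_{ij}$. For a word $a$ put $$PT_a=\frac{1}{(2\pi i)^{n-3}}\,\frac{d\sigma_2\wedge\dots\wedge d\sigma_{n-2}}{\prod_{i=1}^{n-2}\sigma_{a(i)a(i+1)}} .$$ For a Lie monomial $\Gamma$ let $C_\Gamma$ be the torus $|u_{I_p}|=\epsilon_p$ (small $\epsilon_p$, $p=1,\dots,n-3$) in $\mathcal M^{\#}_{0,n}$ near the point $D_\Gamma$. Here $I_1,\dots,I_{n-3}$ are the leaf sets of the propagators of $\Gamma$, and $u_I$ are the dihedral coordinates of the cyclic order $(a(1),\dots,a(n-1),n)$, for a word $a$ with $(\Gamma,a)\neq0$: $$u_I=\frac{\sigma_{a(i)a(j)}\,\sigma_{a(i-1)a(j+1)}}{\sigma_{a(i)a(j+1)}\,\sigma_{a(i-1)a(j)}}\quad\text{for } I=\{a(i),\dots,a(j)\},$$ with indices modulo $n$, $a(n)=n$. The point $D_\Gamma$ is given by $u_{I_p}=0$ for all $p$, and $u_J=1$ for all other $J$.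 The torus $C_\Gamma$ is oriented so that $\int_{C_\Gamma}PT_a=(\Gamma,a)$. Such tori exist for every $\Gamma$. Put $w_\Gamma=\int_{C_\Gamma}q^*\omega^{n-3}$ (integration over the fibre), an $(n-3)$-form on $\mathcal K_n$. Then: 1. The form $w_\Gamma$ has constant coefficients and does not depend on the choices made in $C_\Gamma$, and $\Gamma\mapsto w_\Gamma$ extends to a linear map $w$ from $Lie(n-1)$ to the space of complex-valued alternating $(n-3)$-forms on $\mathcal K_n$. Likewise $a\mapsto PT_a$ extends to a linear map from $Lie(n-1)^*$ to the $(n-3)$-forms on $\mathcal M^{\#}_{0,n}$. 2. For every basis $H$ of $Lie(n-1)$ and every basis $K$ of $Lie(n-1)^*$, with pairing matrix $G=\big((\Gamma,a)\big)_{\Gamma\in H,\,a\in K}$, $$q^*\omega^{n-3}=\sum_{\Gamma\in H,\ a\in K}(G^{-1})_{a\Gamma}\; w_\Gamma\wedge PT_a .$$ If $GG^{T}=1$, in particular if $H$ and $K$ are dual bases, this reads $$q^*\omega^{n-3}=\sum_{\Gamma\in H,\ a\in K}(\Gamma,a)\; w_\Gamma\wedge PT_a .$$ 3. With the combs $\Gamma_{1a}=[\dots[[1,a(1)],a(2)],\dots,a(n-2)]$,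 where $a$ runs over the permutations of $2,\dots,n-1$, $$q^*\omega^{n-3}=\sum_{a}w_{\Gamma_{1a}}\wedge PT_{1a} .$$ -/

import Mathlib

open Filter Topology

noncomputable section

namespace LiePT

/-! Throughout `n = m + 3`.  The labels `1, …, n - 1` are the elements of `Fin (m + 2)`; inside
`Fin (m + 3)` the label `n` is `Fin.last (m + 2)`.  The labels `2, …, n - 2` are `Fin m`. -/

/-! ### Lie polynomials and words -/

/-- The letters of a bracketing, read from left to right. -/
def leaves {α : Type*} : FreeMagma α → List α
  | FreeMagma.of x => [x]
  | FreeMagma.mul l r => leaves l ++ leaves r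

/-- All rooted subtrees of a rooted binary tree (the tree itself and the leaves included). -/
def subtrees {α : Type*} : FreeMagma α → List (FreeMagma α)
  | FreeMagma.of x => [FreeMagma.of x]
  | FreeMagma.mul l r => FreeMagma.mul l r :: (subtrees l ++ subtrees r)

/-- Noncommutative polynomials in `x_1, …, x_{n-1}`. -/
abbrev Poly (m : ℕ) : Type := MonoidAlgebra ℂ (FreeMonoid (Fin (m + 2)))

/-- The expansion of a bracketing, every bracket being read as a commutator. -/
def expand {m : ℕ} : FreeMagma (Fin (m + 2)) → Poly m
  | FreeMagma.of x => MonoidAlgebra.single (FreeMonoid.of x) 1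
  | FreeMagma.mul l r => expand l * expand r - expand r * expand l

/-- Lie monomials of weight one in each of the letters `x_1, …, x_{n-1}`, that is, rooted trivalent
trees with leaves `1, …, n - 1` (and root `n`) with a planar embedding. -/
def LieMonomial (m : ℕ) : Type :=
  {t : FreeMagma (Fin (m + 2)) // (leaves t).Perm (List.finRange (m + 2))}

/-- `Lie(n-1)`, the span of the Lie monomials of weight one in each letter. -/
def Lie (m : ℕ) : Submodule ℂ (Poly m) :=
  Submodule.span ℂ (Set.range fun Γ : LieMonomial m => expand Γ.1)

/-- The Lie polynomial of a Lie monomial. -/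
def LieMonomial.toLie {m : ℕ} (Γ : LieMonomial m) : Lie m :=
  ⟨expand Γ.1, Submodule.subset_span ⟨Γ, rfl⟩⟩

/-- The word `a(1) a(2) ⋯ a(n-1)` of a permutation `a`. -/
def word {m : ℕ} (a : Equiv.Perm (Fin (m + 2))) : FreeMonoid (Fin (m + 2)) :=
  FreeMonoid.ofList (List.ofFn a)

/-- The class of the word `a` in `Lie(n-1)^*`: the functional `Γ ↦ (Γ, a)`, the coefficient of `a`
in `Γ`. -/
def wordDual {m : ℕ} (a : Equiv.Perm (Fin (m + 2))) : Module.Dual ℂ (Lie m) where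
  toFun Γ := (Γ : Poly m).coeff (word a)
  map_add' _ _ := rfl
  map_smul' _ _ := rfl

/-- The comb `[[…[a(1), a(2)], …], a(n-1)]`. -/
def combTree {m : ℕ} (a : Equiv.Perm (Fin (m + 2))) : FreeMagma (Fin (m + 2)) :=
  (List.ofFn fun i : Fin (m + 1) => a i.succ).foldl
    (fun t x => FreeMagma.mul t (FreeMagma.of x)) (FreeMagma.of (a 0))

theorem leaves_foldl {α : Type*} (l : List α) (t : FreeMagma α) :
    leaves (l.foldl (fun t x => FreeMagma.mul t (FreeMagma.of x)) t) = leaves t ++ l := by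
  induction l generalizing t with
  | nil => simp
  | cons x l ih =>
    rw [List.foldl_cons, ih, leaves, leaves, List.append_assoc, List.singleton_append]

theorem leaves_combTree {m : ℕ} (a : Equiv.Perm (Fin (m + 2))) :
    leaves (combTree a) = List.ofFn a := by
  rw [combTree, leaves_foldl, List.ofFn_succ (f := a)]
  rfl

/-- The comb as a Lie monomial. -/
def comb {m : ℕ} (a : Equiv.Perm (Fin (m + 2))) : LieMonomial m :=
  ⟨combTree a, by
    rw [leaves_combTree, List.ofFn_eq_map]
    refine (List.perm_ext_iff_of_nodup ((List.nodup_finRange _).map a.injective)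
      (List.nodup_finRange _)).2 fun x => ?_
    simpa using a.surjective x⟩

/-! ### Differential forms

A complex-valued `k`-form at a point is an `ℝ`-multilinear alternating map with values in `ℂ`. -/

/-- Complex-valued alternating `k`-forms on a real vector space. -/
abbrev Form (E : Type*) [AddCommGroup E] [Module ℝ E] (k : ℕ) : Type _ := E [⋀^Fin k]→ₗ[ℝ] ℂ

/-- The wedge product (sum over shuffles, so that
`(α ∧ β)(u, v) = α(u) β(v) - α(v) β(u)` for one-forms). -/
def wedge {E : Type*} [AddCommGroup E] [Module ℝ E] {k l : ℕ} (α : Form E k) (β : Form E l) :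
    Form E (k + l) :=
  ((LinearMap.mul' ℝ ℂ).compAlternatingMap (α.domCoprod β)).domDomCongr finSumFinEquiv

/-- A linear form as a one-form. -/
def oneForm {E : Type*} [AddCommGroup E] [Module ℝ E] (f : E →ₗ[ℝ] ℂ) : Form E 1 :=
  AlternatingMap.ofSubsingleton ℝ E ℂ (0 : Fin 1) f

/-- The powers `α^k = α ∧ ⋯ ∧ α` of a two-form. -/
def wedgePow {E : Type*} [AddCommGroup E] [Module ℝ E] (α : Form E 2) : (k : ℕ) → Form E (2 * k)
  | 0 => AlternatingMap.constOfIsEmpty ℝ E (Fin 0) (1 : ℂ)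
  | k + 1 => wedge (wedgePow α k) α

/-- The integral of a `k`-form over the parametrised torus `γ : [0, 2π]^k → E`. -/
def torusInt {E : Type*} [NormedAddCommGroup E] [NormedSpace ℝ E] {k : ℕ}
    (γ : (Fin k → ℝ) → E) (η : E → Form E k) : ℂ :=
  ∫ θ in Set.Icc (0 : Fin k → ℝ) (fun _ => 2 * Real.pi),
    η (γ θ) fun p => fderiv ℝ γ θ (Pi.single p 1)

/-- The fibre integral of a `(k + l)`-form `η` on a product `B × E` over the parametrised torus
`γ : [0, 2π]^l → E`: a `k`-form on `B`, evaluated here at `b : B` on the vectors `v_1, …, v_k`. -/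
def fibreInt {B E : Type*} [AddCommGroup B] [Module ℝ B] [NormedAddCommGroup E] [NormedSpace ℝ E]
    {k l : ℕ} (γ : (Fin l → ℝ) → E) (η : B × E → Form (B × E) (k + l)) (b : B) (v : Fin k → B) :
    ℂ :=
  ∫ θ in Set.Icc (0 : Fin l → ℝ) (fun _ => 2 * Real.pi),
    η (b, γ θ) (Fin.append (fun i => ((v i, 0) : B × E))
      fun p => ((0, fderiv ℝ γ θ (Pi.single p 1)) : B × E))

/-! ### The spaces -/

/-- The space `K_n` of Mandelstam variables: symmetric `s_ij` with zero diagonal and vanishing row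
sums. -/
def Mandelstam (m : ℕ) : Submodule ℝ (Fin (m + 3) → Fin (m + 3) → ℝ) where
  carrier := {s | (∀ i j, s i j = s j i) ∧ (∀ i, s i i = 0) ∧ ∀ i, ∑ j, s i j = 0}
  add_mem' := by
    rintro s t ⟨h₁, h₂, h₃⟩ ⟨k₁, k₂, k₃⟩
    refine ⟨fun i j => ?_, fun i => ?_, fun i => ?_⟩
    · simp [h₁ i j, k₁ i j]
    · simp [h₂ i, k₂ i]
    · simp [Finset.sum_add_distrib, h₃ i, k₃ i]
  zero_mem' := by simp
  smul_mem' := by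
    rintro c s ⟨h₁, h₂, h₃⟩
    refine ⟨fun i j => ?_, fun i => ?_, fun i => ?_⟩
    · simp [h₁ i j]
    · simp [h₂ i]
    · simp [← Finset.mul_sum, h₃ i]

/-- The positions `σ_1, …, σ_{n-1}` in the gauge `(σ_1, σ_{n-1}, σ_n) = (0, 1, ∞)`, where
`σ_2, …, σ_{n-2}` are the coordinates `z`. -/
def pos {m : ℕ} (z : Fin m → ℂ) : Fin (m + 2) → ℂ :=
  Fin.cons (0 : ℂ) (Fin.snoc z (1 : ℂ) : Fin (m + 1) → ℂ)

/-- The open stratum of the moduli space, i.e. `n` distinct points on the Riemann sphere modulo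
Möbius transformations, in the gauge `(σ_1, σ_{n-1}, σ_n) = (0, 1, ∞)`. -/
def openModuli (m : ℕ) : Set (Fin m → ℂ) := {z | Function.Injective (pos z)}

/-- The label of the `i`-th moving point among `1, …, n - 1`. -/
def moving {m : ℕ} (i : Fin m) : Fin (m + 2) := i.castSucc.succ

/-- `E_i = ∑_j s_ij / σ_ij`.  The term `j = i` is `0` because `s_ii = 0`; the term `j = n` vanishes
because `σ_n = ∞`. -/
def scatteringE {m : ℕ} (s : Mandelstam m) (z : Fin m → ℂ) (i : Fin m) : ℂ :=
  ∑ j : Fin (m + 2),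
    ((s.1 (moving i).castSucc j.castSucc : ℝ) : ℂ) / (pos z (moving i) - pos z j)

/-- The map `q : (s, σ) ↦ (τ, σ)`, `τ_i = E_i(s, σ)`, to the logarithmic cotangent bundle, which over
the open stratum is the cotangent bundle with coordinates `(τ_i, σ_i)`. -/
def qMap (m : ℕ) (y : Mandelstam m × (Fin m → ℂ)) : (Fin m → ℂ) × (Fin m → ℂ) :=
  (scatteringE y.1 y.2, y.2)

/-- The symplectic form `ω = ∑_i dτ_i ∧ dσ_i` on the cotangent bundle. -/
def symplectic (m : ℕ) : Form ((Fin m → ℂ) × (Fin m → ℂ)) 2 :=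
  ∑ i : Fin m,
    wedge (oneForm (LinearMap.proj i ∘ₗ LinearMap.fst ℝ (Fin m → ℂ) (Fin m → ℂ)))
      (oneForm (LinearMap.proj i ∘ₗ LinearMap.snd ℝ (Fin m → ℂ) (Fin m → ℂ)))

/-- The pullback `q^* ω^{n-3}`, a form of degree `2(n-3) = (n-3) + (n-3)`. -/
def qOmegaPow (m : ℕ) (y : Mandelstam m × (Fin m → ℂ)) :
    Form (Mandelstam m × (Fin m → ℂ)) (m + m) :=
  ((wedgePow (symplectic m) m).compLinearMap
    (fderiv ℝ (qMap m) y : Mandelstam m × (Fin m → ℂ) →ₗ[ℝ] (Fin m → ℂ) × (Fin m → ℂ))).domDomCongr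
    (finCongr (two_mul m))

/-- The form `dσ_2 ∧ ⋯ ∧ dσ_{n-2}`. -/
def dSigma (m : ℕ) : Form (Fin m → ℂ) m :=
  { (Matrix.detRowAlternating (n := Fin m) (R := ℂ)).toMultilinearMap.restrictScalars ℝ with
    map_eq_zero_of_eq' := fun v _ _ h hij =>
      (Matrix.detRowAlternating (n := Fin m) (R := ℂ)).map_eq_zero_of_eq v h hij }

/-- The Parke-Taylor form
`PT_a = (2πi)^{-(n-3)} dσ_2 ∧ ⋯ ∧ dσ_{n-2} / ∏_{i=1}^{n-2} σ_{a(i) a(i+1)}`. -/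
def parkeTaylor {m : ℕ} (a : Equiv.Perm (Fin (m + 2))) (z : Fin m → ℂ) : Form (Fin m → ℂ) m :=
  (((2 * Real.pi * Complex.I) ^ m)⁻¹ *
    (∏ i : Fin (m + 1), (pos z (a i.castSucc) - pos z (a i.succ)))⁻¹) • dSigma m

/-- The wedge product on `K_n × M_{0,n}` of a form on `K_n` and a form on `M_{0,n}` (both pulled
back along the projections). -/
def extWedge {m : ℕ} (w : Form (Mandelstam m) m) (η : Form (Fin m → ℂ) m) :
    Form (Mandelstam m × (Fin m → ℂ)) (m + m) :=
  wedge (w.compLinearMap (LinearMap.fst ℝ (Mandelstam m) (Fin m → ℂ)))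
    (η.compLinearMap (LinearMap.snd ℝ (Mandelstam m) (Fin m → ℂ)))

/-! ### Dihedral coordinates and the cycles -/

/-- Homogeneous coordinates of the marked points: `(σ_i, 1)` for `i < n` and `(1, 0)` for `n`. -/
def point {m : ℕ} (z : Fin m → ℂ) : Fin (m + 3) → ℂ × ℂ :=
  Fin.snoc (fun j : Fin (m + 2) => (pos z j, (1 : ℂ))) ((1 : ℂ), (0 : ℂ))

/-- The homogeneous version of `σ_ij = σ_i - σ_j`. -/
def bracket {m : ℕ} (z : Fin m → ℂ) (i j : Fin (m + 3)) : ℂ :=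
  (point z i).1 * (point z j).2 - (point z j).1 * (point z i).2

/-- The cyclic ordering `a(1), …, a(n-1), n`. -/
def cyclic {m : ℕ} (a : Equiv.Perm (Fin (m + 2))) : Fin (m + 3) → Fin (m + 3) :=
  Fin.snoc (fun i : Fin (m + 2) => (a i).castSucc) (Fin.last (m + 2))

/-- The chords of the `n`-gon, i.e. the proper intervals `[i, j]` of positions in a word of length
`n - 1` that contain at least two positions. -/
def Chord (m : ℕ) : Type :=
  {c : Fin (m + 2) × Fin (m + 2) // c.1 < c.2 ∧ c ≠ (0, Fin.last (m + 1))}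

/-- The subset `I = {a(i), …, a(j)}` of the chord `[i, j]`. -/
def Chord.labels {m : ℕ} (c : Chord m) (a : Equiv.Perm (Fin (m + 2))) : Finset (Fin (m + 2)) :=
  (Finset.Icc c.1.1 c.1.2).map a.toEmbedding

/-- The dihedral coordinate `u_I` of the chord with `I = {a(i), …, a(j)}`: the cross-ratio
`σ_{a(i) a(j)} σ_{a(i-1) a(j+1)} / (σ_{a(i) a(j+1)} σ_{a(i-1) a(j)})`, with cyclic indices modulo
`n` and `a(n) = n`. -/
def dihedral {m : ℕ} (a : Equiv.Perm (Fin (m + 2))) (c : Chord m) (z : Fin m → ℂ) : ℂ :=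
  (bracket z (cyclic a c.1.1.castSucc) (cyclic a c.1.2.castSucc) *
    bracket z (cyclic a (c.1.1.castSucc - 1)) (cyclic a (c.1.2.castSucc + 1))) /
  (bracket z (cyclic a c.1.1.castSucc) (cyclic a (c.1.2.castSucc + 1)) *
    bracket z (cyclic a (c.1.1.castSucc - 1)) (cyclic a c.1.2.castSucc))

/-- The chord corresponds to a propagator of `Γ`: its labels are those of the leaves of a subtree. -/
def IsPropagator {m : ℕ} (Γ : LieMonomial m) (a : Equiv.Perm (Fin (m + 2))) (c : Chord m) : Prop :=
  ∃ t ∈ subtrees Γ.1, (leaves t).toFinset = c.labels a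

/-- The punctured polydisc `0 < |x_p| < r`. -/
def puncturedPolydisc (m : ℕ) (r : ℝ) : Set (Fin m → ℂ) := {x | ∀ p, 0 < ‖x p‖ ∧ ‖x p‖ < r}

/-- The data of the oriented torus `C_Γ : |u_{I_p}| = ε_p` around the point `D_Γ`.  The point `D_Γ`
is given, in the dihedral coordinates of an ordering `a` for which `Γ` is planar, by `u_{I_p} = 0`
for the propagators `I_p` of `Γ` (and then `u_J = 1` for all the other chords `J`).  The `u_{I_p}`
are local coordinates at `D_Γ`; the inverse of this coordinate system, on the complement of the
divisor near `D_Γ`, is recorded as `chart`. -/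
structure TreeCycle {m : ℕ} (Γ : LieMonomial m) where
  /-- an ordering for which `Γ` is planar -/
  a : Equiv.Perm (Fin (m + 2))
  planar : wordDual a Γ.toLie ≠ 0
  /-- an enumeration of the propagators -/
  prop : Fin m → Chord m
  prop_injective : Function.Injective prop
  mem_range_prop : ∀ c, c ∈ Set.range prop ↔ IsPropagator Γ a c
  /-- the size of the coordinate neighbourhood -/
  r : ℝ
  r_pos : 0 < r
  /-- the point with prescribed values of the coordinates `u_{I_p}` -/
  chart : (Fin m → ℂ) → Fin m → ℂ
  chart_holo : DifferentiableOn ℂ chart (puncturedPolydisc m r)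
  chart_mem : ∀ x ∈ puncturedPolydisc m r, chart x ∈ openModuli m
  dihedral_prop : ∀ x ∈ puncturedPolydisc m r, ∀ p, dihedral a (prop p) (chart x) = x p
  dihedral_other : ∀ c, ¬ IsPropagator Γ a c →
    Tendsto (fun x => dihedral a c (chart x)) (𝓝[puncturedPolydisc m r] 0) (𝓝 1)
  /-- the radii of the torus -/
  ε : Fin m → ℝ
  ε_mem : ∀ p, 0 < ε p ∧ ε p < r
  /-- the orientation relative to the parametrisation by the arguments of the `u_{I_p}` -/
  sign : ℤˣ
  orient : ((sign : ℤ) : ℂ) * torusInt (fun θ => chart (torusMap 0 ε θ)) (parkeTaylor a) =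
    wordDual a Γ.toLie

/-- The value of `∫_{C_Γ} q^* ω^{n-3}` at the point `s` of `K_n` on the vectors `v_1, …, v_{n-3}`. -/
def TreeCycle.fibreIntegral {m : ℕ} {Γ : LieMonomial m} (C : TreeCycle Γ) (s : Mandelstam m)
    (v : Fin m → Mandelstam m) : ℂ :=
  ((C.sign : ℤ) : ℂ) * fibreInt (fun θ => C.chart (torusMap 0 C.ε θ)) (qOmegaPow m) s v

/-- The matrix `(Γ_i, a_j)` of the pairing between a basis of `Lie(n-1)` and a basis of
`Lie(n-1)^*`. -/
def pairing {m : ℕ} {ι : Type*} (H : Module.Basis ι ℂ (Lie m))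
    (K : Module.Basis ι ℂ (Module.Dual ℂ (Lie m))) : Matrix ι ι ℂ :=
  Matrix.of fun i j => K j (H i)

end LiePT

end

/-!
The proof computes both sides explicitly.

*The left-hand side.*  Since `dτ_i = ∑_j ds_ij / σ_ij + (terms in dσ)`, the form `q^* ω^{n-3}` is a
constant multiple of `⋀_i (∑_j ds_ij / σ_ij) ∧ dσ_2 ∧ ⋯ ∧ dσ_{n-2}` (`exists_qOmegaPow_eq`).
Expanding the determinant by Cauchy-Binet gives a sum over graphs; a nonzero minor of the incidence
matrix forces the graph to be a spanning tree once the points `σ_1` and `σ_{n-1}` are joined, and the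
product of the `1 / σ_ij` over the edges of a spanning tree is a combination of the Parke-Taylor
factors of the words that begin with the first letter (`exists_detForm_dScattering_eq`).  Hence `q^* ω^{n-3} = ∑_a W_a ∧ PT_{1a}` with constant forms
`W_a` on `K_n` (`exists_qOmegaPow_eq_sum`).

*Words and combs.*  The combs `Γ_{1a}` and the functionals of the words `1a` are dual bases
(`eq_sum_comb`, `wordDual_comb`), and the Parke-Taylor factors satisfy the relations of
`Lie(n-1)^*`, because their generating polynomial is a Lie polynomial (`theta_mem_lieSpan`,
`inv_den_eq_sum`); so `a ↦ PT_a` extends linearly.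

*The cycles.*  Near the point `D_Γ` the differences `σ_ij` of points below a common vertex are
governed by the gap of their lowest common ancestor (`Degenerates.tendsto_gap`).  Two consequences
follow.  The quotient `PT_b / PT_a`, for a planar order `a` of `Γ`, tends to the coefficient of the
word `b` in `Γ` up to sign (`tendsto_den_div`), by induction over the tree: each time the word
passes between the two subtrees more often than necessary, a factor that tends to `0` appears.  And
`PT_a` has a logarithmic pole with residue `± 1` (`IsTreeChart.exists_residue`), because the
logarithmic derivatives of the `u_I` with respect to the gaps tend to an integral matrix with an
integral inverse.  Averaging a holomorphic function over tori (`integral_torus_eq`) then gives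
`∫_{C_Γ} PT_b = (Γ, b)` for every word `b` (`TreeCycle.sign_mul_torusInt`), whence
`w_Γ = ∑_a (Γ, 1a) W_a` (`TreeCycle.fibreIntegral_eq`), which is linear in `Γ`.

*Existence of the cycles.*  Writing each gap as a product of variables `t_p`, one for each
propagator whose leaves enclose the gap, the coordinates `u_{I_p}` become `t_p` times a unit with
value `1` at the origin, and the inverse function theorem applies (`exists_isTreeChart`).

The formula for arbitrary bases is the statement that the canonical element of
`Lie(n-1) ⊗ Lie(n-1)^*` can be written in any pair of bases (`sum_inv_pairing_smul`).
-/

noncomputable section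

namespace LiePT

/-! ### Words and coefficients -/

section Words
variable {m : ℕ}

/-- The word `w`, as a noncommutative monomial. -/
def mono (w : List (Fin (m + 2))) : Poly m := MonoidAlgebra.single (FreeMonoid.ofList w) 1

/-- The coefficient of the word `w` in a noncommutative polynomial. -/
def cf (P : Poly m) (w : List (Fin (m + 2))) : ℂ := P.coeff (FreeMonoid.ofList w)

@[simp] theorem cf_add (P Q : Poly m) (w) : cf (P + Q) w = cf P w + cf Q w := rfl
@[simp] theorem cf_sub (P Q : Poly m) (w) : cf (P - Q) w = cf P w - cf Q w := rfl
@[simp] theorem cf_smul (c : ℂ) (P : Poly m) (w) : cf (c • P) w = c * cf P w := rfl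
@[simp] theorem cf_zero (w : List (Fin (m + 2))) : cf (0 : Poly m) w = 0 := rfl

theorem cf_sum {ι : Type*} (s : Finset ι) (f : ι → Poly m) (w) :
    cf (∑ i ∈ s, f i) w = ∑ i ∈ s, cf (f i) w := by
  classical
  induction s using Finset.induction_on with
  | empty => simp
  | insert a s ha ih => rw [Finset.sum_insert ha, Finset.sum_insert ha, cf_add, ih]

theorem cf_mono (u w : List (Fin (m + 2))) : cf (mono u) w = if u = w then 1 else 0 := by
  classical
  unfold cf mono
  rw [MonoidAlgebra.coeff_single, Finsupp.single_apply]
  simp [FreeMonoid.ofList.injective.eq_iff]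

theorem mono_append (u v : List (Fin (m + 2))) : mono (u ++ v) = mono u * mono v := by
  simp [mono, FreeMonoid.ofList_append]

theorem mono_cons (x : Fin (m + 2)) (v : List (Fin (m + 2))) : mono (x :: v) = mono [x] * mono v :=
  mono_append [x] v

theorem cf_mul (P Q : Poly m) (w : List (Fin (m + 2))) :
    cf (P * Q) w = ∑ k ∈ Finset.range (w.length + 1), cf P (w.take k) * cf Q (w.drop k) := by
  classical
  unfold cf
  have inj : Set.InjOn (fun k => (FreeMonoid.ofList (w.take k), FreeMonoid.ofList (w.drop k)))
      (Finset.range (w.length + 1) : Set ℕ) := by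
    intro i hi j hj h
    simp only [Prod.mk.injEq, EmbeddingLike.apply_eq_iff_eq] at h
    have := congrArg List.length h.1
    simp only [List.length_take, Finset.coe_range, Set.mem_Iio] at this hi hj
    omega
  rw [MonoidAlgebra.coeff_mul_antidiag P Q (FreeMonoid.ofList w)
    ((Finset.range (w.length + 1)).image
      fun k => (FreeMonoid.ofList (w.take k), FreeMonoid.ofList (w.drop k))),
    Finset.sum_image inj]
  rintro ⟨u, v⟩
  simp only [Finset.mem_image, Finset.mem_range, Prod.mk.injEq]
  constructor
  · rintro ⟨k, -, rfl, rfl⟩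
    rw [← FreeMonoid.ofList_append, List.take_append_drop]
  · intro h
    have h' : FreeMonoid.toList u ++ FreeMonoid.toList v = w := h
    refine ⟨(FreeMonoid.toList u).length, ?_, ?_, ?_⟩
    · rw [← h', List.length_append]; omega
    · rw [← h', List.take_left']; rfl; rfl
    · rw [← h', List.drop_left']; rfl; rfl

theorem cf_mul_of_length {P : Poly m} {n : ℕ} (hP : ∀ w, cf P w ≠ 0 → w.length = n) (Q : Poly m)
    (w : List (Fin (m + 2))) : cf (P * Q) w = cf P (w.take n) * cf Q (w.drop n) := by
  rw [cf_mul]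
  by_cases hn : n ≤ w.length
  · apply Finset.sum_eq_single n
    · intro k hk hkn
      by_contra h
      have := hP _ (left_ne_zero_of_mul h)
      simp only [List.length_take, Finset.mem_range] at this hk
      omega
    · intro h
      simp only [Finset.mem_range] at h
      omega
  · have z : ∀ k, cf P (w.take k) = 0 := by
      intro k
      by_contra h
      have := hP _ h
      simp only [List.length_take] at this
      omega
    simp [z]

theorem length_of_cf_mono {u w : List (Fin (m + 2))} (h : cf (mono u) w ≠ 0) :
    w.length = u.length := by
  rw [cf_mono] at h
  have : u = w := by by_contra h'; simp [h'] at h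
  rw [this]

/-! ### The expansion of a tree -/

theorem perm_of_cf_expand {t : FreeMagma (Fin (m + 2))} {w} (h : cf (expand t) w ≠ 0) :
    w.Perm (leaves t) := by
  induction t using FreeMagma.rec generalizing w with
  | of x =>
    change cf (mono [x]) w ≠ 0 at h
    rw [cf_mono] at h
    have : [x] = w := by by_contra h'; simp [h'] at h
    rw [← this]; rfl
  | mul l r hl hr =>
    change cf (expand l * expand r - expand r * expand l) w ≠ 0 at h
    have hl' := fun w h => (hl (w := w) h).length_eq
    have hr' := fun w h => (hr (w := w) h).length_eq
    rw [cf_sub, cf_mul_of_length hl', cf_mul_of_length hr'] at h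
    change w.Perm (leaves l ++ leaves r)
    by_cases h1 : cf (expand l) (w.take (leaves l).length) *
        cf (expand r) (w.drop (leaves l).length) = 0
    · rw [h1, zero_sub, neg_ne_zero] at h
      rw [← List.take_append_drop (leaves r).length w]
      exact ((hr (left_ne_zero_of_mul h)).append (hl (right_ne_zero_of_mul h))).trans
        List.perm_append_comm
    · rw [← List.take_append_drop (leaves l).length w]
      exact (hl (left_ne_zero_of_mul h1)).append (hr (right_ne_zero_of_mul h1))

theorem length_of_cf_expand {t : FreeMagma (Fin (m + 2))} (w) (h : cf (expand t) w ≠ 0) :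
    w.length = (leaves t).length := (perm_of_cf_expand h).length_eq

theorem leaves_length_pos {α : Type*} (t : FreeMagma α) : 0 < (leaves t).length := by
  induction t using FreeMagma.rec with
  | of x => simp [leaves]
  | mul l r hl hr => change 0 < (leaves l ++ leaves r).length; rw [List.length_append]; omega

theorem leaves_mul {α : Type*} (l r : FreeMagma α) :
    leaves (FreeMagma.mul l r) = leaves l ++ leaves r := rfl

theorem expand_mul (l r : FreeMagma (Fin (m + 2))) :
    expand (FreeMagma.mul l r) = expand l * expand r - expand r * expand l := rfl

theorem expand_of (x : Fin (m + 2)) : expand (FreeMagma.of x) = mono [x] := rfl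

theorem cf_expand_mul (l r : FreeMagma (Fin (m + 2))) (w) :
    cf (expand (FreeMagma.mul l r)) w =
      cf (expand l) (w.take (leaves l).length) * cf (expand r) (w.drop (leaves l).length) -
      cf (expand r) (w.take (leaves r).length) * cf (expand l) (w.drop (leaves r).length) := by
  rw [expand_mul, cf_sub, cf_mul_of_length length_of_cf_expand,
    cf_mul_of_length length_of_cf_expand]

theorem cf_expand_leaves {t : FreeMagma (Fin (m + 2))} (h : (leaves t).Nodup) :
    cf (expand t) (leaves t) = 1 := by
  induction t using FreeMagma.rec with
  | of x => exact (cf_mono [x] [x]).trans (by simp)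
  | mul l r hl hr =>
    rw [leaves_mul] at h ⊢
    have h' := List.nodup_append.1 h
    rw [cf_expand_mul, List.take_left, List.drop_left, hl h'.1, hr h'.2.1]
    have z : cf (expand r) ((leaves l ++ leaves r).take (leaves r).length) = 0 := by
      by_contra hz
      have p := perm_of_cf_expand hz
      have hl0 := leaves_length_pos l
      have hr0 := leaves_length_pos r
      have : (leaves l)[0] ∈ (leaves l ++ leaves r).take (leaves r).length := by
        rw [List.mem_iff_getElem]
        refine ⟨0, by simp; omega, ?_⟩
        simp [List.getElem_append_left, hl0]
      exact h'.2.2 _ (List.getElem_mem hl0) _ (p.subset this) rfl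
    rw [z]; simp

/-- If the word `w` occurs in a Lie monomial, then the tree has a planar embedding with leaf order
`w`; reversing brackets changes the Lie polynomial by a sign and keeps the propagators. -/
theorem exists_planar {t : FreeMagma (Fin (m + 2))} {w} (h : cf (expand t) w ≠ 0) :
    ∃ t', leaves t' = w ∧ (∃ ε : ℤˣ, expand t = ((ε : ℤ) : ℂ) • expand t') ∧
      ∀ S : Finset (Fin (m + 2)), (∃ s ∈ subtrees t, (leaves s).toFinset = S) ↔
        ∃ s ∈ subtrees t', (leaves s).toFinset = S := by
  induction t using FreeMagma.rec generalizing w with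
  | of x =>
    rw [expand_of, cf_mono] at h
    have : [x] = w := by by_contra h'; simp [h'] at h
    exact ⟨.of x, this, ⟨1, by simp⟩, fun S => Iff.rfl⟩
  | mul l r hl hr =>
    rw [cf_expand_mul] at h
    have key : ∀ (l' r' : FreeMagma (Fin (m + 2))) (S : Finset (Fin (m + 2))),
        (∃ s ∈ subtrees (FreeMagma.mul l' r'), (leaves s).toFinset = S) ↔
          (leaves l').toFinset ∪ (leaves r').toFinset = S ∨
            (∃ s ∈ subtrees l', (leaves s).toFinset = S) ∨
            (∃ s ∈ subtrees r', (leaves s).toFinset = S) := by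
      intro l' r' S
      simp only [subtrees, List.mem_cons, List.mem_append, or_and_right, exists_or,
        exists_eq_left, leaves_mul, List.toFinset_append]
    by_cases h1 : cf (expand l) (w.take (leaves l).length) *
        cf (expand r) (w.drop (leaves l).length) = 0
    · rw [h1, zero_sub, neg_ne_zero] at h
      have pl := List.toFinset_eq_of_perm _ _ (perm_of_cf_expand (right_ne_zero_of_mul h))
      have pr := List.toFinset_eq_of_perm _ _ (perm_of_cf_expand (left_ne_zero_of_mul h))
      obtain ⟨r', hr1, ⟨εr, hr2⟩, hr3⟩ := hr (left_ne_zero_of_mul h)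
      obtain ⟨l', hl1, ⟨εl, hl2⟩, hl3⟩ := hl (right_ne_zero_of_mul h)
      refine ⟨.mul r' l', ?_, ⟨-(εl * εr), ?_⟩, fun S => ?_⟩
      · rw [leaves_mul, hr1, hl1, List.take_append_drop]
      · rw [expand_mul, expand_mul, hl2, hr2]
        simp only [smul_mul_smul_comm, smul_sub]
        push_cast
        simp only [neg_smul, mul_comm]
        abel
      · rw [key, key, hl3, hr3, hr1, hl1, pl, pr, Finset.union_comm, or_comm (a := ∃ s ∈ subtrees l', _)]
    · have pl := List.toFinset_eq_of_perm _ _ (perm_of_cf_expand (left_ne_zero_of_mul h1))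
      have pr := List.toFinset_eq_of_perm _ _ (perm_of_cf_expand (right_ne_zero_of_mul h1))
      obtain ⟨l', hl1, ⟨εl, hl2⟩, hl3⟩ := hl (left_ne_zero_of_mul h1)
      obtain ⟨r', hr1, ⟨εr, hr2⟩, hr3⟩ := hr (right_ne_zero_of_mul h1)
      refine ⟨.mul l' r', ?_, ⟨εl * εr, ?_⟩, fun S => ?_⟩
      · rw [leaves_mul, hr1, hl1, List.take_append_drop]
      · rw [expand_mul, expand_mul, hl2, hr2]
        simp only [smul_mul_smul_comm, smul_sub]
        push_cast
        simp only [mul_comm]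
      · rw [key, key, hl3, hr3, hr1, hl1, pl, pr]

end Words

/-! ### Combs span the Lie polynomials -/

section Combs
variable {m : ℕ}

/-- The iterated commutator `[[…[x, l(1)], l(2)], …]`. -/
def combPoly (x : Fin (m + 2)) (l : List (Fin (m + 2))) : Poly m :=
  l.foldl (fun P y => P * mono [y] - mono [y] * P) (mono [x])

theorem combPoly_concat (x y : Fin (m + 2)) (l : List (Fin (m + 2))) :
    combPoly x (l ++ [y]) = combPoly x l * mono [y] - mono [y] * combPoly x l := by
  simp [combPoly, List.foldl_append]

theorem expand_foldl (l : List (Fin (m + 2))) (t : FreeMagma (Fin (m + 2))) :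
    expand (l.foldl (fun t x => FreeMagma.mul t (FreeMagma.of x)) t) =
      l.foldl (fun P y => P * mono [y] - mono [y] * P) (expand t) := by
  induction l generalizing t with
  | nil => rfl
  | cons x l ih => rw [List.foldl_cons, ih]; rfl

theorem expand_combTree (a : Equiv.Perm (Fin (m + 2))) :
    expand (combTree a) = combPoly (a 0) (List.ofFn fun i : Fin (m + 1) => a i.succ) := by
  rw [combTree, expand_foldl]; rfl

theorem length_of_cf_combPoly {x : Fin (m + 2)} {l} (w) (h : cf (combPoly x l) w ≠ 0) :
    w.length = l.length + 1 := by
  have e : combPoly x l = expand (l.foldl (fun t x => FreeMagma.mul t (FreeMagma.of x)) (.of x)) := by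
    rw [expand_foldl]; rfl
  rw [e] at h
  rw [length_of_cf_expand w h, leaves_foldl]
  simp [leaves]

/-- The combs `[…[x, l(1)], …]` and the words `x l(1) ⋯` are dual to each other. -/
theorem cf_combPoly {x : Fin (m + 2)} {l : List (Fin (m + 2))} (hx : x ∉ l) (l') :
    cf (combPoly x l) (x :: l') = if l = l' then 1 else 0 := by
  induction l using List.reverseRecOn generalizing l' with
  | nil => exact (cf_mono [x] (x :: l')).trans (by simp)
  | append_singleton l y ih =>
    simp only [List.mem_append, List.mem_singleton, not_or] at hx
    rw [combPoly_concat, cf_sub, cf_mul_of_length length_of_cf_combPoly,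
      cf_mul_of_length (fun w h => length_of_cf_mono h)]
    simp only [List.take_succ_cons, List.drop_succ_cons, List.length_singleton, List.take_zero,
      List.drop_zero]
    rw [ih hx.1, cf_mono, cf_mono, if_neg (c := [y] = [x]) (by simpa using Ne.symm hx.2), zero_mul,
      sub_zero]
    by_cases h : l ++ [y] = l'
    · subst h; simp
    · rw [if_neg h]
      by_cases h1 : l = l'.take l.length
      · rw [if_neg (c := [y] = _), mul_zero]
        intro h2
        apply h
        conv_rhs => rw [← List.take_append_drop l.length l', ← h1, ← h2]
      · rw [if_neg h1, zero_mul]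

/-- The span of the combs starting with `x` whose further letters are those of `S`. -/
def combSpan (x : Fin (m + 2)) (S : List (Fin (m + 2))) : Submodule ℂ (Poly m) :=
  Submodule.span ℂ {P | ∃ l : List (Fin (m + 2)), l.Perm S ∧ combPoly x l = P}

theorem combSpan_perm (x : Fin (m + 2)) {S S' : List (Fin (m + 2))} (h : S.Perm S') :
    combSpan x S = combSpan x S' := by
  unfold combSpan
  congr 1
  ext P
  exact ⟨fun ⟨l, hl, e⟩ => ⟨l, hl.trans h, e⟩, fun ⟨l, hl, e⟩ => ⟨l, hl.trans h.symm, e⟩⟩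

/-- Bracketing with a Lie monomial preserves combs, by the Jacobi identity
`[X, [r, s]] = [[X, r], s] - [[X, s], r]`. -/
theorem commutator_mem_combSpan (r : FreeMagma (Fin (m + 2))) {x : Fin (m + 2)} {S} {P : Poly m}
    (hP : P ∈ combSpan x S) : P * expand r - expand r * P ∈ combSpan x (S ++ leaves r) := by
  induction r using FreeMagma.rec generalizing P S with
  | of y =>
    unfold combSpan at hP
    induction hP using Submodule.span_induction with
    | mem P h =>
      obtain ⟨l, hl, rfl⟩ := h
      exact Submodule.subset_span ⟨l ++ [y], hl.append (List.Perm.refl _), combPoly_concat x y l⟩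
    | zero => simp
    | add P Q _ _ hP hQ =>
      have := Submodule.add_mem _ hP hQ
      rwa [show (P + Q) * expand (.of y) - expand (.of y) * (P + Q) =
        P * expand (.of y) - expand (.of y) * P + (Q * expand (.of y) - expand (.of y) * Q) by
        noncomm_ring]
    | smul c P _ hP =>
      have := Submodule.smul_mem _ c hP
      rwa [smul_mul_assoc, mul_smul_comm, ← smul_sub]
  | mul r s hr hs =>
    have h1 := hs (hr hP)
    have h2 := hr (hs hP)
    rw [List.append_assoc] at h1 h2
    rw [combSpan_perm x ((List.Perm.refl S).append (List.perm_append_comm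
      (l₁ := leaves s) (l₂ := leaves r)))] at h2
    have := Submodule.sub_mem _ h1 h2
    rw [leaves_mul, expand_mul]
    convert this using 1
    noncomm_ring

theorem expand_mem_combSpan {t : FreeMagma (Fin (m + 2))} {x : Fin (m + 2)} (h : x ∈ leaves t) :
    expand t ∈ combSpan x ((leaves t).erase x) := by
  induction t using FreeMagma.rec with
  | of y =>
    have : x = y := by simpa [leaves] using h
    subst this
    exact Submodule.subset_span ⟨[], by simp [leaves], rfl⟩
  | mul l r hl hr =>
    rw [leaves_mul] at h ⊢
    by_cases hx : x ∈ leaves l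
    · rw [List.erase_append_left _ hx]
      exact commutator_mem_combSpan r (hl hx)
    · rw [List.erase_append_right _ hx, combSpan_perm x List.perm_append_comm, expand_mul,
        ← neg_sub]
      exact Submodule.neg_mem _
        (commutator_mem_combSpan l (hr ((List.mem_append.1 h).resolve_left hx)))

theorem exists_perm_of_perm_finRange {w : List (Fin (m + 2))} (h : w.Perm (List.finRange (m + 2))) :
    ∃ a : Equiv.Perm (Fin (m + 2)), List.ofFn a = w := by
  have hl : w.length = m + 2 := by simpa using h.length_eq
  have nd : w.Nodup := h.nodup_iff.2 (List.nodup_finRange _)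
  have inj : Function.Injective fun i : Fin (m + 2) => w.get (i.cast hl.symm) := fun i j hij => by
    have := List.nodup_iff_injective_get.1 nd hij
    simpa [Fin.ext_iff] using this
  refine ⟨Equiv.ofBijective _ (Finite.injective_iff_bijective.1 inj), ?_⟩
  apply List.ext_getElem
  · simp [hl]
  · intro i h1 h2
    simp only [List.getElem_ofFn]
    rfl

theorem ofFn_perm_finRange (a : Equiv.Perm (Fin (m + 2))) :
    (List.ofFn a).Perm (List.finRange (m + 2)) := by
  have := (comb a).2
  rwa [show (comb a).1 = combTree a from rfl, leaves_combTree] at this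

theorem ofFn_eq_cons (a : Equiv.Perm (Fin (m + 2))) :
    List.ofFn a = a 0 :: List.ofFn fun i : Fin (m + 1) => a i.succ := by
  rw [List.ofFn_succ]

/-- A Lie polynomial is determined by the coefficients of the words starting with the first letter,
which are its coordinates with respect to the combs. -/
theorem eq_sum_comb {P : Poly m} (hP : P ∈ Lie m) :
    P = ∑ a : {a : Equiv.Perm (Fin (m + 2)) // a 0 = 0},
      cf P (List.ofFn a.1) • expand (combTree a.1) := by
  have hP' : P ∈ combSpan 0 ((List.finRange (m + 2)).erase 0) := by
    refine (Submodule.span_le (p := combSpan 0 ((List.finRange (m + 2)).erase 0))).2 ?_ hP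
    rintro _ ⟨Γ, rfl⟩
    rw [← combSpan_perm 0 (Γ.2.erase 0)]
    exact expand_mem_combSpan (Γ.2.symm.subset (List.mem_finRange 0))
  clear hP
  unfold combSpan at hP'
  induction hP' using Submodule.span_induction with
  | mem P h =>
    obtain ⟨l, hl, rfl⟩ := h
    have p0 : (0 :: l).Perm (List.finRange (m + 2)) :=
      (hl.cons 0).trans (List.perm_cons_erase (List.mem_finRange 0)).symm
    have nd : (0 :: l).Nodup := p0.nodup_iff.2 (List.nodup_finRange _)
    obtain ⟨a, ha⟩ := exists_perm_of_perm_finRange p0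
    rw [ofFn_eq_cons] at ha
    have ha0 : a 0 = 0 := (List.cons.inj ha).1
    have hal := (List.cons.inj ha).2
    rw [Finset.sum_eq_single (⟨a, ha0⟩ : {a : Equiv.Perm (Fin (m + 2)) // a 0 = 0})]
    · rw [expand_combTree, ofFn_eq_cons, ha0, hal, cf_combPoly (List.nodup_cons.1 nd).1]
      simp
    · rintro ⟨b, hb⟩ - hne
      rw [ofFn_eq_cons]
      dsimp only
      rw [hb, cf_combPoly (List.nodup_cons.1 nd).1, if_neg, zero_smul]
      intro h
      apply hne
      apply Subtype.ext
      apply Equiv.ext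
      intro i
      have : List.ofFn b = List.ofFn a := by
        rw [ofFn_eq_cons, ofFn_eq_cons, ha0, hb, hal, ← h]
      exact congrFun (List.ofFn_injective this) i
    · simp
  | zero => simp
  | add P Q _ _ hP hQ =>
    simp only [cf_add, add_smul, Finset.sum_add_distrib]
    rw [← hP, ← hQ]
  | smul c P _ hP =>
    simp only [cf_smul, mul_smul, ← Finset.smul_sum]
    rw [← hP]

theorem wordDual_apply (a : Equiv.Perm (Fin (m + 2))) (L : Lie m) :
    wordDual a L = cf L (List.ofFn a) := rfl

theorem wordDual_comb (a b : {a : Equiv.Perm (Fin (m + 2)) // a 0 = 0}) :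
    wordDual a.1 (comb b.1).toLie = if a = b then 1 else 0 := by
  have nd : (List.ofFn b.1).Nodup := List.nodup_ofFn.2 b.1.injective
  rw [ofFn_eq_cons, b.2] at nd
  rw [wordDual_apply, show (((comb b.1).toLie : Lie m) : Poly m) = expand (combTree b.1) from rfl,
    expand_combTree, ofFn_eq_cons, a.2, b.2, cf_combPoly (List.nodup_cons.1 nd).1]
  congr 1
  apply propext
  constructor
  · intro h
    have : List.ofFn b.1 = List.ofFn a.1 := by rw [ofFn_eq_cons, ofFn_eq_cons, a.2, b.2, h]
    exact Subtype.ext (Equiv.ext fun i => congrFun (List.ofFn_injective this.symm) i)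
  · rintro rfl; rfl

end Combs

/-! ### The relations between Parke-Taylor factors -/

section Theta
variable {m : ℕ} (σ : Fin (m + 2) → ℂ)

/-- The Parke-Taylor denominator `∏ (σ_{w(i)} - σ_{w(i+1)})` of a word `w`. -/
def den : List (Fin (m + 2)) → ℂ
  | [] => 1
  | [_] => 1
  | x :: y :: l => (σ x - σ y) * den (y :: l)

/-- The tree in which the leaf `j` is replaced by the cherry `(j, i)`. -/
def graft (j i : Fin (m + 2)) : FreeMagma (Fin (m + 2)) → FreeMagma (Fin (m + 2))
  | FreeMagma.of y => if y = j then FreeMagma.mul (.of j) (.of i) else .of y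
  | FreeMagma.mul l r => FreeMagma.mul (graft j i l) (graft j i r)

/-- The substitution `x_j ↦ [x_j, x_i]`. -/
def subst (j i : Fin (m + 2)) : Poly m →ₐ[ℂ] Poly m :=
  MonoidAlgebra.lift ℂ (Poly m) (FreeMonoid (Fin (m + 2)))
    (FreeMonoid.lift fun y => if y = j then mono [j, i] - mono [i, j] else mono [y])

theorem subst_mono_singleton (j i y : Fin (m + 2)) :
    subst j i (mono [y]) = if y = j then mono [j, i] - mono [i, j] else mono [y] := by
  simp [subst, mono]

theorem subst_mono_of_notMem {j i : Fin (m + 2)} {l : List (Fin (m + 2))} (h : j ∉ l) :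
    subst j i (mono l) = mono l := by
  induction l with
  | nil => exact map_one (subst j i)
  | cons x l ih =>
    simp only [List.mem_cons, not_or] at h
    rw [mono_cons, map_mul, ih h.2, subst_mono_singleton, if_neg (Ne.symm h.1)]

theorem expand_graft (j i : Fin (m + 2)) (t : FreeMagma (Fin (m + 2))) :
    expand (graft j i t) = subst j i (expand t) := by
  induction t using FreeMagma.rec with
  | of y =>
    rw [expand_of, subst_mono_singleton]
    unfold graft
    split_ifs
    · rw [expand_mul, expand_of, expand_of, ← mono_append, ← mono_append]; rfl
    · rfl
  | mul l r hl hr =>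
    change expand (FreeMagma.mul (graft j i l) (graft j i r)) = _
    rw [expand_mul, expand_mul, hl, hr, map_sub, map_mul, map_mul]

theorem leaves_graft (j i : Fin (m + 2)) (t : FreeMagma (Fin (m + 2))) :
    leaves (graft j i t) = (leaves t).flatMap fun y => if y = j then [j, i] else [y] := by
  induction t using FreeMagma.rec with
  | of y =>
    unfold graft
    split_ifs with h <;> simp [leaves, h]
  | mul l r hl hr =>
    change leaves (FreeMagma.mul (graft j i l) (graft j i r)) = _
    rw [leaves_mul, leaves_mul, hl, hr, List.flatMap_append]

theorem leaves_graft_of_notMem {j i : Fin (m + 2)} {t : FreeMagma (Fin (m + 2))}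
    (h : j ∉ leaves t) : leaves (graft j i t) = leaves t := by
  rw [leaves_graft]
  have : ∀ l : List (Fin (m + 2)), j ∉ l →
      (l.flatMap fun y => if y = j then [j, i] else [y]) = l := by
    intro l hl
    induction l with
    | nil => rfl
    | cons x l ih =>
      simp only [List.mem_cons, not_or] at hl
      rw [List.flatMap_cons, ih hl.2, if_neg (Ne.symm hl.1)]; rfl
  exact this _ h

theorem leaves_graft_perm {j i : Fin (m + 2)} {t : FreeMagma (Fin (m + 2))}
    (h : j ∈ leaves t) (nd : (leaves t).Nodup) :
    (leaves (graft j i t)).Perm (i :: leaves t) := by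
  induction t using FreeMagma.rec with
  | of y =>
    have : y = j := by simpa [leaves, eq_comm] using h
    subst this
    simp only [graft, if_true]
    exact List.Perm.swap i y []
  | mul l r hl hr =>
    change (leaves (graft j i l) ++ leaves (graft j i r)).Perm (i :: (leaves l ++ leaves r))
    rw [leaves_mul] at h nd
    have nd' := List.nodup_append.1 nd
    rcases List.mem_append.1 h with hj | hj
    · have hr' : j ∉ leaves r := fun hjr => nd'.2.2 _ hj _ hjr rfl
      rw [leaves_graft_of_notMem hr']
      exact (hl hj nd'.1).append_right _
    · have hl' : j ∉ leaves l := fun hjl => nd'.2.2 _ hjl _ hj rfl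
      rw [leaves_graft_of_notMem hl']
      exact ((hr hj nd'.2.1).append_left _).trans List.perm_middle

theorem list_sum_smul {ι : Type*} (c : ℂ) (l : List ι) (f : ι → Poly m) :
    (l.map fun i => c • f i).sum = c • (l.map f).sum := by
  induction l with
  | nil => simp
  | cons a l ih => simp [ih]

theorem list_sum_mul_left {ι : Type*} (c : Poly m) (l : List ι) (f : ι → Poly m) :
    (l.map fun i => c * f i).sum = c * (l.map f).sum := by
  induction l with
  | nil => simp
  | cons a l ih => simp [ih, mul_add]

variable {σ}

theorem sum_insert_aux (hσ : Function.Injective σ) (i : Fin (m + 2)) (ys : List (Fin (m + 2)))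
    (x : Fin (m + 2)) (nd : (x :: ys).Nodup) (hi : i ∉ x :: ys) :
    ((List.permutations'Aux i ys).map fun b => (den σ (x :: b))⁻¹ • mono (x :: b)).sum =
      (den σ (x :: ys))⁻¹ • ((σ x - σ i)⁻¹ • mono (x :: i :: ys) +
        mono [x] * (ys.map fun j => (σ j - σ i)⁻¹ • subst j i (mono ys)).sum) := by
  induction ys generalizing x with
  | nil => simp [den]
  | cons y ys ih =>
    have nd' := List.nodup_cons.1 nd
    have hi' : i ∉ y :: ys := fun h => hi (List.mem_cons_of_mem _ h)
    have ndy := List.nodup_cons.1 nd'.2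
    simp only [List.mem_cons, not_or] at hi nd'
    have e1 : ((List.permutations'Aux i ys).map fun b =>
        (den σ (x :: y :: b))⁻¹ • mono (x :: y :: b)).sum = (σ x - σ y)⁻¹ • (mono [x] *
        ((List.permutations'Aux i ys).map fun b => (den σ (y :: b))⁻¹ • mono (y :: b)).sum) := by
      rw [← list_sum_mul_left, ← list_sum_smul]
      congr 1
      apply List.map_congr_left
      intro b _
      rw [den, mul_inv, mono_cons x, mul_smul_comm, smul_smul]
    have e2 : (ys.map fun j => (σ j - σ i)⁻¹ • subst j i (mono (y :: ys))).sum =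
        mono [y] * (ys.map fun j => (σ j - σ i)⁻¹ • subst j i (mono ys)).sum := by
      rw [← list_sum_mul_left]
      congr 1
      apply List.map_congr_left
      intro j hj
      have : y ≠ j := by rintro rfl; exact ndy.1 hj
      rw [mono_cons, map_mul, subst_mono_singleton, if_neg this, mul_smul_comm]
    rw [List.permutations'Aux, List.map_cons, List.sum_cons, List.map_map,
      show ((fun b => (den σ (x :: b))⁻¹ • mono (x :: b)) ∘ List.cons y) =
        fun b => (den σ (x :: y :: b))⁻¹ • mono (x :: y :: b) from rfl, e1,
      ih y nd'.2 hi', List.map_cons, List.sum_cons, e2, mono_cons y ys, map_mul,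
      subst_mono_singleton, if_pos rfl, subst_mono_of_notMem ndy.1]
    have hxi : σ x - σ i ≠ 0 := sub_ne_zero.2 fun h => hi.1 (hσ h).symm
    have hyi : σ y - σ i ≠ 0 := sub_ne_zero.2 fun h => hi.2.1 (hσ h).symm
    have hiy : σ i - σ y ≠ 0 := sub_ne_zero.2 fun h => hi.2.1 (hσ h)
    have hxy : σ x - σ y ≠ 0 := sub_ne_zero.2 fun h => nd'.1.1 (hσ h)
    set T := (ys.map fun j => (σ j - σ i)⁻¹ • subst j i (mono ys)).sum
    have em1 : ∀ u v : Fin (m + 2), mono [u, v] = mono [u] * mono [v] := fun u v => mono_cons u [v]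
    have em2 : ∀ u v w : Fin (m + 2), mono (u :: v :: w :: ys) =
        mono [u] * (mono [v] * (mono [w] * mono ys)) := fun u v w => by
      rw [mono_cons u, mono_cons v, mono_cons w]
    have em3 : ∀ u v : Fin (m + 2), mono (u :: v :: ys) =
        mono [u] * (mono [v] * mono ys) := fun u v => by rw [mono_cons u, mono_cons v]
    simp only [den, mul_inv, em1, em2, em3]
    simp only [smul_add, smul_sub, mul_add, mul_sub, sub_mul, mul_smul_comm, smul_smul, mul_assoc]
    have hc : (σ x - σ i)⁻¹ * ((σ i - σ y)⁻¹ * (den σ (y :: ys))⁻¹) =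
        (σ x - σ y)⁻¹ * ((den σ (y :: ys))⁻¹ * (σ x - σ i)⁻¹) -
        (σ x - σ y)⁻¹ * ((den σ (y :: ys))⁻¹ * (σ y - σ i)⁻¹) := by
      rw [← neg_sub (σ y) (σ i), inv_neg]
      field_simp
      ring
    rw [hc, sub_smul]
    abel

/-- The generating polynomial of the Parke-Taylor factors of the words in the letters `L`. -/
def theta (σ : Fin (m + 2) → ℂ) (L : List (Fin (m + 2))) : Poly m :=
  ((List.permutations' L).map fun b => (den σ b)⁻¹ • mono b).sum

theorem sum_insert (hσ : Function.Injective σ) (i : Fin (m + 2)) (ys : List (Fin (m + 2)))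
    (nd : ys.Nodup) (hi : i ∉ ys) (h0 : ys ≠ []) :
    ((List.permutations'Aux i ys).map fun b => (den σ b)⁻¹ • mono b).sum =
      (ys.map fun j => (σ j - σ i)⁻¹ • subst j i ((den σ ys)⁻¹ • mono ys)).sum := by
  cases ys with
  | nil => exact absurd rfl h0
  | cons y ys =>
    have ndy := List.nodup_cons.1 nd
    have e2 : (ys.map fun j => (σ j - σ i)⁻¹ • subst j i ((den σ (y :: ys))⁻¹ • mono (y :: ys))).sum =
        (den σ (y :: ys))⁻¹ •
          (mono [y] * (ys.map fun j => (σ j - σ i)⁻¹ • subst j i (mono ys)).sum) := by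
      rw [← list_sum_mul_left, ← list_sum_smul]
      congr 1
      apply List.map_congr_left
      intro j hj
      have : y ≠ j := by rintro rfl; exact ndy.1 hj
      rw [map_smul, mono_cons, map_mul, subst_mono_singleton, if_neg this, mul_smul_comm,
        smul_comm]
    rw [List.permutations'Aux, List.map_cons, List.sum_cons, List.map_map,
      show ((fun b => (den σ b)⁻¹ • mono b) ∘ List.cons y) =
        fun b => (den σ (y :: b))⁻¹ • mono (y :: b) from rfl,
      sum_insert_aux hσ i ys y nd hi, List.map_cons, List.sum_cons, e2, map_smul,
      mono_cons y ys, map_mul, subst_mono_singleton, if_pos rfl, subst_mono_of_notMem ndy.1]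
    have em1 : ∀ u v : Fin (m + 2), mono [u, v] = mono [u] * mono [v] := fun u v => mono_cons u [v]
    have em3 : ∀ u v : Fin (m + 2), mono (u :: v :: ys) =
        mono [u] * (mono [v] * mono ys) := fun u v => by rw [mono_cons u, mono_cons v]
    simp only [den, mul_inv, em1, em3]
    simp only [smul_add, smul_sub, sub_mul, smul_smul, mul_assoc]
    rw [← neg_sub (σ y) (σ i), inv_neg, neg_mul, neg_smul, mul_comm (σ y - σ i)⁻¹]
    abel

/-- Inserting a letter: `Θ_{i, L} = ∑_{j ∈ L} (σ_j - σ_i)⁻¹ Θ_L|_{x_j ↦ [x_j, x_i]}`, by partial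
fractions in `σ_i`. -/
theorem theta_cons (hσ : Function.Injective σ) (i : Fin (m + 2)) (L : List (Fin (m + 2)))
    (nd : (i :: L).Nodup) (h0 : L ≠ []) :
    theta σ (i :: L) = (L.map fun j => (σ j - σ i)⁻¹ • subst j i (theta σ L)).sum := by
  have ndL := List.nodup_cons.1 nd
  have h1 : ∀ b ∈ List.permutations' L,
      ((List.permutations'Aux i b).map fun b => (den σ b)⁻¹ • mono b).sum =
      (L.map fun j => (σ j - σ i)⁻¹ • subst j i ((den σ b)⁻¹ • mono b)).sum := by
    intro b hb
    have p := List.mem_permutations'.1 hb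
    rw [sum_insert hσ i b (p.nodup_iff.2 ndL.2) (fun h => ndL.1 (p.subset h))
      (fun h => h0 (by simpa [h] using p))]
    exact (p.map _).sum_eq
  have h2 : ∀ l : List (List (Fin (m + 2))), (∀ b ∈ l,
      ((List.permutations'Aux i b).map fun b => (den σ b)⁻¹ • mono b).sum =
      (L.map fun j => (σ j - σ i)⁻¹ • subst j i ((den σ b)⁻¹ • mono b)).sum) →
      ((l.flatMap (List.permutations'Aux i)).map fun b => (den σ b)⁻¹ • mono b).sum =
      (L.map fun j => (σ j - σ i)⁻¹ •
        subst j i ((l.map fun b => (den σ b)⁻¹ • mono b).sum)).sum := by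
    intro l hl
    induction l with
    | nil => simp
    | cons b l ih =>
      rw [List.flatMap_cons, List.map_append, List.sum_append,
        ih fun b hb => hl b (List.mem_cons_of_mem _ hb), hl b List.mem_cons_self, List.map_cons,
        List.sum_cons]
      simp only [map_add, smul_add, List.sum_map_add]
  exact h2 _ h1

/-- The span of the Lie monomials of weight one in each of the letters of `L`. -/
def lieSpan (L : List (Fin (m + 2))) : Submodule ℂ (Poly m) :=
  Submodule.span ℂ {P | ∃ t : FreeMagma (Fin (m + 2)), (leaves t).Perm L ∧ expand t = P}

theorem subst_mem_lieSpan {i j : Fin (m + 2)} {L : List (Fin (m + 2))} (nd : L.Nodup) (hj : j ∈ L)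
    {P : Poly m} (hP : P ∈ lieSpan L) : subst j i P ∈ lieSpan (i :: L) := by
  have : lieSpan L ≤ (lieSpan (i :: L)).comap (subst j i).toLinearMap := by
    refine Submodule.span_le.2 ?_
    rintro _ ⟨t, ht, rfl⟩
    refine Submodule.subset_span ⟨graft j i t, ?_, expand_graft j i t⟩
    exact (leaves_graft_perm (ht.symm.subset hj) (ht.nodup_iff.2 nd)).trans (ht.cons i)
  exact this hP

theorem theta_mem_lieSpan (hσ : Function.Injective σ) (L : List (Fin (m + 2))) (nd : L.Nodup)
    (h0 : L ≠ []) : theta σ L ∈ lieSpan L := by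
  induction L with
  | nil => exact absurd rfl h0
  | cons i L ih =>
    by_cases hL : L = []
    · subst hL
      refine Submodule.subset_span ⟨.of i, List.Perm.refl _, ?_⟩
      simp [theta, den, expand_of]
    · rw [theta_cons hσ i L nd hL]
      apply list_sum_mem
      intro P hP
      obtain ⟨j, hj, rfl⟩ := List.mem_map.1 hP
      have nd' := (List.nodup_cons.1 nd).2
      exact Submodule.smul_mem _ _ (subst_mem_lieSpan nd' hj (ih nd' hL))

theorem cf_theta {L : List (Fin (m + 2))} (nd : L.Nodup) {b : List (Fin (m + 2))}
    (hb : b.Perm L) : cf (theta σ L) b = (den σ b)⁻¹ := by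
  have h1 : ∀ l : List (List (Fin (m + 2))), l.Nodup →
      cf ((l.map fun b => (den σ b)⁻¹ • mono b).sum) b = if b ∈ l then (den σ b)⁻¹ else 0 := by
    intro l hl
    induction l with
    | nil => simp
    | cons c l ih =>
      have hc := List.nodup_cons.1 hl
      rw [List.map_cons, List.sum_cons, cf_add, ih hc.2, cf_smul, cf_mono]
      by_cases h : c = b
      · subst h; simp [hc.1]
      · simp [h, Ne.symm h]
  rw [theta, h1 _ (((List.permutations_perm_permutations' L).nodup_iff.1 (List.nodup_permutations L nd))), if_pos (List.mem_permutations'.2 hb)]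

/-- The Parke-Taylor factors satisfy the relations between words in `Lie(n-1)^*`. -/
theorem inv_den_eq_sum (hσ : Function.Injective σ) (b : Equiv.Perm (Fin (m + 2))) :
    (den σ (List.ofFn b))⁻¹ = ∑ a : {a : Equiv.Perm (Fin (m + 2)) // a 0 = 0},
      wordDual b (comb a.1).toLie * (den σ (List.ofFn a.1))⁻¹ := by
  have nd := List.nodup_finRange (m + 2)
  have h0 : List.finRange (m + 2) ≠ [] := by
    intro h; have := congrArg List.length h; simp at this
  have hm : theta σ (List.finRange (m + 2)) ∈ Lie m := by
    have h := theta_mem_lieSpan hσ _ nd h0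
    refine (Submodule.span_le (p := Lie m)).2 ?_ h
    rintro _ ⟨t, ht, rfl⟩
    exact Submodule.subset_span ⟨⟨t, ht⟩, rfl⟩
  have h := congrArg (fun P => cf P (List.ofFn b)) (eq_sum_comb hm)
  simp only [cf_theta nd (ofFn_perm_finRange b), cf_sum, cf_smul,
    cf_theta nd (ofFn_perm_finRange _)] at h
  rw [h]
  exact Finset.sum_congr rfl fun a _ => mul_comm _ _

end Theta

/-! ### Wedge products and determinants of linear forms -/

section Wedge
variable {E : Type*} [AddCommGroup E] [Module ℝ E] {k l : ℕ}

/-- The contribution to `(α ∧ β)(v)` of a coset of permutations, i.e. of a shuffle. -/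
def shuffleTerm (α : Form E k) (β : Form E l) (v : Fin (k + l) → E)
    (σ : Equiv.Perm.ModSumCongr (Fin k) (Fin l)) : ℂ :=
  LinearMap.mul' ℝ ℂ (AlternatingMap.domCoprod.summand α β σ fun i => v (finSumFinEquiv i))

theorem wedge_apply (α : Form E k) (β : Form E l) (v : Fin (k + l) → E) :
    wedge α β v = ∑ σ, shuffleTerm α β v σ := by
  change LinearMap.mul' ℝ ℂ ((α.domCoprod β) fun i => v (finSumFinEquiv i)) = _
  rw [AlternatingMap.domCoprod_apply, sum_apply, map_sum]
  rfl

theorem shuffleTerm_mk (α : Form E k) (β : Form E l) (v : Fin (k + l) → E)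
    (σ : Equiv.Perm (Fin k ⊕ Fin l)) :
    shuffleTerm α β v (Quotient.mk'' σ) = ((Equiv.Perm.sign σ : ℤ) : ℂ) *
      (α (fun i => v (finSumFinEquiv (σ (Sum.inl i)))) *
        β fun i => v (finSumFinEquiv (σ (Sum.inr i)))) := by
  unfold shuffleTerm
  rw [AlternatingMap.domCoprod.summand_mk'', smul_apply, MultilinearMap.domDomCongr_apply,
    MultilinearMap.domCoprod_apply, Units.smul_def, map_zsmul, LinearMap.mul'_apply, zsmul_eq_mul]
  rfl

theorem form_sum_apply {κ : Type*} (s : Finset κ) (f : κ → Form E k) (v : Fin k → E) :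
    (∑ i ∈ s, f i) v = ∑ i ∈ s, f i v := by
  classical
  induction s using Finset.induction_on with
  | empty => simp
  | insert a s ha ih => rw [Finset.sum_insert ha, Finset.sum_insert ha, AlternatingMap.add_apply, ih]

theorem wedge_smul_left (c : ℂ) (α : Form E k) (β : Form E l) :
    wedge (c • α) β = c • wedge α β := by
  ext v
  rw [AlternatingMap.smul_apply, wedge_apply, wedge_apply, Finset.smul_sum]
  refine Finset.sum_congr rfl fun σ _ => ?_
  induction σ using Quotient.inductionOn' with | _ σ
  rw [shuffleTerm_mk, shuffleTerm_mk, AlternatingMap.smul_apply]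
  simp only [smul_eq_mul]; ring

theorem wedge_smul_right (c : ℂ) (α : Form E k) (β : Form E l) :
    wedge α (c • β) = c • wedge α β := by
  ext v
  rw [AlternatingMap.smul_apply, wedge_apply, wedge_apply, Finset.smul_sum]
  refine Finset.sum_congr rfl fun σ _ => ?_
  induction σ using Quotient.inductionOn' with | _ σ
  rw [shuffleTerm_mk, shuffleTerm_mk, AlternatingMap.smul_apply]
  simp only [smul_eq_mul]; ring

theorem wedge_add_left (α α' : Form E k) (β : Form E l) :
    wedge (α + α') β = wedge α β + wedge α' β := by
  ext v
  rw [AlternatingMap.add_apply, wedge_apply, wedge_apply, wedge_apply, ← Finset.sum_add_distrib]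
  refine Finset.sum_congr rfl fun σ _ => ?_
  induction σ using Quotient.inductionOn' with | _ σ
  rw [shuffleTerm_mk, shuffleTerm_mk, shuffleTerm_mk, AlternatingMap.add_apply]
  ring

theorem wedge_add_right (α : Form E k) (β β' : Form E l) :
    wedge α (β + β') = wedge α β + wedge α β' := by
  ext v
  rw [AlternatingMap.add_apply, wedge_apply, wedge_apply, wedge_apply, ← Finset.sum_add_distrib]
  refine Finset.sum_congr rfl fun σ _ => ?_
  induction σ using Quotient.inductionOn' with | _ σ
  rw [shuffleTerm_mk, shuffleTerm_mk, shuffleTerm_mk, AlternatingMap.add_apply]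
  ring

theorem wedge_zero_left (β : Form E l) : wedge (0 : Form E k) β = 0 := by
  simpa using wedge_smul_left 0 (0 : Form E k) β

theorem wedge_zero_right (α : Form E k) : wedge α (0 : Form E l) = 0 := by
  simpa using wedge_smul_right 0 α (0 : Form E l)

variable {ι : Type*} [Fintype ι] [DecidableEq ι]

/-- The wedge product `ℓ_1 ∧ ⋯ ∧ ℓ_k` of linear forms. -/
def detForm (ℓ : ι → E →ₗ[ℝ] ℂ) : E [⋀^ι]→ₗ[ℝ] ℂ :=
  MultilinearMap.alternatization ((MultilinearMap.mkPiAlgebra ℝ ι ℂ).compLinearMap ℓ)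

theorem detForm_apply (ℓ : ι → E →ₗ[ℝ] ℂ) (v : ι → E) :
    detForm ℓ v = (Matrix.of fun i j => ℓ i (v j)).det := by
  rw [detForm, MultilinearMap.alternatization_apply, ← Matrix.det_transpose, Matrix.det_apply]
  refine Finset.sum_congr rfl fun σ _ => ?_
  simp

theorem wedge_detForm (ℓ : Fin k → E →ₗ[ℝ] ℂ) (ℓ' : Fin l → E →ₗ[ℝ] ℂ) :
    wedge (detForm ℓ) (detForm ℓ') = detForm (Sum.elim ℓ ℓ' ∘ finSumFinEquiv.symm) := by
  ext v
  rw [wedge, detForm, detForm, ← MultilinearMap.domCoprod_alternization,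
    ← LinearMap.compMultilinearMap_alternatization, AlternatingMap.domDomCongr_apply]
  have : (LinearMap.mul' ℝ ℂ).compMultilinearMap
      (((MultilinearMap.mkPiAlgebra ℝ (Fin k) ℂ).compLinearMap ℓ).domCoprod
        ((MultilinearMap.mkPiAlgebra ℝ (Fin l) ℂ).compLinearMap ℓ')) =
      (MultilinearMap.mkPiAlgebra ℝ (Fin k ⊕ Fin l) ℂ).compLinearMap (Sum.elim ℓ ℓ') := by
    ext w
    simp
  rw [this]
  change detForm (Sum.elim ℓ ℓ') _ = _
  rw [detForm_apply, detForm_apply, ← Matrix.det_submatrix_equiv_self finSumFinEquiv.symm]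
  congr 1
  ext i j
  simp

theorem detForm_compLinearMap {F : Type*} [AddCommGroup F] [Module ℝ F] (ℓ : ι → E →ₗ[ℝ] ℂ)
    (f : F →ₗ[ℝ] E) : (detForm ℓ).compLinearMap f = detForm fun i => ℓ i ∘ₗ f := by
  ext v
  rw [AlternatingMap.compLinearMap_apply, detForm_apply, detForm_apply]
  rfl

/-- Selecting factors of a wedge product changes it by a constant, a sign or zero. -/
theorem detForm_comp (ℓ : ι → E →ₗ[ℝ] ℂ) (ρ : ι → ι) :
    detForm (ℓ ∘ ρ) = (Matrix.of fun i j => if ρ i = j then (1 : ℂ) else 0).det • detForm ℓ := by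
  ext v
  rw [AlternatingMap.smul_apply, detForm_apply, detForm_apply, smul_eq_mul, ← Matrix.det_mul]
  congr 1
  ext i j
  simp [Matrix.mul_apply]

theorem oneForm_eq (f : E →ₗ[ℝ] ℂ) : oneForm f = detForm fun _ : Fin 1 => f := by
  ext v
  rw [detForm_apply]
  simp [oneForm]

theorem extWedge_apply {m : ℕ} (w : Form (Mandelstam m) m) (η : Form (Fin m → ℂ) m)
    (v : Fin m → Mandelstam m) (u : Fin m → Fin m → ℂ) :
    extWedge w η (Fin.append (fun i => ((v i, 0) : Mandelstam m × (Fin m → ℂ)))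
      fun i => ((0, u i) : Mandelstam m × (Fin m → ℂ))) = w v * η u := by
  rw [extWedge, wedge_apply]
  refine (Finset.sum_eq_single
    (Quotient.mk'' 1 : Equiv.Perm.ModSumCongr (Fin m) (Fin m)) ?_ ?_).trans ?_
  · intro σ _ hσ
    induction σ using Quotient.inductionOn' with | _ σ
    rw [shuffleTerm_mk]
    -- outside the trivial coset some argument of `w` is tangent to the fibre
    have : ∃ i, ∃ j, σ (Sum.inl i) = Sum.inr j := by
      by_contra! h
      apply hσ
      refine Quotient.sound' (QuotientGroup.leftRel_apply.2 ?_)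
      rw [mul_one, Subgroup.inv_mem_iff]
      apply Equiv.Perm.mem_sumCongrHom_range_of_perm_mapsTo_inl
      rintro _ ⟨i, rfl⟩
      rcases hx : σ (Sum.inl i) with j | j
      · exact ⟨j, rfl⟩
      · exact absurd hx (h i j)
    obtain ⟨i, j, hij⟩ := this
    have z : (w.compLinearMap (LinearMap.fst ℝ (Mandelstam m) (Fin m → ℂ)))
        (fun i => Fin.append (fun i => ((v i, 0) : Mandelstam m × (Fin m → ℂ)))
          (fun i => ((0, u i) : Mandelstam m × (Fin m → ℂ)))
            (finSumFinEquiv (σ (Sum.inl i)))) = 0 := by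
      rw [AlternatingMap.compLinearMap_apply]
      apply AlternatingMap.map_coord_zero _ i
      simp only [hij, finSumFinEquiv_apply_right, Fin.append_right, LinearMap.fst_apply]
    rw [z, zero_mul, mul_zero]
  · simp
  · rw [shuffleTerm_mk]
    simp only [AlternatingMap.compLinearMap_apply, Equiv.Perm.sign_one, Equiv.Perm.one_apply,
      finSumFinEquiv_apply_left, finSumFinEquiv_apply_right, Fin.append_left, Fin.append_right,
      LinearMap.fst_apply, LinearMap.snd_apply, Units.val_one, Int.cast_one, one_mul]

theorem extWedge_smul_left {m : ℕ} (c : ℂ) (w : Form (Mandelstam m) m) (η : Form (Fin m → ℂ) m) :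
    extWedge (c • w) η = c • extWedge w η := by
  unfold extWedge
  rw [← wedge_smul_left]
  rfl

theorem extWedge_smul_right {m : ℕ} (c : ℂ) (w : Form (Mandelstam m) m) (η : Form (Fin m → ℂ) m) :
    extWedge w (c • η) = c • extWedge w η := by
  unfold extWedge
  rw [← wedge_smul_right]
  rfl

theorem extWedge_add_left {m : ℕ} (w w' : Form (Mandelstam m) m) (η : Form (Fin m → ℂ) m) :
    extWedge (w + w') η = extWedge w η + extWedge w' η := by
  unfold extWedge
  rw [← wedge_add_left]
  rfl

theorem extWedge_add_right {m : ℕ} (w : Form (Mandelstam m) m) (η η' : Form (Fin m → ℂ) m) :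
    extWedge w (η + η') = extWedge w η + extWedge w η' := by
  unfold extWedge
  rw [← wedge_add_right]
  rfl

/-- The wedge product of a form on `K_n` and a form on `M_{0,n}` as a bilinear map. -/
def extWedgeBilin (m : ℕ) : Form (Mandelstam m) m →ₗ[ℂ] Form (Fin m → ℂ) m →ₗ[ℂ]
    Form (Mandelstam m × (Fin m → ℂ)) (m + m) :=
  LinearMap.mk₂ ℂ extWedge extWedge_add_left extWedge_smul_left extWedge_add_right
    extWedge_smul_right

theorem dSigma_eq (m : ℕ) : dSigma m = detForm fun i => LinearMap.proj i := by
  ext v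
  rw [detForm_apply, ← Matrix.det_transpose]
  rfl

end Wedge

/-! ### The powers of the symplectic form -/

section Symplectic
variable {m : ℕ}

/-- The linear forms `dτ_i` and `dσ_i` on the cotangent bundle. -/
def darboux (m : ℕ) : Fin m ⊕ Fin m → (Fin m → ℂ) × (Fin m → ℂ) →ₗ[ℝ] ℂ :=
  Sum.elim (fun i => LinearMap.proj i ∘ₗ LinearMap.fst ℝ (Fin m → ℂ) (Fin m → ℂ))
    fun i => LinearMap.proj i ∘ₗ LinearMap.snd ℝ (Fin m → ℂ) (Fin m → ℂ)

theorem symplectic_eq (m : ℕ) : symplectic m =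
    ((List.finRange m).map fun i =>
      detForm (darboux m ∘ (Sum.elim (fun _ : Fin 1 => Sum.inl i) (fun _ : Fin 1 => Sum.inr i) ∘
        (finSumFinEquiv (m := 1) (n := 1)).symm : Fin 2 → Fin m ⊕ Fin m))).sum := by
  rw [symplectic, ← List.sum_toFinset _ (List.nodup_finRange m), List.toFinset_finRange]
  refine Finset.sum_congr rfl fun i _ => ?_
  rw [oneForm_eq, oneForm_eq, wedge_detForm]
  congr 1
  funext x
  simp only [Function.comp_apply]
  rcases finSumFinEquiv.symm x with j | j <;> rfl

theorem wedge_list_sum {E ι κ : Type*} [AddCommGroup E] [Module ℝ E] {k l : ℕ} (s : List ι)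
    (t : List κ) (f : ι → Form E k) (g : κ → Form E l) :
    wedge (s.map f).sum (t.map g).sum =
      ((s ×ˢ t).map fun p => wedge (f p.1) (g p.2)).sum := by
  induction s with
  | nil => simp [wedge_zero_left]
  | cons a s ih =>
    rw [List.map_cons, List.sum_cons, wedge_add_left, ih, List.product_cons, List.map_append,
      List.sum_append]
    congr 1
    clear ih
    induction t with
    | nil => simp [wedge_zero_right]
    | cons b t ih => rw [List.map_cons, List.sum_cons, wedge_add_right, ih]; simp

/-- The powers of `ω` are sums of wedge products of the forms `dτ_i`, `dσ_i`. -/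
theorem wedgePow_symplectic (k : ℕ) : ∃ s : List (Fin (2 * k) → Fin m ⊕ Fin m),
    wedgePow (symplectic m) k = (s.map fun ρ => detForm (darboux m ∘ ρ)).sum := by
  induction k with
  | zero =>
    refine ⟨[Fin.elim0], ?_⟩
    ext v
    rw [List.map_singleton, List.sum_singleton, detForm_apply]
    have : IsEmpty (Fin (2 * 0)) := inferInstanceAs (IsEmpty (Fin 0))
    rw [Matrix.det_isEmpty]
    rfl
  | succ k ih =>
    obtain ⟨s, hs⟩ := ih
    refine ⟨(s ×ˢ List.finRange m).map fun p =>
      Sum.elim p.1 (Sum.elim (fun _ : Fin 1 => Sum.inl p.2) (fun _ : Fin 1 => Sum.inr p.2) ∘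
        (finSumFinEquiv (m := 1) (n := 1)).symm : Fin 2 → Fin m ⊕ Fin m) ∘ finSumFinEquiv.symm, ?_⟩
    rw [wedgePow, hs, symplectic_eq, wedge_list_sum, List.map_map]
    congr 1
    apply List.map_congr_left
    intro p _
    rw [wedge_detForm]
    simp only [Function.comp_apply]
    congr 1
    funext x
    simp only [Function.comp_apply]
    generalize finSumFinEquiv.symm x = y
    rcases y with y | y <;> rfl

/-- `ω^m` is a constant multiple of `dτ_1 ∧ ⋯ ∧ dτ_m ∧ dσ_1 ∧ ⋯ ∧ dσ_m`. -/
theorem exists_wedgePow_eq (m : ℕ) : ∃ c : ℂ,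
    (wedgePow (symplectic m) m).domDomCongr (finCongr (two_mul m)) =
      c • detForm (darboux m ∘ finSumFinEquiv.symm) := by
  obtain ⟨s, hs⟩ := wedgePow_symplectic (m := m) m
  rw [hs]
  clear hs
  induction s with
  | nil => exact ⟨0, by ext; simp⟩
  | cons ρ s ih =>
    obtain ⟨c, hc⟩ := ih
    have h1 : (detForm (darboux m ∘ ρ)).domDomCongr (finCongr (two_mul m)) =
        detForm ((darboux m ∘ finSumFinEquiv.symm) ∘
          (finSumFinEquiv ∘ ρ ∘ (finCongr (two_mul m)).symm)) := by
      ext v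
      rw [AlternatingMap.domDomCongr_apply, detForm_apply, detForm_apply,
        ← Matrix.det_submatrix_equiv_self (finCongr (two_mul m)).symm]
      congr 1
      ext i j
      simp
    rw [detForm_comp] at h1
    refine ⟨(Matrix.of fun i j =>
      if (finSumFinEquiv ∘ ρ ∘ (finCongr (two_mul m)).symm) i = j then (1 : ℂ) else 0).det + c, ?_⟩
    · rw [add_smul, ← hc, ← h1]
      ext v; simp
end Symplectic

/-! ### The pullback of the symplectic form -/

section Pullback
variable {m : ℕ}

/-- The linear part of `z ↦ (σ_1, …, σ_{n-1})`. -/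
def posLin (m : ℕ) : (Fin m → ℂ) →ₗ[ℂ] (Fin (m + 2) → ℂ) where
  toFun u := Fin.cons (0 : ℂ) (Fin.snoc u (0 : ℂ) : Fin (m + 1) → ℂ)
  map_add' u v := by
    funext i
    refine Fin.cases ?_ (fun i => ?_) i
    · simp
    · refine Fin.lastCases ?_ (fun i => ?_) i <;> simp
  map_smul' c u := by
    funext i
    refine Fin.cases ?_ (fun i => ?_) i
    · simp
    · refine Fin.lastCases ?_ (fun i => ?_) i <;> simp

theorem pos_eq (z : Fin m → ℂ) : pos z = pos 0 + posLin m z := by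
  funext i
  refine Fin.cases ?_ (fun i => ?_) i
  · simp [pos, posLin]
  · refine Fin.lastCases ?_ (fun i => ?_) i <;> simp [pos, posLin]

theorem posLin_moving (u : Fin m → ℂ) (i : Fin m) : posLin m u (moving i) = u i := by
  simp [posLin, moving]

theorem pos_moving (u : Fin m → ℂ) (i : Fin m) : pos u (moving i) = u i := by
  simp [pos, moving]

@[simp] theorem pos_zero (u : Fin m → ℂ) : pos u 0 = 0 := by simp [pos]

@[simp] theorem pos_last (u : Fin m → ℂ) : pos u (Fin.last (m + 1)) = 1 := by
  simp [pos, ← Fin.succ_last]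

/-- The coordinate `s_ij` on `K_n`, for `i, j < n`. -/
def sCoord (m : ℕ) (i j : Fin (m + 2)) : Mandelstam m →ₗ[ℝ] ℂ :=
  Complex.ofRealCLM.toLinearMap ∘ₗ LinearMap.proj j.castSucc ∘ₗ LinearMap.proj i.castSucc ∘ₗ
    (Mandelstam m).subtype

theorem sCoord_apply (i j : Fin (m + 2)) (s : Mandelstam m) :
    sCoord m i j s = ((s.1 i.castSucc j.castSucc : ℝ) : ℂ) := rfl

theorem sCoord_symm (i j : Fin (m + 2)) : sCoord m i j = sCoord m j i := by
  ext s
  rw [sCoord_apply, sCoord_apply, s.2.1]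

/-- The component of `dE_i` along `K_n`, i.e. `∑_j ds_ij / σ_ij`. -/
def dScattering (z : Fin m → ℂ) (i : Fin m) : Mandelstam m →ₗ[ℝ] ℂ :=
  ∑ j : Fin (m + 2), (pos z (moving i) - pos z j)⁻¹ • sCoord m (moving i) j

/-- The component of `dE_i` along the moduli space. -/
def dScatteringFibre (s : Mandelstam m) (z : Fin m → ℂ) (i : Fin m) : (Fin m → ℂ) →ₗ[ℂ] ℂ :=
  ∑ j : Fin (m + 2), (-(sCoord m (moving i) j s) / (pos z (moving i) - pos z j) ^ 2) •
    (((LinearMap.proj (moving i) : (Fin (m + 2) → ℂ) →ₗ[ℂ] ℂ) - LinearMap.proj j) ∘ₗ posLin m)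

theorem differentiableAt_pos (z : Fin m → ℂ) (i : Fin (m + 2)) :
    DifferentiableAt ℂ (fun z : Fin m → ℂ => pos z i) z := by
  have : (fun z : Fin m → ℂ => pos z i) = fun z => pos 0 i + LinearMap.toContinuousLinearMap
      (LinearMap.proj i ∘ₗ posLin m) z := by
    funext z; rw [pos_eq z]; rfl
  rw [this]
  fun_prop

theorem differentiableAt_sCoord (i j : Fin (m + 2)) (s : Mandelstam m) :
    DifferentiableAt ℝ (sCoord m i j) s :=
  (LinearMap.toContinuousLinearMap (sCoord m i j)).differentiableAt

theorem pos_ne {z : Fin m → ℂ} (hz : z ∈ openModuli m) {i j : Fin (m + 2)} (h : i ≠ j) :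
    pos z i - pos z j ≠ 0 := sub_ne_zero.2 fun e => h (hz e)

theorem differentiableAt_scatteringE {s : Mandelstam m} {z : Fin m → ℂ} (hz : z ∈ openModuli m)
    (i : Fin m) :
    DifferentiableAt ℝ (fun y : Mandelstam m × (Fin m → ℂ) => scatteringE y.1 y.2 i) (s, z) := by
  unfold scatteringE
  refine DifferentiableAt.fun_sum fun j _ => ?_
  by_cases h : moving i = j
  · subst h
    simp
  · have h1 : DifferentiableAt ℝ (fun y : Mandelstam m × (Fin m → ℂ) => sCoord m (moving i) j y.1)
        (s, z) := (differentiableAt_sCoord _ _ s).comp (s, z) differentiableAt_fst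
    have h2 : ∀ k, DifferentiableAt ℝ (fun y : Mandelstam m × (Fin m → ℂ) => pos y.2 k) (s, z) :=
      fun k => DifferentiableAt.comp (g := fun w : Fin m → ℂ => pos w k) (s, z)
        ((differentiableAt_pos z k).restrictScalars ℝ) differentiableAt_snd
    exact h1.mul (((h2 _).sub (h2 _)).inv (pos_ne hz h))

theorem fderiv_qMap {s : Mandelstam m} {z : Fin m → ℂ} (hz : z ∈ openModuli m)
    (v : Mandelstam m) (u : Fin m → ℂ) :
    fderiv ℝ (qMap m) (s, z) (v, u) =
      (fun i => dScattering z i v + dScatteringFibre s z i u, u) := by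
  have hd : DifferentiableAt ℝ (qMap m) (s, z) :=
    (differentiableAt_pi.2 fun i => differentiableAt_scatteringE hz i).prodMk differentiableAt_snd
  have hl : HasDerivAt (fun t : ℝ => (s, z) + t • (v, u)) (v, u) 0 := by
    simpa using ((hasDerivAt_id (0 : ℝ)).smul_const (v, u)).const_add (s, z)
  have h1 : HasDerivAt (fun t : ℝ => qMap m ((s, z) + t • (v, u)))
      (fderiv ℝ (qMap m) (s, z) (v, u)) 0 := by
    have h0 : HasFDerivAt (qMap m) (fderiv ℝ (qMap m) (s, z)) ((s, z) + (0 : ℝ) • (v, u)) := by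
      simpa using hd.hasFDerivAt
    exact h0.comp_hasDerivAt 0 hl
  have h2 : HasDerivAt (fun t : ℝ => qMap m ((s, z) + t • (v, u)))
      (fun i => dScattering z i v + dScatteringFibre s z i u, u) 0 := by
    refine HasDerivAt.prodMk (hasDerivAt_pi.2 fun i => ?_) ?_
    · have : dScattering z i v + dScatteringFibre s z i u = ∑ j : Fin (m + 2),
          ((pos z (moving i) - pos z j)⁻¹ * sCoord m (moving i) j v +
          (-(sCoord m (moving i) j s) / (pos z (moving i) - pos z j) ^ 2) *
            (posLin m u (moving i) - posLin m u j)) := by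
        rw [Finset.sum_add_distrib]
        simp [dScattering, dScatteringFibre]
      rw [this]
      unfold scatteringE
      refine HasDerivAt.fun_sum fun j _ => ?_
      by_cases h : moving i = j
      · subst h
        simpa using hasDerivAt_const (0 : ℝ) (0 : ℂ)
      · have e1 : HasDerivAt (fun t : ℝ => sCoord m (moving i) j s + (t : ℂ) * sCoord m (moving i) j v)
            (sCoord m (moving i) j v) 0 := by
          simpa using ((Complex.ofRealCLM.hasDerivAt (x := (0:ℝ))).mul_const
            (sCoord m (moving i) j v)).const_add (sCoord m (moving i) j s)
        have e2 : HasDerivAt (fun t : ℝ => (pos z (moving i) - pos z j) +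
            (t : ℂ) * (posLin m u (moving i) - posLin m u j))
            (posLin m u (moving i) - posLin m u j) 0 := by
          simpa using ((Complex.ofRealCLM.hasDerivAt (x := (0:ℝ))).mul_const
            (posLin m u (moving i) - posLin m u j)).const_add (pos z (moving i) - pos z j)
        have e3 := e1.div e2 (by simpa using pos_ne hz h)
        have hne := pos_ne hz h
        refine (e3.congr_deriv ?_).congr_of_eventuallyEq (Eventually.of_forall fun t => ?_)
        · simp only [Complex.ofReal_zero, zero_mul, add_zero]
          field_simp
          ring
        · have hp : ∀ k, pos (z + t • u) k = pos z k + (t : ℂ) * posLin m u k := by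
            intro k
            have : t • u = (t : ℂ) • u := by ext; simp
            rw [pos_eq, pos_eq z, this, map_add, map_smul]
            simp [add_assoc]
          change sCoord m (moving i) j (s + t • v) /
            (pos (z + t • u) (moving i) - pos (z + t • u) j) =
            (sCoord m (moving i) j s + (t : ℂ) * sCoord m (moving i) j v) /
            (pos z (moving i) - pos z j + (t : ℂ) * (posLin m u (moving i) - posLin m u j))
          rw [hp, hp, map_add, map_smul, Complex.real_smul]
          congr 1
          ring
    · simpa using ((hasDerivAt_id (0 : ℝ)).smul_const u).const_add z
  exact h1.unique h2

/-- `q^* ω^{n-3}` is a constant multiple of `⋀_i (∑_j ds_ij / σ_ij) ∧ dσ_2 ∧ ⋯ ∧ dσ_{n-2}`: the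
`dσ` components of the `dE_i` do not contribute. -/
theorem exists_qOmegaPow_eq (m : ℕ) : ∃ c : ℂ, ∀ (s : Mandelstam m) (z : Fin m → ℂ),
    z ∈ openModuli m →
      qOmegaPow m (s, z) = c • extWedge (detForm (dScattering z)) (dSigma m) := by
  obtain ⟨c, hc⟩ := exists_wedgePow_eq m
  refine ⟨c, fun s z hz => ?_⟩
  have h1 : qOmegaPow m (s, z) = ((wedgePow (symplectic m) m).domDomCongr
      (finCongr (two_mul m))).compLinearMap (fderiv ℝ (qMap m) (s, z) :
        Mandelstam m × (Fin m → ℂ) →ₗ[ℝ] (Fin m → ℂ) × (Fin m → ℂ)) := rfl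
  rw [h1, hc, extWedge, dSigma_eq, detForm_compLinearMap, detForm_compLinearMap, wedge_detForm]
  ext v
  rw [AlternatingMap.compLinearMap_apply, AlternatingMap.smul_apply, AlternatingMap.smul_apply,
    detForm_apply, detForm_apply]
  congr 1
  rw [← Matrix.det_submatrix_equiv_self (finSumFinEquiv (m := m) (n := m)),
    ← Matrix.det_submatrix_equiv_self (finSumFinEquiv (m := m) (n := m)) (Matrix.of _)]
  -- row operations remove the `dσ` components
  let C : Matrix (Fin m) (Fin m) ℂ := Matrix.of fun i k => dScatteringFibre s z i (Pi.single k 1)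
  have h2 : (Matrix.fromBlocks 1 C 0 1).det = 1 := by
    rw [Matrix.det_fromBlocks_zero₂₁]; simp
  conv_rhs => rw [← one_mul (Matrix.det _), ← h2, ← Matrix.det_mul]
  congr 1
  ext i j
  rw [Matrix.mul_apply, Fintype.sum_sum_type]
  rcases i with i | i
  · have hC : ∀ u : Fin m → ℂ, dScatteringFibre s z i u = ∑ k, C i k * u k := by
      intro u
      rw [LinearMap.pi_apply_eq_sum_univ (dScatteringFibre s z i) u]
      refine Finset.sum_congr rfl fun k _ => ?_
      have hk : (Pi.single k 1 : Fin m → ℂ) = fun l => if k = l then 1 else 0 := by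
        ext l
        simp [Pi.single_apply, eq_comm]
      change _ = dScatteringFibre s z i (Pi.single k 1) * u k
      rw [hk, smul_eq_mul, mul_comm]
    have hv : v (finSumFinEquiv j) = ((v (finSumFinEquiv j)).1, (v (finSumFinEquiv j)).2) := rfl
    have := fderiv_qMap (s := s) hz (v (finSumFinEquiv j)).1 (v (finSumFinEquiv j)).2
    simp only [Matrix.fromBlocks_apply₁₁, Matrix.fromBlocks_apply₁₂, Matrix.submatrix_apply,
      Matrix.of_apply, Function.comp_apply, Equiv.symm_apply_apply, Sum.elim_inl, Sum.elim_inr,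
      darboux, LinearMap.coe_comp, LinearMap.proj_apply, LinearMap.fst_apply, LinearMap.snd_apply,
      ContinuousLinearMap.coe_coe, Matrix.one_apply, ite_mul, one_mul, zero_mul,
      Finset.sum_ite_eq, Finset.mem_univ, if_true]
    rw [hv, this]
    simp only [hC]
  · have := fderiv_qMap (s := s) hz (v (finSumFinEquiv j)).1 (v (finSumFinEquiv j)).2
    have hv : v (finSumFinEquiv j) = ((v (finSumFinEquiv j)).1, (v (finSumFinEquiv j)).2) := rfl
    simp only [Matrix.fromBlocks_apply₂₁, Matrix.fromBlocks_apply₂₂, Matrix.submatrix_apply,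
      Matrix.of_apply, Function.comp_apply, Equiv.symm_apply_apply, Sum.elim_inl, Sum.elim_inr,
      darboux, LinearMap.coe_comp, LinearMap.proj_apply, LinearMap.fst_apply, LinearMap.snd_apply,
      ContinuousLinearMap.coe_coe, Matrix.one_apply, ite_mul, one_mul, zero_mul,
      Finset.sum_ite_eq, Finset.mem_univ, if_true, Matrix.zero_apply, Finset.sum_const_zero,
      zero_add]
    rw [hv, this]

end Pullback

/-! ### Products over spanning trees as combinations of Parke-Taylor factors -/

section Trees
variable {m : ℕ}

/-- The span of the Parke-Taylor factors of the words in the letter `0`, which comes first, and the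
letters of `T`. -/
def ptSpan (T : Set (Fin (m + 2))) : Submodule ℂ (openModuli m → ℂ) :=
  Submodule.span ℂ {f | ∃ w : List (Fin (m + 2)), (0 :: w).Nodup ∧ (∀ x, x ∈ w ↔ x ∈ T) ∧
    (fun z : openModuli m => (den (pos z.1) (0 :: w))⁻¹) = f}

/-- The span of the Parke-Taylor factors of the words with first letter `y` obtained from `y w` by
inserting the letter `x`. -/
def insertSpan (x y : Fin (m + 2)) (w : List (Fin (m + 2))) :
    Submodule ℂ (openModuli m → ℂ) :=
  Submodule.span ℂ {f | ∃ w' : List (Fin (m + 2)), w'.Perm (x :: w) ∧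
    (fun z : openModuli m => (den (pos z.1) (y :: w'))⁻¹) = f}

theorem mul_mem_insertSpan {x y u : Fin (m + 2)} {w : List (Fin (m + 2))}
    {f : openModuli m → ℂ} (hf : f ∈ insertSpan x y w) :
    (fun z => (pos z.1 u - pos z.1 y)⁻¹ * f z) ∈ insertSpan x u (y :: w) := by
  let φ : (openModuli m → ℂ) →ₗ[ℂ] (openModuli m → ℂ) :=
    LinearMap.mulLeft ℂ (fun z : openModuli m => (pos z.1 u - pos z.1 y)⁻¹)
  have : insertSpan x y w ≤ (insertSpan x u (y :: w)).comap φ := by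
    refine Submodule.span_le.2 ?_
    rintro _ ⟨w', hw', rfl⟩
    refine Submodule.subset_span ⟨y :: w', (hw'.cons y).trans (List.Perm.swap x y w), ?_⟩
    funext z
    change _ = (pos z.1 u - pos z.1 y)⁻¹ * (den (pos z.1) (y :: w'))⁻¹
    rw [den, mul_inv]
  exact this hf

/-- Inserting a letter `x` after the first letter `y`, by partial fractions. -/
theorem insert_head (x y : Fin (m + 2)) (w : List (Fin (m + 2))) (nd : (x :: y :: w).Nodup) :
    (fun z : openModuli m => (pos z.1 y - pos z.1 x)⁻¹ * (den (pos z.1) (y :: w))⁻¹) ∈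
      insertSpan x y w := by
  induction w generalizing y with
  | nil =>
    refine Submodule.subset_span ⟨[x], List.Perm.refl _, ?_⟩
    funext z
    simp [den]
  | cons u w ih =>
    simp only [List.nodup_cons, List.mem_cons, not_or] at nd
    obtain ⟨⟨hxy, hxu, hxw⟩, ⟨hyu, hyw⟩, huw, ndw⟩ := nd
    have h1 : (fun z : openModuli m => (den (pos z.1) (y :: x :: u :: w))⁻¹) ∈
        insertSpan x y (u :: w) := Submodule.subset_span ⟨_, List.Perm.refl _, rfl⟩
    have h2 := mul_mem_insertSpan (u := y) (ih u (by simp [*]))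
    have := Submodule.add_mem _ h1 h2
    convert this using 1
    funext z
    have e1 := pos_ne z.2 (Ne.symm hxy)
    have e2 := pos_ne z.2 hxu
    have e3 := pos_ne z.2 (Ne.symm hxu)
    have e4 := pos_ne z.2 hyu
    simp only [Pi.add_apply, den, mul_inv]
    rw [← neg_sub (pos z.1 x) (pos z.1 u), inv_neg]
    field_simp
    ring

theorem insert_mem (x y v : Fin (m + 2)) (w : List (Fin (m + 2))) (nd : (x :: v :: w).Nodup)
    (hy : y ∈ v :: w) :
    (fun z : openModuli m => (pos z.1 y - pos z.1 x)⁻¹ * (den (pos z.1) (v :: w))⁻¹) ∈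
      insertSpan x v w := by
  induction w generalizing v with
  | nil =>
    have : y = v := by simpa using hy
    subst this
    exact insert_head x y [] nd
  | cons u w ih =>
    by_cases h : y = v
    · subst h
      exact insert_head x y _ nd
    · have hy' : y ∈ u :: w := (List.mem_cons.1 hy).resolve_left h
      have nd' : (x :: u :: w).Nodup := by
        simp only [List.nodup_cons, List.mem_cons, not_or] at nd ⊢
        tauto
      have := mul_mem_insertSpan (u := v) (ih u nd' hy')
      convert this using 1
      funext z
      rw [den, mul_inv]
      ring

theorem mul_mem_ptSpan {T : Set (Fin (m + 2))} {x y : Fin (m + 2)} (hx : x ∉ T) (hx0 : x ≠ 0)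
    (hy : y = 0 ∨ y ∈ T) {f : openModuli m → ℂ} (hf : f ∈ ptSpan T) :
    (fun z => (pos z.1 y - pos z.1 x)⁻¹ * f z) ∈ ptSpan (insert x T) := by
  let φ : (openModuli m → ℂ) →ₗ[ℂ] (openModuli m → ℂ) :=
    LinearMap.mulLeft ℂ (fun z : openModuli m => (pos z.1 y - pos z.1 x)⁻¹)
  have : ptSpan T ≤ (ptSpan (insert x T)).comap φ := by
    refine Submodule.span_le.2 ?_
    rintro _ ⟨w, nd, hw, rfl⟩
    have nd' : (x :: 0 :: w).Nodup := by
      refine List.nodup_cons.2 ⟨?_, nd⟩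
      simp [hx0, hw, hx]
    have h1 := insert_mem x y 0 w nd' (by simpa [hw] using hy)
    refine (Submodule.span_le (p := ptSpan (insert x T))).2 ?_ h1
    rintro _ ⟨w', hw', rfl⟩
    refine Submodule.subset_span ⟨w', ?_, fun u => ?_, rfl⟩
    · exact ((hw'.cons 0).trans (List.Perm.swap x 0 w)).nodup_iff.2 nd'
    · rw [hw'.mem_iff]; simp [hw]
  exact this hf

/-- The incidence matrix of a graph with edges `c` at the vertices `l`. -/
def incidence {k : ℕ} (l : Fin k → Fin (m + 2)) (c : Fin k → Fin (m + 2) × Fin (m + 2)) :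
    Matrix (Fin k) (Fin k) ℂ :=
  Matrix.of fun i q => (if l i = (c q).1 then 1 else 0) - if l i = (c q).2 then 1 else 0

theorem card_filter_eq_le_one {k : ℕ} {l : Fin k → Fin (m + 2)} (hl : Function.Injective l)
    (x : Fin (m + 2)) : (Finset.univ.filter fun i => l i = x).card ≤ 1 :=
  Finset.card_le_one.2 fun _ hi _ hj =>
    hl ((Finset.mem_filter.1 hi).2.trans (Finset.mem_filter.1 hj).2.symm)

/-- A graph with invertible incidence matrix has a leaf: otherwise every vertex has degree two, and
no edge meets a root, so that the rows of the matrix add up to zero. -/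
theorem exists_leaf {k : ℕ} {l : Fin (k + 1) → Fin (m + 2)} (hl : Function.Injective l)
    {c : Fin (k + 1) → Fin (m + 2) × Fin (m + 2)} (hdet : (incidence l c).det ≠ 0) :
    ∃ i q, incidence l c i q ≠ 0 ∧ ∀ q', q' ≠ q → incidence l c i q' = 0 := by
  classical
  set N := incidence l c with hN
  by_contra! hcon
  have hrow : ∀ i, 2 ≤ (Finset.univ.filter fun q => N i q ≠ 0).card := by
    intro i
    have : ∃ q, N i q ≠ 0 := by
      by_contra! h
      exact hdet (Matrix.det_eq_zero_of_row_eq_zero i h)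
    obtain ⟨q, hq⟩ := this
    obtain ⟨q', hq', hq''⟩ := hcon i q hq
    exact Finset.one_lt_card.2 ⟨q, by simp [hq], q', by simp [hq''], hq'.symm⟩
  have hsub : ∀ q, (Finset.univ.filter fun i => N i q ≠ 0) ⊆
      (Finset.univ.filter fun i => l i = (c q).1) ∪ (Finset.univ.filter fun i => l i = (c q).2) := by
    intro q i hi
    simp only [Finset.mem_filter, Finset.mem_univ, true_and, Finset.mem_union] at hi ⊢
    by_contra! h
    apply hi
    simp [hN, incidence, h.1, h.2]
  have hcol : ∀ q, (Finset.univ.filter fun i => N i q ≠ 0).card ≤ 2 := by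
    intro q
    have h1 := card_filter_eq_le_one hl (c q).1
    have h2 := card_filter_eq_le_one hl (c q).2
    exact ((Finset.card_le_card (hsub q)).trans (Finset.card_union_le _ _)).trans (by omega)
  have hsum : ∑ i, (Finset.univ.filter fun q => N i q ≠ 0).card =
      ∑ q, (Finset.univ.filter fun i => N i q ≠ 0).card := by
    simp only [Finset.card_filter]
    exact Finset.sum_comm
  have hlow : ∑ _i : Fin (k + 1), 2 ≤ ∑ i, (Finset.univ.filter fun q => N i q ≠ 0).card :=
    Finset.sum_le_sum fun i _ => hrow i
  have heq : ∀ q, (Finset.univ.filter fun i => N i q ≠ 0).card = 2 := by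
    intro q
    by_contra h
    have : ∑ q, (Finset.univ.filter fun i => N i q ≠ 0).card < ∑ _q : Fin (k + 1), 2 :=
      Finset.sum_lt_sum (fun q _ => hcol q) ⟨q, Finset.mem_univ q, lt_of_le_of_ne (hcol q) h⟩
    omega
  apply hdet
  refine Matrix.exists_vecMul_eq_zero_iff.1 ⟨fun _ => 1, fun h => one_ne_zero (congrFun h 0), ?_⟩
  funext q
  have h1 := card_filter_eq_le_one hl (c q).1
  have h2 := card_filter_eq_le_one hl (c q).2
  have h3 := (Finset.card_le_card (hsub q)).trans (Finset.card_union_le _ _)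
  rw [heq q] at h3
  have e1 : (Finset.univ.filter fun i => l i = (c q).1).card = 1 := by omega
  have e2 : (Finset.univ.filter fun i => l i = (c q).2).card = 1 := by omega
  simp only [Matrix.vecMul, dotProduct, one_mul, Pi.zero_apply, hN, incidence, Matrix.of_apply,
    Finset.sum_sub_distrib, Finset.sum_boole, e1, e2]
  simp

/-- The product over the edges of a graph on the marked points with invertible incidence matrix
(which is a spanning tree once the points `0` and `1` are joined) is a combination of Parke-Taylor
factors. -/
theorem prod_edges_mem_ptSpan {k : ℕ} (l : Fin k → Fin (m + 2)) (hl : Function.Injective l)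
    (h0 : ∀ i, l i ≠ 0) (h1 : ∀ i, l i ≠ Fin.last (m + 1))
    (c : Fin k → Fin (m + 2) × Fin (m + 2))
    (hc : ∀ q, ((c q).1 = 0 ∨ (c q).1 = Fin.last (m + 1) ∨ (c q).1 ∈ Set.range l) ∧
      ((c q).2 = 0 ∨ (c q).2 = Fin.last (m + 1) ∨ (c q).2 ∈ Set.range l))
    (hdet : (incidence l c).det ≠ 0) :
    (fun z : openModuli m => ∏ q, (pos z.1 (c q).1 - pos z.1 (c q).2)⁻¹) ∈
      ptSpan (insert (Fin.last (m + 1)) (Set.range l)) := by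
  induction k with
  | zero =>
    -- the two roots alone: the word `0, last` has Parke-Taylor factor `(0 - 1)⁻¹`
    have : (fun z : openModuli m => (den (pos z.1) [0, Fin.last (m + 1)])⁻¹) ∈
        ptSpan (insert (Fin.last (m + 1)) (Set.range l)) := by
      refine Submodule.subset_span ⟨[Fin.last (m + 1)], ?_, ?_, rfl⟩
      · simp [Fin.ext_iff]
      · intro x; simp
    convert Submodule.neg_mem _ this using 1
    funext z
    simp [den]
  | succ k ih =>
    obtain ⟨i, q, hq, hq'⟩ := exists_leaf hl hdet
    have hloop : ∀ q, (c q).1 ≠ (c q).2 := by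
      intro q h
      apply hdet
      refine Matrix.det_eq_zero_of_column_eq_zero q fun i => ?_
      simp [incidence, h]
    have hdet' : (incidence (l ∘ i.succAbove) (c ∘ q.succAbove)).det ≠ 0 := by
      intro h
      apply hdet
      rw [Matrix.det_succ_row _ i, Finset.sum_eq_single q]
      · have : (incidence l c).submatrix i.succAbove q.succAbove =
          incidence (l ∘ i.succAbove) (c ∘ q.succAbove) := rfl
        rw [this, h, mul_zero]
      · intro q'' _ hne
        rw [hq' q'' hne]; simp
      · simp
    have hmem : ∀ x, x ∈ Set.range l → x ≠ l i → x ∈ Set.range (l ∘ i.succAbove) := by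
      rintro _ ⟨j, rfl⟩ hj
      obtain ⟨j', rfl⟩ := Fin.exists_succAbove_eq (fun h => hj (by rw [h]) : j ≠ i)
      exact ⟨j', rfl⟩
    have hedge : ∀ q', q' ≠ q → (c q').1 ≠ l i ∧ (c q').2 ≠ l i := by
      intro q' hne
      have h := hq' q' hne
      have hl' := hloop q'
      simp only [incidence, Matrix.of_apply] at h
      constructor
      · intro e
        rw [if_pos e.symm, if_neg (by rw [← e]; exact hl')] at h
        simp at h
      · intro e
        rw [if_pos e.symm, if_neg (by rw [← e]; exact hl'.symm)] at h
        simp at h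
    have key := ih (l ∘ i.succAbove) (hl.comp Fin.succAbove_right_injective)
      (fun j => h0 _) (fun j => h1 _) (c ∘ q.succAbove) (fun j => by
        have hj := hedge (q.succAbove j) (Fin.succAbove_ne q j)
        have := hc (q.succAbove j)
        exact ⟨this.1.imp_right (Or.imp_right fun h => hmem _ h hj.1),
          this.2.imp_right (Or.imp_right fun h => hmem _ h hj.2)⟩) hdet'
    have hset : insert (l i) (insert (Fin.last (m + 1)) (Set.range (l ∘ i.succAbove))) =
        insert (Fin.last (m + 1)) (Set.range l) := by
      rw [Set.insert_comm]
      congr 1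
      ext x
      constructor
      · rintro (rfl | ⟨j, rfl⟩)
        · exact ⟨i, rfl⟩
        · exact ⟨_, rfl⟩
      · intro h
        by_cases hx : x = l i
        · exact Or.inl hx
        · exact Or.inr (hmem x h hx)
    have hxT : l i ∉ insert (Fin.last (m + 1)) (Set.range (l ∘ i.succAbove)) := by
      rintro (h | ⟨j, hj⟩)
      · exact h1 i h
      · exact Fin.succAbove_ne i j (hl hj)
    have hy : ∀ y, (y = 0 ∨ y = Fin.last (m + 1) ∨ y ∈ Set.range l) → y ≠ l i →
        y = 0 ∨ y ∈ insert (Fin.last (m + 1)) (Set.range (l ∘ i.succAbove)) := fun y h hne =>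
      h.imp_right (Or.imp_right fun h => hmem _ h hne)
    rw [← hset]
    have hor : (c q).1 = l i ∨ (c q).2 = l i := by
      by_contra! h
      apply hq
      simp [incidence, h.1.symm, h.2.symm]
    rcases hor with h | h
    · have := Submodule.neg_mem _ (mul_mem_ptSpan hxT (h0 i)
        (hy (c q).2 (hc q).2 (fun e => hloop q (h.trans e.symm))) key)
      convert this using 1
      funext z
      rw [Fin.prod_univ_succAbove _ q, h]
      simp only [Pi.neg_apply, Function.comp_apply]
      rw [← neg_sub (pos z.1 (c q).2), inv_neg, neg_mul]
    · have := mul_mem_ptSpan hxT (h0 i)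
        (hy (c q).1 (hc q).1 (fun e => hloop q (e.trans h.symm))) key
      convert this using 1
      funext z
      rw [Fin.prod_univ_succAbove _ q, h]
      simp only [Function.comp_apply]

theorem exists_coeff_of_mem_ptSpan {f : openModuli m → ℂ}
    (hf : f ∈ ptSpan (insert (Fin.last (m + 1)) (Set.range (moving (m := m))))) :
    ∃ κ : {a : Equiv.Perm (Fin (m + 2)) // a 0 = 0} → ℂ, ∀ z,
      f z = ∑ a, κ a * (den (pos z.1) (List.ofFn a.1))⁻¹ := by
  classical
  unfold ptSpan at hf
  induction hf using Submodule.span_induction with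
  | mem f h =>
    obtain ⟨w, nd, hw, rfl⟩ := h
    have p : (0 :: w).Perm (List.finRange (m + 2)) := by
      refine (List.perm_ext_iff_of_nodup nd (List.nodup_finRange _)).2 fun x => ?_
      simp only [List.mem_cons, List.mem_finRange, iff_true, hw]
      refine Fin.cases (Or.inl rfl) (fun x => Or.inr ?_) x
      refine Fin.lastCases (Or.inl (Fin.succ_last _)) (fun x => Or.inr ⟨x, rfl⟩) x
    obtain ⟨a, ha⟩ := exists_perm_of_perm_finRange p
    have ha0 : a 0 = 0 := by rw [ofFn_eq_cons] at ha; exact (List.cons.inj ha).1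
    refine ⟨fun b => if b = ⟨a, ha0⟩ then 1 else 0, fun z => ?_⟩
    simp only [ite_mul, one_mul, zero_mul, Finset.sum_ite_eq', Finset.mem_univ, if_true]
    rw [ha]
  | zero => exact ⟨0, fun z => by simp⟩
  | add f g _ _ hf hg =>
    obtain ⟨κ, hκ⟩ := hf
    obtain ⟨κ', hκ'⟩ := hg
    refine ⟨κ + κ', fun z => ?_⟩
    simp only [Pi.add_apply, hκ, hκ', add_mul, Finset.sum_add_distrib]
  | smul c f _ hf =>
    obtain ⟨κ, hκ⟩ := hf
    refine ⟨c • κ, fun z => ?_⟩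
    simp only [Pi.smul_apply, smul_eq_mul, hκ, mul_assoc, Finset.mul_sum]

/-- The Cauchy-Binet expansion, with a sum over all sequences of `k` indices. -/
theorem cauchyBinet {k : ℕ} {K : Type*} [Fintype K] (B : Matrix (Fin k) K ℂ)
    (F : Matrix K (Fin k) ℂ) :
    (k.factorial : ℂ) * (B * F).det = ∑ c : Fin k → K,
      (B.submatrix id c).det * (F.submatrix c id).det := by
  classical
  have h1 : (B * F).det = ∑ c : Fin k → K, (∏ i, B i (c i)) * (F.submatrix c id).det := by
    have e : (B * F) = fun i => ∑ q, B i q • F q := by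
      funext i j
      simp [Matrix.mul_apply]
    rw [e]
    change (Matrix.detRowAlternating (R := ℂ)).toMultilinearMap _ = _
    rw [MultilinearMap.map_sum]
    refine Finset.sum_congr rfl fun c _ => ?_
    rw [MultilinearMap.map_smul_univ]
    rfl
  have h2 : ∀ π : Equiv.Perm (Fin k), (B * F).det = ∑ c : Fin k → K,
      (((Equiv.Perm.sign π : ℤ) : ℂ) * ∏ i, B i (c (π i))) * (F.submatrix c id).det := by
    intro π
    rw [h1]
    refine (Fintype.sum_equiv (Equiv.arrowCongr π (Equiv.refl K)) _ _ fun c => ?_)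
    have : F.submatrix c id = (F.submatrix (Equiv.arrowCongr π (Equiv.refl K) c) id).submatrix π id := by
      ext i j; simp
    rw [this, Matrix.det_permute]
    simp only [Equiv.arrowCongr_apply, Equiv.coe_refl, Function.comp_apply, id,
      Equiv.symm_apply_apply]
    ring
  have h3 : (k.factorial : ℂ) * (B * F).det = ∑ _π : Equiv.Perm (Fin k), (B * F).det := by
    simp [Fintype.card_perm]
  rw [h3, Finset.sum_congr rfl fun π _ => h2 π, Finset.sum_comm]
  refine Finset.sum_congr rfl fun c _ => ?_
  rw [← Finset.sum_mul, ← Matrix.det_transpose (B.submatrix id c),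
    Matrix.det_apply' (B.submatrix id c).transpose]
  rfl

theorem dScattering_eq (z : Fin m → ℂ) (i : Fin m) : dScattering z i =
    ∑ e : Fin (m + 2) × Fin (m + 2), ((2 : ℂ)⁻¹ * ((if moving i = e.1 then 1 else 0) -
      if moving i = e.2 then 1 else 0) * (pos z e.1 - pos z e.2)⁻¹) • sCoord m e.1 e.2 := by
  have h1 : ∀ e : Fin (m + 2) × Fin (m + 2), ((2 : ℂ)⁻¹ * ((if moving i = e.1 then 1 else 0) -
      if moving i = e.2 then 1 else 0) * (pos z e.1 - pos z e.2)⁻¹) • sCoord m e.1 e.2 =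
      (if moving i = e.1 then ((2 : ℂ)⁻¹ * (pos z e.1 - pos z e.2)⁻¹) • sCoord m e.1 e.2 else 0) +
      if moving i = e.2 then ((2 : ℂ)⁻¹ * (pos z e.2 - pos z e.1)⁻¹) • sCoord m e.1 e.2 else 0 := by
    intro e
    rw [← neg_sub (pos z e.1) (pos z e.2), inv_neg]
    split_ifs <;> simp
  rw [Finset.sum_congr rfl fun e _ => h1 e, Finset.sum_add_distrib, Fintype.sum_prod_type,
    Fintype.sum_prod_type_right]
  simp only [Finset.sum_ite_irrel, Finset.sum_const_zero, Finset.sum_ite_eq, Finset.mem_univ,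
    if_true]
  rw [← Finset.sum_add_distrib, dScattering]
  refine Finset.sum_congr rfl fun j _ => ?_
  rw [sCoord_symm j, ← add_smul, ← add_mul]
  norm_num

/-- `⋀_i (∑_j ds_ij / σ_ij)` is a combination of Parke-Taylor factors whose coefficients are
constant forms on `K_n`. -/
theorem exists_detForm_dScattering_eq (m : ℕ) :
    ∃ V : {a : Equiv.Perm (Fin (m + 2)) // a 0 = 0} → Form (Mandelstam m) m,
      ∀ z : openModuli m, detForm (dScattering z.1) =
        ∑ a, (den (pos z.1) (List.ofFn a.1))⁻¹ • V a := by
  classical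
  have hκ : ∀ c : Fin m → Fin (m + 2) × Fin (m + 2),
      ∃ κ : {a : Equiv.Perm (Fin (m + 2)) // a 0 = 0} → ℂ, ∀ z : openModuli m,
        (incidence moving c).det * ∏ q, (pos z.1 (c q).1 - pos z.1 (c q).2)⁻¹ =
          ∑ a, κ a * (den (pos z.1) (List.ofFn a.1))⁻¹ := by
    intro c
    by_cases hdet : (incidence moving c).det = 0
    · exact ⟨0, fun z => by simp [hdet]⟩
    · have hall : ∀ x : Fin (m + 2), x = 0 ∨ x = Fin.last (m + 1) ∨
          x ∈ Set.range (moving (m := m)) := by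
        intro x
        refine Fin.cases (Or.inl rfl) (fun x => Or.inr ?_) x
        refine Fin.lastCases (Or.inl (Fin.succ_last _)) (fun x => Or.inr ⟨x, rfl⟩) x
      obtain ⟨κ, hκ⟩ := exists_coeff_of_mem_ptSpan (prod_edges_mem_ptSpan (moving (m := m))
        (fun i j h => by simpa [moving] using h) (fun i => by simp [moving])
        (fun i => by simp [moving, Fin.ext_iff, i.2.ne]) c (fun q => ⟨hall _, hall _⟩) hdet)
      refine ⟨fun a => (incidence moving c).det * κ a, fun z => ?_⟩
      rw [hκ z, Finset.mul_sum]
      simp only [mul_assoc]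
  choose κ hκ using hκ
  refine ⟨fun a => ∑ c, ((m.factorial : ℂ)⁻¹ * (2 : ℂ)⁻¹ ^ m * κ c a) •
    detForm fun q => sCoord m (c q).1 (c q).2, fun z => ?_⟩
  ext v
  rw [detForm_apply]
  let B : Matrix (Fin m) (Fin (m + 2) × Fin (m + 2)) ℂ := Matrix.of fun i e =>
    (2 : ℂ)⁻¹ * ((if moving i = e.1 then 1 else 0) -
      if moving i = e.2 then 1 else 0) * (pos z.1 e.1 - pos z.1 e.2)⁻¹
  let F : Matrix (Fin (m + 2) × Fin (m + 2)) (Fin m) ℂ := Matrix.of fun e j =>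
    sCoord m e.1 e.2 (v j)
  have h1 : (Matrix.of fun i j => dScattering z.1 i (v j)) = B * F := by
    ext i j
    rw [Matrix.of_apply, dScattering_eq, Matrix.mul_apply, LinearMap.sum_apply]
    rfl
  have h2 : ∀ c : Fin m → Fin (m + 2) × Fin (m + 2), (B.submatrix id c).det =
      (2 : ℂ)⁻¹ ^ m * ((incidence moving c).det * ∏ q, (pos z.1 (c q).1 - pos z.1 (c q).2)⁻¹) := by
    intro c
    have : B.submatrix id c = (2 : ℂ)⁻¹ • Matrix.of fun i j =>
        (pos z.1 (c j).1 - pos z.1 (c j).2)⁻¹ * incidence moving c i j := by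
      ext i j
      simp only [B, incidence, Matrix.submatrix_apply, Matrix.of_apply, id, Matrix.smul_apply,
        smul_eq_mul]
      ring
    rw [this, Matrix.det_smul, Matrix.det_mul_row, Fintype.card_fin, mul_comm (∏ q, _)]
  have h3 : (m.factorial : ℂ) ≠ 0 := Nat.cast_ne_zero.2 (Nat.factorial_ne_zero m)
  rw [h1, ← mul_right_inj' h3, cauchyBinet]
  simp only [h2, hκ, form_sum_apply, AlternatingMap.smul_apply, Finset.smul_sum,
    smul_eq_mul, Finset.mul_sum, Finset.sum_mul]
  rw [Finset.sum_comm]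
  refine Finset.sum_congr rfl fun a _ => Finset.sum_congr rfl fun c _ => ?_
  rw [detForm_apply, show (F.submatrix c id) =
    Matrix.of fun i j => sCoord m (c i).1 (c i).2 (v j) from rfl]
  field_simp

end Trees

/-! ### Planar binary trees as families of intervals -/

section TreeIntervals

/-- The interval family of a planar binary tree with `N` leaves at the positions `0, …, N - 1`.  The
internal vertices correspond to the gaps `k` between the positions `k` and `k + 1`, and the leaves
below the vertex `k` are those at the positions in `[lo k, hi k]`.  Every interval `[i, j]` with
`i < j` has a unique lowest common ancestor, the gap of which lies in the interval. -/
structure IsTree (N : ℕ) (lo hi : ℕ → ℕ) : Prop where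
  lo_le : ∀ k, k + 1 < N → lo k ≤ k
  lt_hi : ∀ k, k + 1 < N → k < hi k
  hi_lt : ∀ k, k + 1 < N → hi k < N
  exists_top : ∀ i j, i < j → j < N → ∃ k, i ≤ k ∧ k < j ∧ lo k ≤ i ∧ j ≤ hi k
  unique : ∀ i j k k', k + 1 < N → k' + 1 < N → i ≤ k → k < j → i ≤ k' → k' < j → lo k ≤ i →
    j ≤ hi k → lo k' ≤ i → j ≤ hi k' → k = k'

variable {N : ℕ} {lo hi : ℕ → ℕ}

/-- The vertex intervals are laminar. -/
theorem IsTree.laminar (T : IsTree N lo hi) {k k' : ℕ} (hk : k + 1 < N) (hk' : k' + 1 < N)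
    (h1 : lo k' ≤ k) (h2 : k < hi k') : lo k' ≤ lo k ∧ hi k ≤ hi k' := by
  have a1 := T.lo_le k hk
  have a2 := T.lt_hi k hk
  have a3 := T.hi_lt k hk
  have b1 := T.lo_le k' hk'
  have b2 := T.lt_hi k' hk'
  have b3 := T.hi_lt k' hk'
  have c1 : lo k' ≤ lo k := by
    by_contra hlt
    obtain ⟨K, e1, e2, e3, e4⟩ := T.exists_top (lo k) (max (hi k) (hi k')) (by omega) (by omega)
    by_cases hK : lo k' ≤ K ∧ K < hi k'
    · have := T.unique (lo k') (hi k') K k' (by omega) hk' hK.1 hK.2 b1 b2 (by omega) (by omega)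
        le_rfl le_rfl
      subst this; omega
    · have := T.unique (lo k) (hi k) K k (by omega) hk e1 (by omega) a1 a2 e3 (by omega)
        le_rfl le_rfl
      omega
  refine ⟨c1, ?_⟩
  by_contra hlt
  obtain ⟨K, e1, e2, e3, e4⟩ := T.exists_top (lo k') (hi k) (by omega) (by omega)
  by_cases hK : K < hi k'
  · have := T.unique (lo k') (hi k') K k' (by omega) hk' e1 hK b1 b2 (by omega) (by omega)
      le_rfl le_rfl
    subst this; omega
  · have := T.unique (lo k) (hi k) K k (by omega) hk (by omega) (by omega) a1 a2 (by omega)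
      (by omega) le_rfl le_rfl
    omega

/-- A vertex lies above `[i, j]` if and only if it lies above the lowest common ancestor. -/
theorem IsTree.top_mem_iff (T : IsTree N lo hi) {i j k p : ℕ} (hj : j < N) (hik : i ≤ k)
    (hkj : k < j) (h1 : lo k ≤ i) (h2 : j ≤ hi k) (hp : p + 1 < N) :
    (lo p ≤ k ∧ k < hi p) ↔ (lo p ≤ i ∧ j ≤ hi p) := by
  constructor
  · rintro ⟨e1, e2⟩
    have := T.laminar (k := k) (by omega) hp e1 e2
    omega
  · rintro ⟨e1, e2⟩
    omega

/-- The interval `[i, j]` is the set of leaves below an internal vertex. -/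
def IsNode (N : ℕ) (lo hi : ℕ → ℕ) (i j : ℕ) : Prop := ∃ k, k + 1 < N ∧ lo k = i ∧ hi k = j

/-- The left subtree at the gap `j` consists of the positions `lo j, …, j`. -/
theorem IsTree.exists_node_iff (T : IsTree N lo hi) {i j : ℕ} (hij : i < j) (hj : j + 1 < N) :
    (∃ i', i' ≤ i ∧ IsNode N lo hi i' j) ↔ lo j ≤ i := by
  have key : ∀ k, k + 1 < N → hi k = j → lo j ≤ lo k := by
    intro k hk hkj
    have a1 := T.lo_le k hk
    have a2 := T.lt_hi k hk
    obtain ⟨K, e1, e2, e3, e4⟩ := T.exists_top (lo k) (j + 1) (by omega) hj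
    by_cases hK : K = j
    · subst hK; exact e3
    · have := T.unique (lo k) j K k (by omega) hk e1 (by omega) a1 (by omega) e3 (by omega) le_rfl
        hkj.ge
      subst this; omega
  constructor
  · rintro ⟨i', hi', k, hk, rfl, hkj⟩
    exact (key k hk hkj).trans hi'
  · intro h
    obtain ⟨K, e1, e2, e3, e4⟩ := T.exists_top (lo j) j (by omega) (by omega)
    have hhi : hi K = j := by
      by_contra hne
      have b := T.lt_hi j hj
      have := T.unique (lo j) (j + 1) K j (by omega) hj e1 (by omega) (T.lo_le j hj) (by omega) e3
        (by omega) le_rfl (by omega)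
      omega
    have := key K (by omega) hhi
    exact ⟨lo K, by omega, K, by omega, rfl, hhi⟩

end TreeIntervals

section TreeOfMagma
variable {α : Type*}

/-- The left end of the interval of the internal vertex at the gap `k`. -/
def lo : FreeMagma α → ℕ → ℕ
  | FreeMagma.of _, _ => 0
  | FreeMagma.mul l r, k =>
    if k + 1 < (leaves l).length then lo l k
    else if k + 1 = (leaves l).length then 0
    else (leaves l).length + lo r (k - (leaves l).length)

/-- The right end of the interval of the internal vertex at the gap `k`. -/
def hi : FreeMagma α → ℕ → ℕ
  | FreeMagma.of _, _ => 0
  | FreeMagma.mul l r, k =>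
    if k + 1 < (leaves l).length then hi l k
    else if k + 1 = (leaves l).length then (leaves l).length + (leaves r).length - 1
    else (leaves l).length + hi r (k - (leaves l).length)

theorem lo_mul (l r : FreeMagma α) (k : ℕ) : lo (FreeMagma.mul l r) k =
    if k + 1 < (leaves l).length then lo l k
    else if k + 1 = (leaves l).length then 0
    else (leaves l).length + lo r (k - (leaves l).length) := rfl

theorem hi_mul (l r : FreeMagma α) (k : ℕ) : hi (FreeMagma.mul l r) k =
    if k + 1 < (leaves l).length then hi l k
    else if k + 1 = (leaves l).length then (leaves l).length + (leaves r).length - 1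
    else (leaves l).length + hi r (k - (leaves l).length) := rfl

theorem isTree (t : FreeMagma α) : IsTree (leaves t).length (lo t) (hi t) := by
  induction t using FreeMagma.rec with
  | of x =>
    have h : (leaves (FreeMagma.of x)).length = 1 := rfl
    constructor <;> intros <;> omega
  | mul l r hl hr =>
    have pl := leaves_length_pos l
    have pr := leaves_length_pos r
    have hN : (leaves (FreeMagma.mul l r)).length = (leaves l).length + (leaves r).length := by
      rw [leaves_mul, List.length_append]
    rw [hN]
    set a := (leaves l).length with ha
    set b := (leaves r).length with hb
    have L : ∀ k, k + 1 < a → lo (FreeMagma.mul l r) k = lo l k ∧ hi (FreeMagma.mul l r) k = hi l k :=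
      fun k hk => by rw [lo_mul, hi_mul, if_pos (by omega), if_pos (by omega)]; exact ⟨rfl, rfl⟩
    have M : lo (FreeMagma.mul l r) (a - 1) = 0 ∧ hi (FreeMagma.mul l r) (a - 1) = a + b - 1 := by
      rw [lo_mul, hi_mul, if_neg (by omega), if_pos (by omega), if_neg (by omega),
        if_pos (by omega)]
      exact ⟨rfl, rfl⟩
    have R : ∀ k, lo (FreeMagma.mul l r) (a + k) = a + lo r k ∧
        hi (FreeMagma.mul l r) (a + k) = a + hi r k := fun k => by
      rw [lo_mul, hi_mul, if_neg (by omega), if_neg (by omega), if_neg (by omega),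
        if_neg (by omega), ← ha, Nat.add_sub_cancel_left]
      exact ⟨rfl, rfl⟩
    have bounds : ∀ k, k + 1 < a + b → (k + 1 < a ∧ lo (FreeMagma.mul l r) k = lo l k ∧
        hi (FreeMagma.mul l r) k = hi l k ∧ lo l k ≤ k ∧ k < hi l k ∧ hi l k < a) ∨
        (k + 1 = a ∧ lo (FreeMagma.mul l r) k = 0 ∧ hi (FreeMagma.mul l r) k = a + b - 1) ∨
        (∃ k', k = a + k' ∧ k' + 1 < b ∧ lo (FreeMagma.mul l r) k = a + lo r k' ∧
          hi (FreeMagma.mul l r) k = a + hi r k' ∧ lo r k' ≤ k' ∧ k' < hi r k' ∧ hi r k' < b) := by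
      intro k hk
      rcases lt_trichotomy (k + 1) a with h | h | h
      · exact Or.inl ⟨h, (L k h).1, (L k h).2, hl.lo_le k h, hl.lt_hi k h, hl.hi_lt k h⟩
      · obtain rfl : k = a - 1 := by omega
        exact Or.inr (Or.inl ⟨h, M⟩)
      · obtain ⟨k', rfl⟩ : ∃ k', k = a + k' := ⟨k - a, by omega⟩
        have hk' : k' + 1 < b := by omega
        exact Or.inr (Or.inr ⟨k', rfl, hk', (R k').1, (R k').2, hr.lo_le k' hk', hr.lt_hi k' hk',
          hr.hi_lt k' hk'⟩)
    constructor
    · intro k hk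
      rcases bounds k hk with h | h | ⟨k', h⟩ <;> omega
    · intro k hk
      rcases bounds k hk with h | h | ⟨k', h⟩ <;> omega
    · intro k hk
      rcases bounds k hk with h | h | ⟨k', h⟩ <;> omega
    · intro i j hij hj
      by_cases h1 : j < a
      · obtain ⟨k, h⟩ := hl.exists_top i j hij h1
        have := L k (by omega)
        exact ⟨k, by omega⟩
      · by_cases h2 : a ≤ i
        · obtain ⟨k, h⟩ := hr.exists_top (i - a) (j - a) (by omega) (by omega)
          have := R k
          exact ⟨a + k, by omega⟩
        · exact ⟨a - 1, by omega⟩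
    · intro i j k k' hk hk' e1 e2 e3 e4 e5 e6 e7 e8
      rcases bounds k hk with h | h | ⟨q, h⟩ <;> rcases bounds k' hk' with h' | h' | ⟨q', h'⟩
      · exact hl.unique i j k k' (by omega) (by omega) e1 e2 e3 e4 (by omega) (by omega) (by omega)
          (by omega)
      · omega
      · omega
      · omega
      · omega
      · omega
      · omega
      · omega
      · have := hr.unique (i - a) (j - a) q q' (by omega) (by omega) (by omega) (by omega) (by omega)
          (by omega) (by omega) (by omega) (by omega) (by omega)
        omega

/-- The leaves of a proper subtree are those at the positions of a vertex interval. -/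
theorem exists_interval_of_mem_subtrees {t s : FreeMagma α} (hs : s ∈ subtrees t) :
    (∃ x, s = FreeMagma.of x) ∨ ∃ k, k + 1 < (leaves t).length ∧ ∀ x, x ∈ leaves s ↔
      ∃ q, lo t k ≤ q ∧ q ≤ hi t k ∧ (leaves t)[q]? = some x := by
  induction t using FreeMagma.rec with
  | of y =>
    left
    exact ⟨y, by simpa [subtrees] using hs⟩
  | mul l r hl hr =>
    have pl := leaves_length_pos l
    have pr := leaves_length_pos r
    simp only [subtrees, List.mem_cons, List.mem_append] at hs
    rcases hs with rfl | hs | hs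
    · right
      refine ⟨(leaves l).length - 1, ?_, fun x => ?_⟩
      · rw [leaves_mul, List.length_append]; omega
      · rw [lo_mul, hi_mul, if_neg (by omega), if_pos (by omega), if_neg (by omega),
          if_pos (by omega), leaves_mul, List.mem_iff_getElem?]
        constructor
        · rintro ⟨q, hq⟩
          have := (List.getElem?_eq_some_iff.1 hq).1
          rw [List.length_append] at this
          exact ⟨q, by omega, by omega, hq⟩
        · rintro ⟨q, -, -, hq⟩
          exact ⟨q, hq⟩
    · rcases hl hs with h | ⟨k, hk, h⟩
      · exact Or.inl h
      · right
        have := (isTree l).hi_lt k hk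
        refine ⟨k, by rw [leaves_mul, List.length_append]; omega, fun x => ?_⟩
        rw [h, lo_mul, hi_mul, if_pos hk, if_pos hk, leaves_mul]
        refine exists_congr fun q => and_congr_right fun _ => and_congr_right fun hq => ?_
        rw [List.getElem?_append_left (by omega)]
    · rcases hr hs with h | ⟨k, hk, h⟩
      · exact Or.inl h
      · right
        refine ⟨(leaves l).length + k, by rw [leaves_mul, List.length_append]; omega, fun x => ?_⟩
        rw [h, lo_mul, hi_mul, if_neg (by omega), if_neg (by omega), if_neg (by omega),
          if_neg (by omega), leaves_mul, Nat.add_sub_cancel_left]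
        constructor
        · rintro ⟨q, h1, h2, h3⟩
          refine ⟨(leaves l).length + q, by omega, by omega, ?_⟩
          rw [List.getElem?_append_right (by omega), Nat.add_sub_cancel_left, h3]
        · rintro ⟨q, h1, h2, h3⟩
          rw [List.getElem?_append_right (by omega)] at h3
          exact ⟨q - (leaves l).length, by omega, by omega, h3⟩

/-- Every vertex interval consists of the positions of the leaves of a subtree. -/
theorem exists_subtree_of_gap {t : FreeMagma α} {k : ℕ} (hk : k + 1 < (leaves t).length) :
    ∃ s ∈ subtrees t, ∀ x, x ∈ leaves s ↔
      ∃ q, lo t k ≤ q ∧ q ≤ hi t k ∧ (leaves t)[q]? = some x := by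
  induction t using FreeMagma.rec generalizing k with
  | of y => simp [leaves] at hk
  | mul l r hl hr =>
    have pl := leaves_length_pos l
    have pr := leaves_length_pos r
    rw [leaves_mul, List.length_append] at hk
    rcases lt_trichotomy (k + 1) (leaves l).length with h | h | h
    · obtain ⟨s, hs, e⟩ := hl h
      have := (isTree l).hi_lt k h
      refine ⟨s, by simp [subtrees, hs], fun x => ?_⟩
      rw [e, lo_mul, hi_mul, if_pos h, if_pos h, leaves_mul]
      refine exists_congr fun q => and_congr_right fun _ => and_congr_right fun hq => ?_
      rw [List.getElem?_append_left (by omega)]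
    · refine ⟨FreeMagma.mul l r, by simp [subtrees], fun x => ?_⟩
      rw [lo_mul, hi_mul, if_neg (by omega), if_pos (by omega), if_neg (by omega),
        if_pos (by omega), leaves_mul, List.mem_iff_getElem?]
      constructor
      · rintro ⟨q, hq⟩
        have := (List.getElem?_eq_some_iff.1 hq).1
        rw [List.length_append] at this
        exact ⟨q, by omega, by omega, hq⟩
      · rintro ⟨q, -, -, hq⟩
        exact ⟨q, hq⟩
    · obtain ⟨k', rfl⟩ : ∃ k', k = (leaves l).length + k' := ⟨k - (leaves l).length, by omega⟩
      obtain ⟨s, hs, e⟩ := hr (k := k') (by omega)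
      refine ⟨s, by simp [subtrees, hs], fun x => ?_⟩
      rw [e, lo_mul, hi_mul, if_neg (by omega), if_neg (by omega), if_neg (by omega),
        if_neg (by omega), leaves_mul, Nat.add_sub_cancel_left]
      constructor
      · rintro ⟨q, h1, h2, h3⟩
        refine ⟨(leaves l).length + q, by omega, by omega, ?_⟩
        rw [List.getElem?_append_right (by omega), Nat.add_sub_cancel_left, h3]
      · rintro ⟨q, h1, h2, h3⟩
        rw [List.getElem?_append_right (by omega)] at h3
        exact ⟨q - (leaves l).length, by omega, by omega, h3⟩

end TreeOfMagma

/-! ### Degenerating configurations -/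

section Degeneration

/-- The differences `y_{i-1} - y_j` of positions, where the position of index `i = 0` (one step to
the left of the first point) or `j = N` is infinite and its differences are normalised to `1`. -/
def rho (N : ℕ) (y : ℕ → ℂ) (i j : ℕ) : ℂ := if i = 0 ∨ N ≤ j then 1 else y (i - 1) - y j

/-- The dihedral coordinate of the interval `[i, j]`. -/
def crossU (N : ℕ) (y : ℕ → ℂ) (i j : ℕ) : ℂ :=
  rho N y (i + 1) j * rho N y i (j + 1) / (rho N y (i + 1) (j + 1) * rho N y i j)

theorem rho_succ {N : ℕ} (y : ℕ → ℂ) {i j : ℕ} (hj : j < N) : rho N y (i + 1) j = y i - y j := by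
  rw [rho, if_neg (by omega), Nat.add_sub_cancel]

theorem rho_zero (N : ℕ) (y : ℕ → ℂ) (j : ℕ) : rho N y 0 j = 1 := by
  rw [rho, if_pos (Or.inl rfl)]

theorem rho_of_le {N : ℕ} (y : ℕ → ℂ) (i : ℕ) {j : ℕ} (hj : N ≤ j) : rho N y i j = 1 := by
  rw [rho, if_pos (Or.inr hj)]

theorem rho_ne_zero {N : ℕ} {y : ℕ → ℂ} (h : ∀ i j, i < j → j < N → y i - y j ≠ 0) {i j : ℕ}
    (hij : i ≤ j) : rho N y i j ≠ 0 := by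
  rw [rho]
  split_ifs with h'
  · exact one_ne_zero
  · exact h _ _ (by omega) (by omega)

open Classical in
/-- A family of configurations `y` of `N` points on the line converges to the point of the boundary
of the moduli space that is given by a tree: the dihedral coordinates of the vertices of the tree
tend to `0` and the others tend to `1`. -/
structure Degenerates {X : Type*} (F : Filter X) (N : ℕ) (lo hi : ℕ → ℕ) (y : X → ℕ → ℂ) :
    Prop where
  tree : IsTree N lo hi
  ne : ∀ᶠ x in F, ∀ i j, i < j → j < N → y x i - y x j ≠ 0
  lim : ∀ i j, i < j → j < N → ¬ (i = 0 ∧ j + 1 = N) →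
    Tendsto (fun x => crossU N (y x) i j) F (𝓝 (if IsNode N lo hi i j then 0 else 1))

variable {X : Type*} {F : Filter X} {N : ℕ} {lo hi : ℕ → ℕ} {y : X → ℕ → ℂ}

open Classical in
/-- Since `(y_i - y_j) / (y_i - y_{j+1}) = ∏_{i' ≤ i} u_{[i', j]}`, this ratio tends to `0` if the
left subtree at the gap `j` contains `i`, and to `1` otherwise. -/
theorem Degenerates.tendsto_ratio (D : Degenerates F N lo hi y) {i j : ℕ} (hij : i < j)
    (hj : j + 1 < N) : Tendsto (fun x => (y x i - y x j) / (y x i - y x (j + 1))) F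
      (𝓝 (if lo j ≤ i then 0 else 1)) := by
  induction i with
  | zero =>
    have h := D.lim 0 j hij (by omega) (by omega)
    have e : IsNode N lo hi 0 j ↔ lo j ≤ 0 := by
      rw [← D.tree.exists_node_iff hij hj]
      constructor
      · intro h; exact ⟨0, le_rfl, h⟩
      · rintro ⟨i', h1, h2⟩
        rwa [Nat.le_zero.1 h1] at h2
    simp only [e] at h
    convert h using 2 with x
    rw [crossU, rho_zero, rho_zero, rho_succ _ (by omega), rho_succ _ (by omega), mul_one, mul_one]
  | succ i ih =>
    have h := (ih (by omega)).mul (D.lim (i + 1) j hij (by omega) (by omega))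
    have e : (lo j ≤ i ∨ IsNode N lo hi (i + 1) j) ↔ lo j ≤ i + 1 := by
      rw [← D.tree.exists_node_iff hij hj, ← D.tree.exists_node_iff (i := i) (by omega) hj]
      constructor
      · rintro (⟨i', h1, h2⟩ | h)
        · exact ⟨i', by omega, h2⟩
        · exact ⟨i + 1, le_rfl, h⟩
      · rintro ⟨i', h1, h2⟩
        rcases Nat.le_succ_iff.1 h1 with h1 | rfl
        · exact Or.inl ⟨i', h1, h2⟩
        · exact Or.inr h2
    have e2 : ((if lo j ≤ i then 0 else 1) * if IsNode N lo hi (i + 1) j then 0 else 1) =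
        if lo j ≤ i + 1 then (0 : ℂ) else 1 := by
      rw [← if_congr e rfl rfl]
      by_cases h1 : lo j ≤ i <;> by_cases h2 : IsNode N lo hi (i + 1) j <;> simp [h1, h2]
    rw [e2] at h
    refine h.congr' ?_
    filter_upwards [D.ne] with x hx
    have n1 := hx i j (by omega) (by omega)
    have n2 := hx i (j + 1) (by omega) (by omega)
    have n3 := hx (i + 1) (j + 1) (by omega) (by omega)
    rw [crossU, rho_succ _ (by omega), rho_succ _ (by omega), rho_succ _ (by omega),
      rho_succ _ (by omega)]
    field_simp

open Classical in
/-- The gap of the lowest common ancestor of `i` and `j` dominates `y_i - y_j`. -/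
theorem Degenerates.tendsto_gap (D : Degenerates F N lo hi y) {i j k : ℕ} (hik : i ≤ k)
    (hkj : k < j) (hj : j < N) :
    Tendsto (fun x => (y x k - y x (k + 1)) / (y x i - y x j)) F
      (𝓝 (if lo k ≤ i ∧ j ≤ hi k then 1 else 0)) := by
  have T := D.tree
  induction j with
  | zero => omega
  | succ j ih =>
    by_cases hk : k = j
    · subst hk
      have a1 := T.lo_le k hj
      have a2 := T.lt_hi k hj
      by_cases hi' : i = k
      · subst hi'
        rw [if_pos (by omega)]
        refine tendsto_const_nhds.congr' ?_
        filter_upwards [D.ne] with x hx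
        rw [div_self (hx i (i + 1) (by omega) hj)]
      · have h := (tendsto_const_nhds (x := (1 : ℂ))).sub
          (D.tendsto_ratio (i := i) (j := k) (by omega) hj)
        have e : (1 : ℂ) - (if lo k ≤ i then 0 else 1) =
            if lo k ≤ i ∧ k + 1 ≤ hi k then 1 else 0 := by
          by_cases h1 : lo k ≤ i
          · rw [if_pos h1, if_pos (by omega), sub_zero]
          · rw [if_neg h1, if_neg (by omega), sub_self]
        rw [e] at h
        refine h.congr' ?_
        filter_upwards [D.ne] with x hx
        have n := hx i (k + 1) (by omega) hj
        field_simp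
        ring
    · have h := (ih (by omega) (by omega)).mul (D.tendsto_ratio (i := i) (j := j) (by omega) hj)
      have e : ((if lo k ≤ i ∧ j ≤ hi k then 1 else 0) * if lo j ≤ i then 0 else 1) =
          if lo k ≤ i ∧ j + 1 ≤ hi k then (1 : ℂ) else 0 := by
        have a2 := T.lt_hi j hj
        by_cases h1 : lo k ≤ i ∧ j + 1 ≤ hi k
        · have h2 : ¬ lo j ≤ i := by
            intro h2
            have := T.unique i (j + 1) k j (by omega) hj hik hkj (by omega) (by omega) h1.1 h1.2 h2
              (by omega)
            exact hk this
          rw [if_pos h1, if_pos (by omega), if_neg h2, mul_one]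
        · rw [if_neg h1]
          by_cases h2 : lo j ≤ i
          · rw [if_pos h2, mul_zero]
          · rw [if_neg (c := lo k ≤ i ∧ j ≤ hi k), zero_mul]
            intro h3
            obtain ⟨K, e1, e2, e3, e4⟩ := T.exists_top i (j + 1) (by omega) hj
            by_cases hKj : K = j
            · subst hKj; exact h2 e3
            · have := T.unique i j K k (by omega) (by omega) e1 (by omega) hik (by omega) e3
                (by omega) h3.1 h3.2
              subst this
              exact h1 ⟨e3, e4⟩
      rw [e] at h
      refine h.congr' ?_
      filter_upwards [D.ne] with x hx
      have n1 := hx i j (by omega) (by omega)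
      have n2 := hx i (j + 1) (by omega) (by omega)
      field_simp

theorem sub_eq_sum_gap (f : ℕ → ℂ) {a b : ℕ} (h : a ≤ b) :
    f a - f b = ∑ k ∈ Finset.Ico a b, (f k - f (k + 1)) := by
  rw [Finset.sum_Ico_eq_sub _ h, Finset.sum_range_sub', Finset.sum_range_sub']
  ring

/-- If the gaps inside `[e, f]` are negligible compared with `Δ`, so are all differences. -/
theorem tendsto_sub_div {Δ : X → ℂ} {e f : ℕ}
    (h : ∀ k, e ≤ k → k < f → Tendsto (fun x => (y x k - y x (k + 1)) / Δ x) F (𝓝 0)) {a b : ℕ}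
    (ha : e ≤ a ∧ a ≤ f) (hb : e ≤ b ∧ b ≤ f) :
    Tendsto (fun x => (y x a - y x b) / Δ x) F (𝓝 0) := by
  have key : ∀ a b, a ≤ b → e ≤ a → b ≤ f →
      Tendsto (fun x => (y x a - y x b) / Δ x) F (𝓝 0) := by
    intro a b hab ha hb
    have : (fun x => (y x a - y x b) / Δ x) =
        fun x => ∑ k ∈ Finset.Ico a b, (y x k - y x (k + 1)) / Δ x := by
      funext x
      rw [sub_eq_sum_gap (y x) hab, Finset.sum_div]
    rw [this, show (0 : ℂ) = ∑ k ∈ Finset.Ico a b, 0 by simp]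
    refine tendsto_finsetSum _ fun k hk => ?_
    rw [Finset.mem_Ico] at hk
    exact h k (by omega) (by omega)
  rcases le_total a b with hab | hab
  · exact key a b hab ha.1 hb.2
  · have := (key b a hab hb.1 ha.2).neg
    rw [neg_zero] at this
    refine this.congr fun x => ?_
    rw [← neg_div, neg_sub]

/-- Points below a vertex are much closer to each other than to the other points. -/
theorem Degenerates.tendsto_inside (D : Degenerates F N lo hi y) {k a b c : ℕ} (hk : k + 1 < N)
    (ha : lo k ≤ a ∧ a ≤ hi k) (hb : lo k ≤ b ∧ b ≤ hi k) (hc : c < lo k ∨ hi k < c)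
    (hcN : c < N) : Tendsto (fun x => (y x a - y x b) / (y x c - y x b)) F (𝓝 0) := by
  classical
  have T := D.tree
  have a1 := T.lo_le k hk
  have a2 := T.lt_hi k hk
  have a3 := T.hi_lt k hk
  -- compare both differences with the distance of `c` from the far end of the interval
  have main : ∃ (Δ : X → ℂ) (d : ℕ), (∀ᶠ x in F, Δ x ≠ 0) ∧ (lo k ≤ d ∧ d ≤ hi k) ∧
      (∀ x, Δ x = y x c - y x d) ∧ ∀ k', lo k ≤ k' → k' < hi k →
        Tendsto (fun x => (y x k' - y x (k' + 1)) / Δ x) F (𝓝 0) := by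
    rcases hc with hc | hc
    · refine ⟨fun x => y x c - y x (hi k), hi k, ?_, by omega, fun x => rfl, fun k' h1 h2 => ?_⟩
      · filter_upwards [D.ne] with x hx
        exact hx _ _ (by omega) (by omega)
      · have := D.tendsto_gap (i := c) (j := hi k) (k := k') (by omega) h2 a3
        rwa [if_neg] at this
        intro h
        have := T.laminar (k := k') (k' := k) (by omega) hk h1 h2
        omega
    · refine ⟨fun x => y x c - y x (lo k), lo k, ?_, by omega, fun x => rfl, fun k' h1 h2 => ?_⟩
      · filter_upwards [D.ne] with x hx
        rw [← neg_sub]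
        exact neg_ne_zero.2 (hx _ _ (by omega) (by omega))
      · have := D.tendsto_gap (i := lo k) (j := c) (k := k') h1 (by omega) hcN
        rw [if_neg] at this
        · have := this.neg
          rw [neg_zero] at this
          refine this.congr fun x => ?_
          rw [← div_neg, neg_sub]
        · intro h
          have := T.laminar (k := k') (k' := k) (by omega) hk h1 h2
          omega
  obtain ⟨Δ, d, hΔ, hd, hΔd, hgap⟩ := main
  have e1 := tendsto_sub_div hgap ha hb
  have e2 := (tendsto_sub_div hgap hd hb).const_add 1
  have e3 := e1.div e2 (by simp)
  rw [add_zero, zero_div] at e3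
  refine e3.congr' ?_
  filter_upwards [hΔ] with x hx
  rw [Pi.div_apply]
  have : 1 + (y x d - y x b) / Δ x = (y x c - y x b) / Δ x := by
    rw [eq_div_iff hx, add_mul, div_mul_cancel₀ _ hx, hΔd]
    ring
  rw [this, div_div_div_cancel_right₀ hx]

end Degeneration

/-! ### Parke-Taylor factors of degenerating configurations -/

section WordLimits
variable {m : ℕ} {X : Type*} {F : Filter X} {σ : X → Fin (m + 2) → ℂ}

theorem den_cons {σ : Fin (m + 2) → ℂ} {x : Fin (m + 2)} {l : List (Fin (m + 2))} {y : Fin (m + 2)}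
    (h : l.head? = some y) : den σ (x :: l) = (σ x - σ y) * den σ l := by
  cases l with
  | nil => simp at h
  | cons z l =>
    rw [List.head?_cons, Option.some.injEq] at h
    subst h
    rfl

theorem den_append {σ : Fin (m + 2) → ℂ} {u v : List (Fin (m + 2))} {x y : Fin (m + 2)}
    (hu : u.getLast? = some x) (hv : v.head? = some y) :
    den σ (u ++ v) = den σ u * (σ x - σ y) * den σ v := by
  induction u with
  | nil => simp at hu
  | cons z u ih =>
    cases u with
    | nil =>
      simp only [List.getLast?_singleton, Option.some.injEq] at hu
      subst hu
      rw [List.singleton_append, den_cons hv, den, one_mul]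
    | cons z' u =>
      rw [List.getLast?_cons_cons] at hu
      rw [List.cons_append, List.cons_append, den, den, ← List.cons_append, ih hu]
      ring

theorem den_ne_zero {σ : Fin (m + 2) → ℂ} (hσ : Function.Injective σ) {w : List (Fin (m + 2))}
    (nd : w.Nodup) : den σ w ≠ 0 := by
  induction w with
  | nil => exact one_ne_zero
  | cons x w ih =>
    cases w with
    | nil => exact one_ne_zero
    | cons y w =>
      rw [den]
      have nd' := List.nodup_cons.1 nd
      refine mul_ne_zero (sub_ne_zero.2 fun h => ?_) (ih nd'.2)
      rw [hσ h] at nd'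
      exact nd'.1 List.mem_cons_self

/-- The points split into two clusters, according to `P` and its complement `Q`, whose diameters
are negligible compared with their distance; `p` and `q` are points of the clusters. -/
structure TwoClusters (F : Filter X) (σ : X → Fin (m + 2) → ℂ) (S : Set (Fin (m + 2)))
    (P Q : Fin (m + 2) → Bool) (p q : Fin (m + 2)) : Prop where
  compl : ∀ x, Q x = !P x
  inj : ∀ᶠ x in F, Function.Injective (σ x)
  lim : ∀ x ∈ S, ∀ y ∈ S, ∀ z ∈ S, P x = P y → P z ≠ P x →
    Tendsto (fun t => (σ t x - σ t y) / (σ t x - σ t z)) F (𝓝 0)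
  memp : p ∈ S
  memq : q ∈ S
  hp : P p = true
  hq : Q q = true

variable {S : Set (Fin (m + 2))} {P Q : Fin (m + 2) → Bool} {p q : Fin (m + 2)}

theorem TwoClusters.symm (T : TwoClusters F σ S P Q p q) : TwoClusters F σ S Q P q p where
  compl x := by simp [T.compl]
  inj := T.inj
  lim x hx y hy z hz h1 h2 := T.lim x hx y hy z hz (by simpa [T.compl] using h1)
    (by simpa [T.compl] using h2)
  memp := T.memq
  memq := T.memp
  hp := T.hq
  hq := T.hp

theorem TwoClusters.tendsto_cross (T : TwoClusters F σ S P Q p q) {x y : Fin (m + 2)} (hx : x ∈ S)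
    (hy : y ∈ S) (hPx : P x = true) (hQy : Q y = true) :
    Tendsto (fun t => (σ t p - σ t q) / (σ t x - σ t y)) F (𝓝 1) := by
  have hPy : P y = false := by simpa [T.compl] using hQy
  have hPq : P q = false := by simpa [T.compl] using T.hq
  have h1 := T.lim x hx p T.memp y hy (by rw [hPx, T.hp]) (by simp [hPx, hPy])
  have h2 := T.lim y hy q T.memq x hx (by rw [hPq, hPy]) (by simp [hPx, hPy])
  have h3 := (h1.const_sub 1).sub h2
  simp only [sub_zero] at h3
  refine h3.congr' ?_
  filter_upwards [T.inj] with t ht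
  have n1 : σ t x - σ t y ≠ 0 := sub_ne_zero.2 fun h => by
    rw [ht h, hPy] at hPx; exact absurd hPx (by simp)
  have n2 : σ t y - σ t x ≠ 0 := by rw [← neg_sub]; exact neg_ne_zero.2 n1
  rw [← neg_sub (σ t x) (σ t y)]
  field_simp
  ring

/-- The factor by which the Parke-Taylor denominator of `w` differs from those of its subwords in
the two clusters. -/
def splitRatio (σ : Fin (m + 2) → ℂ) (P Q : Fin (m + 2) → Bool) (w : List (Fin (m + 2))) : ℂ :=
  den σ (w.filter P) * den σ (w.filter Q) / den σ w

/-- The limit of `σ_pq · splitRatio`: every change of cluster along the word beyond the first one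
costs a factor that tends to infinity. -/
def SplitLimit (F : Filter X) (σ : X → Fin (m + 2) → ℂ) (P Q : Fin (m + 2) → Bool)
    (p q : Fin (m + 2)) (w : List (Fin (m + 2))) : Prop :=
  (∃ x ∈ w, P x = true) → (∃ x ∈ w, Q x = true) →
    Tendsto (fun t => (σ t p - σ t q) * splitRatio (σ t) P Q w) F
      (𝓝 ((if w = w.filter P ++ w.filter Q then 1 else 0) -
        if w = w.filter Q ++ w.filter P then 1 else 0))

theorem SplitLimit.symm {w : List (Fin (m + 2))} (h : SplitLimit F σ P Q p q w) :
    SplitLimit F σ Q P q p w := by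
  intro h1 h2
  have := (h h2 h1).neg
  rw [neg_sub] at this
  refine this.congr fun t => ?_
  rw [splitRatio, splitRatio, ← neg_mul, neg_sub, mul_comm (den _ (w.filter P))]

theorem TwoClusters.splitLimit_cons (T : TwoClusters F σ S P Q p q) {x : Fin (m + 2)}
    {w : List (Fin (m + 2))} (nd : (x :: w).Nodup) (hS : ∀ y ∈ x :: w, y ∈ S) (hx : P x = true)
    (ih : SplitLimit F σ P Q p q w) : SplitLimit F σ P Q p q (x :: w) := by
  intro _ h2
  have hQx : Q x = false := by simp [T.compl, hx]
  have fP : (x :: w).filter P = x :: w.filter P := by simp [hx]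
  have fQ : (x :: w).filter Q = w.filter Q := by simp [hQx]
  have hQ : ∃ y ∈ w, Q y = true := by
    obtain ⟨y, hy, hQy⟩ := h2
    rcases List.mem_cons.1 hy with rfl | hy
    · simp [hQx] at hQy
    · exact ⟨y, hy, hQy⟩
  have hne : ∀ y, y ∈ w → ∀ᶠ t in F, σ t x - σ t y ≠ 0 := fun y hy => by
    filter_upwards [T.inj] with t ht
    refine sub_ne_zero.2 fun h => ?_
    rw [ht h] at nd
    exact (List.nodup_cons.1 nd).1 hy
  have hQP : x :: w ≠ w.filter Q ++ (x :: w.filter P) := by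
    intro h
    obtain ⟨y, hy, hQy⟩ := hQ
    have : y ∈ w.filter Q := List.mem_filter.2 ⟨hy, hQy⟩
    cases hf : w.filter Q with
    | nil => rw [hf] at this; simp at this
    | cons z l =>
      rw [hf, List.cons_append] at h
      have hz : z ∈ w.filter Q := by rw [hf]; exact List.mem_cons_self
      have := (List.mem_filter.1 hz).2
      rw [← (List.cons.inj h).1, hQx] at this
      exact absurd this (by simp)
  rw [fP, fQ, if_neg hQP, sub_zero, List.cons_append]
  obtain ⟨y, w', rfl⟩ : ∃ y w', w = y :: w' := by
    cases w with
    | nil => obtain ⟨y, hy, -⟩ := hQ; simp at hy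
    | cons y w' => exact ⟨y, w', rfl⟩
  have hyw : y ∈ y :: w' := List.mem_cons_self
  by_cases hPw : ∃ z ∈ y :: w', P z = true
  · have ih := ih hPw hQ
    by_cases hy : P y = true
    · have hQy : Q y = false := by simp [T.compl, hy]
      have e2 : y :: w' ≠ (y :: w').filter Q ++ (y :: w').filter P := by
        intro h
        obtain ⟨z, hz, hQz⟩ := hQ
        have : z ∈ (y :: w').filter Q := List.mem_filter.2 ⟨hz, hQz⟩
        cases hf : (y :: w').filter Q with
        | nil => rw [hf] at this; simp at this
        | cons z l =>
          rw [hf, List.cons_append] at h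
          have hz : z ∈ (y :: w').filter Q := by rw [hf]; exact List.mem_cons_self
          have := (List.mem_filter.1 hz).2
          rw [← (List.cons.inj h).1, hQy] at this
          exact absurd this (by simp)
      rw [if_neg e2, sub_zero] at ih
      simp only [List.cons.injEq, true_and]
      refine ih.congr' ?_
      filter_upwards [hne y hyw] with t ht
      rw [splitRatio, splitRatio, fP, fQ, den_cons (y := y) (l := (y :: w').filter P) (by simp [hy]),
        den_cons (y := y) (l := y :: w') rfl, mul_assoc (σ t x - σ t y), mul_div_mul_left _ _ ht]
    · have hQy : Q y = true := by simpa [T.compl] using hy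
      obtain ⟨z, l, hz⟩ : ∃ z l, (y :: w').filter P = z :: l := by
        obtain ⟨z, hz, hPz⟩ := hPw
        have : z ∈ (y :: w').filter P := List.mem_filter.2 ⟨hz, hPz⟩
        cases hf : (y :: w').filter P with
        | nil => rw [hf] at this; simp at this
        | cons z l => exact ⟨z, l, rfl⟩
      have hz' : z ∈ (y :: w').filter P := by rw [hz]; exact List.mem_cons_self
      have hPz := (List.mem_filter.1 hz').2
      have hzw := (List.mem_filter.1 hz').1
      rw [if_neg]
      · have h := (T.lim x (hS x List.mem_cons_self) z (hS z (List.mem_cons_of_mem _ hzw)) y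
          (hS y (List.mem_cons_of_mem _ hyw)) (by rw [hx, hPz]) (by rw [hx]; exact hy)).mul ih
        rw [zero_mul] at h
        refine h.congr fun t => ?_
        rw [splitRatio, splitRatio, fP, fQ, den_cons (y := z) (l := (y :: w').filter P)
          (by rw [hz]; rfl), den_cons (y := y) (l := y :: w') rfl, mul_assoc (σ t x - σ t z),
          mul_div_mul_comm]
        ring
      · intro h
        rw [hz, List.cons_append] at h
        have := (List.cons.inj (List.cons.inj h).2).1
        rw [this] at hy
        exact hy hPz
  · have e1 : (y :: w').filter P = [] := by
      rw [List.filter_eq_nil_iff]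
      intro a ha hPa
      exact hPw ⟨a, ha, hPa⟩
    have e2 : (y :: w').filter Q = y :: w' := by
      rw [List.filter_eq_self]
      intro a ha
      rw [T.compl]
      simpa using fun hPa => hPw ⟨a, ha, hPa⟩
    have hQy : Q y = true := by
      rw [T.compl]; simpa using fun hPa => hPw ⟨y, hyw, hPa⟩
    rw [e1, e2, if_pos (by simp)]
    refine (T.tendsto_cross (hS x List.mem_cons_self) (hS y (List.mem_cons_of_mem _ hyw)) hx
      hQy).congr' ?_
    filter_upwards [T.inj] with t ht
    have h0 := den_ne_zero ht (List.nodup_cons.1 nd).2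
    rw [splitRatio, fP, fQ, e1, e2, den_cons (y := y) (l := y :: w') rfl, den, one_mul,
      div_mul_cancel_right₀ h0, div_eq_mul_inv]

theorem TwoClusters.splitLimit (T : TwoClusters F σ S P Q p q) {w : List (Fin (m + 2))}
    (nd : w.Nodup) (hS : ∀ y ∈ w, y ∈ S) : SplitLimit F σ P Q p q w := by
  induction w with
  | nil => rintro ⟨x, hx, -⟩; simp at hx
  | cons x w ih =>
    have ih := ih (List.nodup_cons.1 nd).2 fun y hy => hS y (List.mem_cons_of_mem _ hy)
    by_cases hx : P x = true
    · exact T.splitLimit_cons nd hS hx ih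
    · exact (T.symm.splitLimit_cons nd hS (by simpa [T.compl] using hx) ih.symm).symm

/-- The leaves of every subtree of `t` are much closer to each other than to the other leaves. -/
def Clusters (F : Filter X) (σ : X → Fin (m + 2) → ℂ) (t : FreeMagma (Fin (m + 2))) : Prop :=
  ∀ s ∈ subtrees t, ∀ a ∈ leaves s, ∀ b ∈ leaves s, ∀ c ∈ leaves t, c ∉ leaves s →
    Tendsto (fun x => (σ x a - σ x b) / (σ x c - σ x b)) F (𝓝 0)

theorem mem_subtrees_self {α : Type*} (t : FreeMagma α) : t ∈ subtrees t := by
  cases t <;> simp [subtrees]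

theorem filter_append_of_perm {l r u v : List (Fin (m + 2))} (nd : (l ++ r).Nodup)
    (hu : u.Perm l) (hv : v.Perm r) :
    (u ++ v).filter (fun x => decide (x ∈ l)) = u ∧
      (u ++ v).filter (fun x => !decide (x ∈ l)) = v := by
  have nd' := List.nodup_append.1 nd
  have h1 : ∀ x ∈ u, x ∈ l := fun x hx => hu.subset hx
  have h2 : ∀ x ∈ v, x ∉ l := fun x hx hl => nd'.2.2 _ hl _ (hv.subset hx) rfl
  rw [List.filter_append, List.filter_append]
  constructor
  · rw [List.filter_eq_self.2 (by simpa using h1), List.filter_eq_nil_iff.2 (by simpa using h2),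
      List.append_nil]
  · rw [List.filter_eq_nil_iff.2 (by simpa using h1), List.filter_eq_self.2 (by simpa using h2),
      List.nil_append]

/-- The coefficients of the expansion of a tree are the limits of the quotients of Parke-Taylor
factors at the corresponding boundary point. -/
theorem tendsto_den_div (hσ : ∀ᶠ x in F, Function.Injective (σ x)) {t : FreeMagma (Fin (m + 2))}
    (nd : (leaves t).Nodup) (hC : Clusters F σ t) {w : List (Fin (m + 2))} (hw : w.Perm (leaves t)) :
    Tendsto (fun x => den (σ x) (leaves t) / den (σ x) w) F (𝓝 (cf (expand t) w)) := by
  induction t using FreeMagma.rec generalizing w with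
  | of x =>
    have : w = [x] := List.perm_singleton.1 hw
    subst this
    simpa [leaves, den, expand_of, cf_mono] using tendsto_const_nhds
  | mul l r hl hr =>
    rw [leaves_mul] at nd hw ⊢
    have nd' := List.nodup_append.1 nd
    have ndw := hw.nodup_iff.2 nd
    have hCl : Clusters F σ l := fun s hs a ha b hb c hc hcs =>
      hC s (by simp [subtrees, hs]) a ha b hb c (List.mem_append_left _ hc) hcs
    have hCr : Clusters F σ r := fun s hs a ha b hb c hc hcs =>
      hC s (by simp [subtrees, hs]) a ha b hb c (List.mem_append_right _ hc) hcs
    have disj : ∀ x ∈ leaves r, x ∉ leaves l := fun x hx hxl => nd'.2.2 _ hxl _ hx rfl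
    set P : Fin (m + 2) → Bool := fun x => decide (x ∈ leaves l) with hP
    set Q : Fin (m + 2) → Bool := fun x => !decide (x ∈ leaves l) with hQ
    have ppos := leaves_length_pos l
    have qpos := leaves_length_pos r
    obtain ⟨p, hp⟩ : ∃ p, (leaves l).getLast? = some p :=
      ⟨_, List.getLast?_eq_some_getLast (List.ne_nil_of_length_pos ppos)⟩
    obtain ⟨q, hq⟩ : ∃ q, (leaves r).head? = some q :=
      ⟨_, List.head?_eq_some_head (List.ne_nil_of_length_pos qpos)⟩
    have hpl : p ∈ leaves l := List.mem_of_getLast? hp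
    have hqr : q ∈ leaves r := List.mem_of_head? hq
    have T : TwoClusters F σ {x | x ∈ leaves l ++ leaves r} P Q p q :=
      { compl := fun x => rfl
        inj := hσ
        lim := fun x hx y hy z hz h1 h2 => by
          have key : ∀ s ∈ subtrees (FreeMagma.mul l r), x ∈ leaves s → y ∈ leaves s →
              z ∉ leaves s → Tendsto (fun t => (σ t x - σ t y) / (σ t x - σ t z)) F (𝓝 0) := by
            intro s hs hxs hys hzs
            refine (hC s hs y hys x hxs z hz hzs).congr fun t => ?_
            rw [← neg_sub (σ t x), ← neg_sub (σ t x) (σ t z), neg_div_neg_eq]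
          simp only [P, decide_eq_decide, ne_eq] at h1 h2
          simp only [Set.mem_ofPred_eq, List.mem_append] at hx hy hz
          by_cases hxl : x ∈ leaves l
          · exact key l (by simp [subtrees, mem_subtrees_self]) hxl (h1.1 hxl)
              fun hz => h2 (by simp [hxl, hz])
          · have hyl : y ∉ leaves l := fun h => hxl (h1.2 h)
            refine key r (by simp [subtrees, mem_subtrees_self]) (hx.resolve_left hxl)
              (hy.resolve_left hyl) fun hz => h2 (by simp [hxl, disj z hz])
        memp := by simp [hpl]
        memq := by simp [hqr]
        hp := by simp [P, hpl]
        hq := by simp [Q, disj q hqr] }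
    have hfl : (w.filter P).Perm (leaves l) := by
      have := hw.filter P
      rwa [(filter_append_of_perm nd (List.Perm.refl _) (List.Perm.refl _)).1] at this
    have hfr : (w.filter Q).Perm (leaves r) := by
      have := hw.filter Q
      rwa [(filter_append_of_perm nd (List.Perm.refl _) (List.Perm.refl _)).2] at this
    have h1 := ((hl nd'.1 hCl hfl).mul (hr nd'.2.1 hCr hfr)).mul
      (T.splitLimit ndw (fun y hy => hw.subset hy) ⟨p, hw.symm.subset (by simp [hpl]), T.hp⟩
        ⟨q, hw.symm.subset (by simp [hqr]), T.hq⟩)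
    have e : cf (expand l) (w.filter P) * cf (expand r) (w.filter Q) *
        ((if w = w.filter P ++ w.filter Q then 1 else 0) -
          if w = w.filter Q ++ w.filter P then 1 else 0) =
        cf (expand (FreeMagma.mul l r)) w := by
      rw [cf_expand_mul, mul_sub]
      congr 1
      · split_ifs with h
        · conv_rhs => rw [h]
          rw [mul_one, ← hfl.length_eq, List.take_left, List.drop_left]
        · rw [mul_zero]
          symm
          by_contra h'
          have p1 := perm_of_cf_expand (left_ne_zero_of_mul h')
          have p2 := perm_of_cf_expand (right_ne_zero_of_mul h')
          have := filter_append_of_perm nd p1 p2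
          rw [List.take_append_drop] at this
          apply h
          rw [this.1, this.2, List.take_append_drop]
      · split_ifs with h
        · conv_rhs => rw [h]
          rw [mul_one, ← hfr.length_eq, List.take_left, List.drop_left, mul_comm]
        · rw [mul_zero]
          symm
          by_contra h'
          have p1 := perm_of_cf_expand (left_ne_zero_of_mul h')
          have p2 := perm_of_cf_expand (right_ne_zero_of_mul h')
          have e1 : (w.take (leaves r).length).filter P = [] := List.filter_eq_nil_iff.2
            fun x hx => by simpa [P] using disj x (p1.subset hx)
          have e2 : (w.drop (leaves r).length).filter P = w.drop (leaves r).length :=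
            List.filter_eq_self.2 fun x hx => by simpa [P] using p2.subset hx
          have e3 : (w.take (leaves r).length).filter Q = w.take (leaves r).length :=
            List.filter_eq_self.2 fun x hx => by simpa [Q] using disj x (p1.subset hx)
          have e4 : (w.drop (leaves r).length).filter Q = [] := List.filter_eq_nil_iff.2
            fun x hx => by simpa [Q] using p2.subset hx
          apply h
          conv_rhs => rw [← List.take_append_drop (leaves r).length w]
          rw [List.filter_append, List.filter_append, e1, e2, e3, e4, List.append_nil,
            List.nil_append, List.take_append_drop]
    rw [← e]
    refine h1.congr' ?_
    filter_upwards [hσ] with x hx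
    have n1 := den_ne_zero hx (hfl.nodup_iff.2 nd'.1)
    have n2 := den_ne_zero hx (hfr.nodup_iff.2 nd'.2.1)
    rw [den_append hp hq, splitRatio]
    field_simp

end WordLimits

/-! ### Coordinates near the point of the boundary given by a tree -/

section Charts
variable {m : ℕ}

/-- The points `σ_{a(1)}, …, σ_{a(n-1)}`, indexed by their positions `0, …, n - 2`. -/
def line (a : Equiv.Perm (Fin (m + 2))) (z : Fin m → ℂ) (k : ℕ) : ℂ :=
  if h : k < m + 2 then pos z (a ⟨k, h⟩) else 0

theorem line_val (a : Equiv.Perm (Fin (m + 2))) (z : Fin m → ℂ) (i : Fin (m + 2)) :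
    line a z i = pos z (a i) := by
  rw [line, dif_pos i.2]

theorem line_ne {a : Equiv.Perm (Fin (m + 2))} {z : Fin m → ℂ} (hz : z ∈ openModuli m) (i j : ℕ)
    (hij : i < j) (hj : j < m + 2) : line a z i - line a z j ≠ 0 := by
  rw [line, line, dif_pos (by omega), dif_pos hj]
  exact pos_ne hz fun h => by simpa [Fin.ext_iff, hij.ne] using a.injective h

theorem point_cyclic (a : Equiv.Perm (Fin (m + 2))) (z : Fin m → ℂ) (i : Fin (m + 2)) :
    point z (cyclic a i.castSucc) = (pos z (a i), 1) := by
  simp [point, cyclic]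

theorem point_cyclic_last (a : Equiv.Perm (Fin (m + 2))) (z : Fin m → ℂ) :
    point z (cyclic a (Fin.last (m + 2))) = (1, 0) := by
  simp [point, cyclic]

/-- The dihedral coordinates are cross-ratios on the line, in which the differences with the point
at infinity cancel. -/
theorem dihedral_eq (a : Equiv.Perm (Fin (m + 2))) (c : Chord m) (z : Fin m → ℂ) :
    dihedral a c z = crossU (m + 2) (line a z) c.1.1 c.1.2 := by
  obtain ⟨⟨i, j⟩, hij, hc⟩ := c
  dsimp only at hij hc
  have hi0 : ∀ k : Fin (m + 1), (k.succ).castSucc - 1 = (k.castSucc).castSucc := fun k => by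
    rw [sub_eq_iff_eq_add, Fin.coeSucc_eq_succ]
    rfl
  have hi1 : (0 : Fin (m + 2)).castSucc - 1 = Fin.last (m + 2) := by
    rw [sub_eq_iff_eq_add, Fin.last_add_one]
    rfl
  have hj0 : ∀ k : Fin (m + 1), (k.castSucc).castSucc + 1 = (k.succ).castSucc := fun k => by
    rw [Fin.coeSucc_eq_succ]
    rfl
  have hj1 : (Fin.last (m + 1)).castSucc + 1 = Fin.last (m + 2) := by
    rw [Fin.coeSucc_eq_succ]
    rfl
  unfold dihedral crossU bracket
  dsimp only
  rw [rho_succ _ j.2]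
  by_cases hi : i = 0
  · subst hi
    have hjl : j ≠ Fin.last (m + 1) := by rintro rfl; exact hc rfl
    obtain ⟨j, rfl⟩ := Fin.exists_castSucc_eq.2 hjl
    have : ((j.castSucc : Fin (m + 2)) : ℕ) + 1 = (j.succ : Fin (m + 2)) := by simp
    rw [hi1, hj0, point_cyclic_last, point_cyclic, point_cyclic, point_cyclic, Fin.val_zero,
      rho_zero, rho_zero, this, rho_succ _ j.succ.2, line_val]
    have := line_val a z 0
    rw [Fin.val_zero] at this
    rw [this, line_val]
    simp
  · obtain ⟨i, rfl⟩ := Fin.exists_succ_eq.2 hi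
    have e1 : ∀ l, l < m + 2 → rho (m + 2) (line a z) (i.succ : Fin (m + 2)) l =
        line a z (i.castSucc : Fin (m + 2)) - line a z l := fun l hl => by
      rw [Fin.val_succ, rho_succ _ hl]
      rfl
    rw [hi0, e1 _ j.2, line_val, line_val, line_val]
    by_cases hjl : j = Fin.last (m + 1)
    · subst hjl
      rw [hj1, rho_of_le _ _ (by simp), rho_of_le _ _ (by simp)]
      simp only [point_cyclic, point_cyclic_last]
      simp only [mul_one, mul_zero, zero_sub, mul_neg, one_mul, neg_mul]
      rw [neg_div_neg_eq]
    · obtain ⟨j, rfl⟩ := Fin.exists_castSucc_eq.2 hjl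
      have : ((j.castSucc : Fin (m + 2)) : ℕ) + 1 = (j.succ : Fin (m + 2)) := by simp
      rw [hj0, this, e1 _ j.succ.2, rho_succ _ j.succ.2, line_val, line_val, line_val]
      simp only [point_cyclic]
      simp

theorem getElem?_ofFn (a : Equiv.Perm (Fin (m + 2))) {q : ℕ} {x : Fin (m + 2)} :
    (List.ofFn a)[q]? = some x ↔ ∃ h : q < m + 2, a ⟨q, h⟩ = x := by
  rw [List.getElem?_ofFn]
  split_ifs with h <;> simp [h]

/-- The labels of a chord are the leaves of a subtree if and only if the chord is a vertex
interval. -/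
theorem exists_subtree_labels_iff {t : FreeMagma (Fin (m + 2))} {a : Equiv.Perm (Fin (m + 2))}
    (ht : leaves t = List.ofFn a) (c : Chord m) :
    (∃ s ∈ subtrees t, (leaves s).toFinset = c.labels a) ↔
      IsNode (m + 2) (lo t) (hi t) c.1.1 c.1.2 := by
  obtain ⟨⟨i, j⟩, hij, hc⟩ := c
  dsimp only at hij hc ⊢
  have hlen : (leaves t).length = m + 2 := by rw [ht, List.length_ofFn]
  have T := isTree t
  rw [hlen] at T
  have hmem : ∀ x, x ∈ Chord.labels ⟨(i, j), hij, hc⟩ a ↔ ∃ q, i ≤ q ∧ q ≤ j ∧ a q = x := fun x => by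
    simp only [Chord.labels, Finset.mem_map, Finset.mem_Icc, and_assoc]
    rfl
  constructor
  · rintro ⟨s, hs, e⟩
    have hs' : ∀ x, x ∈ leaves s ↔ ∃ q, i ≤ q ∧ q ≤ j ∧ a q = x := fun x => by
      rw [← hmem, ← e, List.mem_toFinset]
    rcases exists_interval_of_mem_subtrees hs with ⟨x, rfl⟩ | ⟨k, hk, h⟩
    · have h1 : a i ∈ leaves (FreeMagma.of x) := (hs' _).2 ⟨i, le_rfl, hij.le, rfl⟩
      have h2 : a j ∈ leaves (FreeMagma.of x) := (hs' _).2 ⟨j, hij.le, le_rfl, rfl⟩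
      rw [leaves, List.mem_singleton] at h1 h2
      exact absurd (a.injective (h1.trans h2.symm)) hij.ne
    · rw [hlen] at hk
      have b1 := T.lo_le k hk
      have b2 := T.lt_hi k hk
      have b3 := T.hi_lt k hk
      have key : ∀ q : Fin (m + 2), (lo t k ≤ q ∧ (q : ℕ) ≤ hi t k) ↔ (i ≤ q ∧ q ≤ j) := by
        intro q
        have h1 := h (a q)
        rw [hs', ht] at h1
        constructor
        · rintro ⟨h2, h3⟩
          obtain ⟨q', h4, h5, h6⟩ := h1.2 ⟨q, h2, h3, (getElem?_ofFn a).2 ⟨q.2, rfl⟩⟩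
          rw [a.injective h6] at h4 h5
          exact ⟨h4, h5⟩
        · rintro ⟨h2, h3⟩
          obtain ⟨q', h4, h5, h6⟩ := h1.1 ⟨q, h2, h3, rfl⟩
          obtain ⟨h7, h8⟩ := (getElem?_ofFn a).1 h6
          have := a.injective h8
          rw [← this]
          exact ⟨h4, h5⟩
      have k1 := (key ⟨lo t k, by omega⟩).1 ⟨le_rfl, by simp; omega⟩
      have k2 := (key ⟨hi t k, by omega⟩).1 ⟨by simp; omega, le_rfl⟩
      have k3 := (key i).2 ⟨le_rfl, hij.le⟩
      have k4 := (key j).2 ⟨hij.le, le_rfl⟩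
      simp only [Fin.le_def] at k1 k2 k3 k4
      exact ⟨k, hk, by omega, by omega⟩
  · rintro ⟨k, hk, h1, h2⟩
    obtain ⟨s, hs, h⟩ := exists_subtree_of_gap (t := t) (k := k) (by omega)
    refine ⟨s, hs, ?_⟩
    ext x
    rw [List.mem_toFinset, h, hmem, ht, h1, h2]
    constructor
    · rintro ⟨q, h3, h4, h5⟩
      obtain ⟨h6, h7⟩ := (getElem?_ofFn a).1 h5
      exact ⟨⟨q, h6⟩, h3, h4, h7⟩
    · rintro ⟨q, h3, h4, h5⟩
      exact ⟨q, h3, h4, (getElem?_ofFn a).2 ⟨q.2, h5⟩⟩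

/-- The part of the data of a cycle that does not concern the orientation and the radii, for a
planar tree `t` whose leaves in their planar order are `a(1), …, a(n-1)`. -/
structure IsTreeChart (t : FreeMagma (Fin (m + 2))) (a : Equiv.Perm (Fin (m + 2)))
    (prop : Fin m → Chord m) (r : ℝ) (chart : (Fin m → ℂ) → Fin m → ℂ) : Prop where
  leaves_eq : leaves t = List.ofFn a
  prop_injective : Function.Injective prop
  mem_range_prop : ∀ c, c ∈ Set.range prop ↔ IsNode (m + 2) (lo t) (hi t) c.1.1 c.1.2
  r_pos : 0 < r
  chart_holo : DifferentiableOn ℂ chart (puncturedPolydisc m r)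
  chart_mem : ∀ x ∈ puncturedPolydisc m r, chart x ∈ openModuli m
  dihedral_prop : ∀ x ∈ puncturedPolydisc m r, ∀ p, dihedral a (prop p) (chart x) = x p
  dihedral_other : ∀ c : Chord m, ¬ IsNode (m + 2) (lo t) (hi t) c.1.1 c.1.2 →
    Tendsto (fun x => dihedral a c (chart x)) (𝓝[puncturedPolydisc m r] 0) (𝓝 1)

/-- A word in which a Lie monomial has a nonzero coefficient is a planar order of its tree. -/
theorem TreeCycle.exists_isTreeChart {Γ : LieMonomial m} (C : TreeCycle Γ) :
    ∃ t, (∃ ε : ℤˣ, expand Γ.1 = ((ε : ℤ) : ℂ) • expand t) ∧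
      IsTreeChart t C.a C.prop C.r C.chart := by
  have h : cf (expand Γ.1) (List.ofFn C.a) ≠ 0 := C.planar
  obtain ⟨t, ht, hε, hS⟩ := exists_planar h
  have key : ∀ c, IsPropagator Γ C.a c ↔ IsNode (m + 2) (lo t) (hi t) c.1.1 c.1.2 := fun c => by
    rw [← exists_subtree_labels_iff ht, ← hS]
    rfl
  refine ⟨t, hε, ht, C.prop_injective, fun c => ?_, C.r_pos, C.chart_holo, C.chart_mem,
    C.dihedral_prop, fun c hc => ?_⟩
  · rw [← key, C.mem_range_prop]
  · rw [← key] at hc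
    exact C.dihedral_other c hc

variable {t : FreeMagma (Fin (m + 2))} {a : Equiv.Perm (Fin (m + 2))} {prop : Fin m → Chord m}
  {r : ℝ} {chart : (Fin m → ℂ) → Fin m → ℂ}

theorem IsTreeChart.isTree (I : IsTreeChart t a prop r chart) : IsTree (m + 2) (lo t) (hi t) := by
  have T := LiePT.isTree t
  rwa [I.leaves_eq, List.length_ofFn] at T

theorem IsTreeChart.degenerates (I : IsTreeChart t a prop r chart) :
    Degenerates (𝓝[puncturedPolydisc m r] 0) (m + 2) (lo t) (hi t) fun x => line a (chart x) where
  tree := I.isTree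
  ne := by
    filter_upwards [self_mem_nhdsWithin] with x hx i j hij hj
    exact line_ne (I.chart_mem x hx) i j hij hj
  lim i j hij hj h := by
    classical
    let c : Chord m := ⟨(⟨i, by omega⟩, ⟨j, hj⟩), hij, fun e => h (by
      simp only [Prod.mk.injEq, Fin.ext_iff, Fin.val_zero, Fin.val_last] at e
      omega)⟩
    have e : ∀ z, crossU (m + 2) (line a z) i j = dihedral a c z := fun z => (dihedral_eq a c z).symm
    simp only [e]
    by_cases hn : IsNode (m + 2) (lo t) (hi t) i j
    · rw [if_pos hn]
      obtain ⟨p, hp⟩ := (I.mem_range_prop c).2 hn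
      have : Tendsto (fun x : Fin m → ℂ => x p) (𝓝[puncturedPolydisc m r] 0) (𝓝 0) :=
        ((continuous_apply p).tendsto' 0 0 rfl).mono_left nhdsWithin_le_nhds
      refine this.congr' ?_
      filter_upwards [self_mem_nhdsWithin] with x hx
      rw [← hp, I.dihedral_prop x hx]
    · rw [if_neg hn]
      exact I.dihedral_other c hn

theorem IsTreeChart.injective (I : IsTreeChart t a prop r chart) :
    ∀ᶠ x in 𝓝[puncturedPolydisc m r] 0, Function.Injective (pos (chart x)) := by
  filter_upwards [self_mem_nhdsWithin] with x hx
  exact I.chart_mem x hx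

theorem IsTreeChart.clusters (I : IsTreeChart t a prop r chart) :
    Clusters (𝓝[puncturedPolydisc m r] 0) (fun x => pos (chart x)) t := by
  intro s hs x hx y hy z hz hzs
  have hlen : (leaves t).length = m + 2 := by rw [I.leaves_eq, List.length_ofFn]
  rcases exists_interval_of_mem_subtrees hs with ⟨w, rfl⟩ | ⟨k, hk, h⟩
  · rw [leaves, List.mem_singleton] at hx hy
    subst hx hy
    simpa using tendsto_const_nhds
  · rw [h, I.leaves_eq] at hx hy
    obtain ⟨i, hi1, hi2, hi3⟩ := hx
    obtain ⟨j, hj1, hj2, hj3⟩ := hy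
    obtain ⟨hi4, rfl⟩ := (getElem?_ofFn a).1 hi3
    obtain ⟨hj4, rfl⟩ := (getElem?_ofFn a).1 hj3
    obtain ⟨l, rfl⟩ := a.surjective z
    rw [hlen] at hk
    have := I.degenerates.tendsto_inside hk ⟨hi1, hi2⟩ ⟨hj1, hj2⟩ (c := l) (by
      by_contra hc
      exact hzs ((h _).2 ⟨l, by omega, by omega, by
        rw [I.leaves_eq]; exact (getElem?_ofFn a).2 ⟨l.2, rfl⟩⟩)) l.2
    refine this.congr fun u => ?_
    rw [line_val, line, line, dif_pos hi4, dif_pos hj4]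

theorem IsTreeChart.tendsto_den_div (I : IsTreeChart t a prop r chart)
    (b : Equiv.Perm (Fin (m + 2))) :
    Tendsto (fun x => den (pos (chart x)) (List.ofFn a) / den (pos (chart x)) (List.ofFn b))
      (𝓝[puncturedPolydisc m r] 0) (𝓝 (cf (expand t) (List.ofFn b))) := by
  have := LiePT.tendsto_den_div I.injective (t := t) (by
    rw [I.leaves_eq]; exact List.nodup_ofFn.2 a.injective) I.clusters (w := List.ofFn b) (by
    rw [I.leaves_eq]; exact (ofFn_perm_finRange b).trans (ofFn_perm_finRange a).symm)
  rwa [I.leaves_eq] at this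

end Charts

/-! ### Logarithmic derivatives of the dihedral coordinates -/

section LogDerivatives
variable {N : ℕ} {lo hi : ℕ → ℕ}

/-- The logarithmic derivative of `y_{i-1} - y_j` with respect to the gap `y_k - y_{k+1}`. -/
def gapLog (N : ℕ) (y : ℕ → ℂ) (i j k : ℕ) : ℂ :=
  if i = 0 ∨ N ≤ j then 0
  else if i ≤ k + 1 ∧ k < j then (y k - y (k + 1)) / (y (i - 1) - y j) else 0

/-- The logarithmic derivative of the dihedral coordinate of `[i, j]` with respect to the gap
`y_k - y_{k+1}`. -/
def crossLog (N : ℕ) (y : ℕ → ℂ) (i j k : ℕ) : ℂ :=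
  gapLog N y (i + 1) j k + gapLog N y i (j + 1) k - gapLog N y (i + 1) (j + 1) k - gapLog N y i j k

theorem sum_gapLog_mul {y : ℕ → ℂ} (h : ∀ i j, i < j → j < N → y i - y j ≠ 0) (d : ℕ → ℂ) {i j : ℕ}
    (hij : i ≤ j) : ∑ k ∈ Finset.range (N - 1), gapLog N y i j k * ((d k - d (k + 1)) /
      (y k - y (k + 1))) = if i = 0 ∨ N ≤ j then 0 else (d (i - 1) - d j) / (y (i - 1) - y j) := by
  by_cases h0 : i = 0 ∨ N ≤ j
  · rw [if_pos h0]
    exact Finset.sum_eq_zero fun k _ => by rw [gapLog, if_pos h0, zero_mul]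
  · rw [if_neg h0, sub_eq_sum_gap d (show i - 1 ≤ j by omega), Finset.sum_div]
    symm
    refine Finset.sum_subset_zero_on_sdiff (fun k hk => ?_) (fun k hk => ?_) fun k hk => ?_
    · rw [Finset.mem_Ico] at hk
      rw [Finset.mem_range]; omega
    · rw [Finset.mem_sdiff, Finset.mem_range, Finset.mem_Ico] at hk
      rw [gapLog, if_neg h0, if_neg (by omega), zero_mul]
    · rw [Finset.mem_Ico] at hk
      have n1 := h k (k + 1) (by omega) (by omega)
      have n2 := h (i - 1) j (by omega) (by omega)
      rw [gapLog, if_neg h0, if_pos (by omega)]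
      field_simp

/-- The logarithmic derivative of `y_{i-1} - y_j` along a vector `d`. -/
def rhoLog (N : ℕ) (y d : ℕ → ℂ) (i j : ℕ) : ℂ :=
  if i = 0 ∨ N ≤ j then 0 else (d (i - 1) - d j) / (y (i - 1) - y j)

theorem sum_crossLog_mul {y : ℕ → ℂ} (h : ∀ i j, i < j → j < N → y i - y j ≠ 0) (d : ℕ → ℂ)
    {i j : ℕ} (hij : i < j) : ∑ k ∈ Finset.range (N - 1), crossLog N y i j k *
      ((d k - d (k + 1)) / (y k - y (k + 1))) =
      rhoLog N y d (i + 1) j + rhoLog N y d i (j + 1) - rhoLog N y d (i + 1) (j + 1) -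
        rhoLog N y d i j := by
  simp only [crossLog, sub_mul, add_mul, Finset.sum_add_distrib, Finset.sum_sub_distrib]
  rw [sum_gapLog_mul h d (show i + 1 ≤ j by omega), sum_gapLog_mul h d (show i ≤ j + 1 by omega),
    sum_gapLog_mul h d (show i + 1 ≤ j + 1 by omega), sum_gapLog_mul h d hij.le]
  rfl

/-- The dihedral coordinates are invariant under dilations. -/
theorem sum_crossLog {y : ℕ → ℂ} (h : ∀ i j, i < j → j < N → y i - y j ≠ 0) {i j : ℕ}
    (hij : i < j) (hj : j < N) (hr : ¬ (i = 0 ∧ j + 1 = N)) :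
    ∑ k ∈ Finset.range (N - 1), crossLog N y i j k = 0 := by
  have h1 := sum_crossLog_mul h y hij
  have h2 : ∑ k ∈ Finset.range (N - 1), crossLog N y i j k *
      ((y k - y (k + 1)) / (y k - y (k + 1))) = ∑ k ∈ Finset.range (N - 1), crossLog N y i j k :=
    Finset.sum_congr rfl fun k hk => by
      rw [Finset.mem_range] at hk
      rw [div_self (h k (k + 1) (by omega) (by omega)), mul_one]
  rw [← h2, h1]
  have h3 : ∀ i j, i ≤ j → rhoLog N y y i j = if i = 0 ∨ N ≤ j then 0 else 1 := fun i j hij => by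
    rw [rhoLog]
    split_ifs with h0
    · rfl
    · exact div_self (h _ _ (by omega) (by omega))
  rw [h3 _ _ (by omega), h3 _ _ (by omega), h3 _ _ (by omega), h3 _ _ (by omega)]
  by_cases h4 : i = 0
  · rw [if_neg (by omega), if_pos (by omega), if_neg (by omega), if_pos (by omega)]; ring
  · by_cases h5 : j + 1 = N
    · rw [if_neg (by omega), if_pos (by omega), if_pos (by omega), if_neg (by omega)]; ring
    · rw [if_neg (by omega), if_neg (by omega), if_neg (by omega), if_neg (by omega)]; ring

theorem hasDerivAt_rho {y : ℂ → ℕ → ℂ} {d : ℕ → ℂ}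
    (hy : ∀ k, HasDerivAt (fun s => y s k) (d k) 0)
    (h : ∀ i j, i < j → j < N → y 0 i - y 0 j ≠ 0) {i j : ℕ} (hij : i ≤ j) :
    HasDerivAt (fun s => rho N (y s) i j) (rho N (y 0) i j * rhoLog N (y 0) d i j) 0 := by
  by_cases h0 : i = 0 ∨ N ≤ j
  · simp only [rho, rhoLog, if_pos h0, mul_zero]
    exact hasDerivAt_const _ _
  · simp only [rho, rhoLog, if_neg h0]
    rw [mul_div_cancel₀ _ (h _ _ (by omega) (by omega))]
    exact (hy _).sub (hy _)

/-- The logarithmic derivative of a dihedral coordinate along a curve. -/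
theorem sum_crossLog_mul_of_hasDerivAt {y : ℂ → ℕ → ℂ} {d : ℕ → ℂ}
    (hy : ∀ k, HasDerivAt (fun s => y s k) (d k) 0)
    (h : ∀ i j, i < j → j < N → y 0 i - y 0 j ≠ 0) {i j : ℕ} (hij : i < j) {u' : ℂ}
    (hu : HasDerivAt (fun s => crossU N (y s) i j) u' 0) :
    ∑ k ∈ Finset.range (N - 1), crossLog N (y 0) i j k *
      ((d k - d (k + 1)) / (y 0 k - y 0 (k + 1))) = u' / crossU N (y 0) i j := by
  rw [sum_crossLog_mul h d hij]
  have n1 := rho_ne_zero h (show i + 1 ≤ j by omega)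
  have n2 := rho_ne_zero h (show i ≤ j + 1 by omega)
  have n3 := rho_ne_zero h (show i + 1 ≤ j + 1 by omega)
  have n4 := rho_ne_zero h hij.le
  have e := (((hasDerivAt_rho hy h (show i + 1 ≤ j by omega)).mul
    (hasDerivAt_rho hy h (show i ≤ j + 1 by omega))).div
    ((hasDerivAt_rho hy h (show i + 1 ≤ j + 1 by omega)).mul (hasDerivAt_rho hy h hij.le))
    (mul_ne_zero n3 n4)).unique hu
  rw [← e, crossU]
  simp only [Pi.mul_apply]
  field_simp
  ring

/-- The limit of `gapLog` at the boundary point of a tree: `1` if `k` is the gap of the lowest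
common ancestor of `i - 1` and `j`. -/
def gapLim (N : ℕ) (lo hi : ℕ → ℕ) (i j k : ℕ) : ℤ :=
  if i = 0 ∨ N ≤ j then 0
  else if (i ≤ k + 1 ∧ k < j) ∧ lo k ≤ i - 1 ∧ j ≤ hi k then 1 else 0

/-- The limit of `crossLog` at the boundary point of a tree. -/
def crossLim (N : ℕ) (lo hi : ℕ → ℕ) (i j k : ℕ) : ℤ :=
  gapLim N lo hi (i + 1) j k + gapLim N lo hi i (j + 1) k - gapLim N lo hi (i + 1) (j + 1) k -
    gapLim N lo hi i j k

theorem Degenerates.tendsto_gapLog {X : Type*} {F : Filter X} {y : X → ℕ → ℂ}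
    (D : Degenerates F N lo hi y) (i j k : ℕ) :
    Tendsto (fun x => gapLog N (y x) i j k) F (𝓝 (gapLim N lo hi i j k : ℂ)) := by
  simp only [gapLog, gapLim]
  by_cases h0 : i = 0 ∨ N ≤ j
  · simp only [if_pos h0]
    simpa using tendsto_const_nhds
  · simp only [if_neg h0]
    by_cases h1 : i ≤ k + 1 ∧ k < j
    · simp only [h1, true_and]
      have := D.tendsto_gap (i := i - 1) (j := j) (k := k) (by omega) h1.2 (by omega)
      have e : ((if lo k ≤ i - 1 ∧ j ≤ hi k then 1 else 0 : ℤ) : ℂ) =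
          if lo k ≤ i - 1 ∧ j ≤ hi k then 1 else 0 := by
        by_cases h2 : lo k ≤ i - 1 ∧ j ≤ hi k
        · rw [if_pos h2, if_pos h2, Int.cast_one]
        · rw [if_neg h2, if_neg h2, Int.cast_zero]
      simp only [if_true, e]
      convert this using 2
    · simp only [h1, false_and, if_false]
      simpa using tendsto_const_nhds

theorem Degenerates.tendsto_crossLog {X : Type*} {F : Filter X} {y : X → ℕ → ℂ}
    (D : Degenerates F N lo hi y) (i j k : ℕ) :
    Tendsto (fun x => crossLog N (y x) i j k) F (𝓝 (crossLim N lo hi i j k : ℂ)) := by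
  have := (((D.tendsto_gapLog (i + 1) j k).add (D.tendsto_gapLog i (j + 1) k)).sub
    (D.tendsto_gapLog (i + 1) (j + 1) k)).sub (D.tendsto_gapLog i j k)
  unfold crossLim
  push_cast
  exact this

/-- The interval `[b, c]` has no vertex across its boundary: a lowest common ancestor lies in it
if and only if both descendants do. -/
def Clean (N : ℕ) (lo hi : ℕ → ℕ) (b c : ℕ) : Prop :=
  c < N ∧ ∀ i j k, i ≤ k → k < j → j < N → lo k ≤ i → j ≤ hi k →
    ((b ≤ k ∧ k < c) ↔ (b ≤ i ∧ j ≤ c))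

theorem IsTree.clean (T : IsTree N lo hi) {p : ℕ} (hp : p + 1 < N) :
    Clean N lo hi (lo p) (hi p) :=
  ⟨T.hi_lt p hp, fun _ _ _ hik hkj hj h1 h2 => T.top_mem_iff hj hik hkj h1 h2 hp⟩

theorem clean_root (hN : 0 < N) : Clean N lo hi 0 (N - 1) :=
  ⟨by omega, fun i j k _ _ _ _ _ => by omega⟩

theorem IsTree.sum_gapLim_mul (T : IsTree N lo hi) {b c : ℕ} (hbc : Clean N lo hi b c) {i j : ℕ}
    (hij : i ≤ j) : ∑ k ∈ Finset.range (N - 1), gapLim N lo hi i j k *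
      (if b ≤ k ∧ k < c then 1 else 0) = if b + 1 ≤ i ∧ j ≤ c then 1 else 0 := by
  by_cases h0 : i = 0 ∨ N ≤ j
  · rw [if_neg (by have := hbc.1; omega)]
    exact Finset.sum_eq_zero fun k _ => by rw [gapLim, if_pos h0, zero_mul]
  · obtain ⟨K, e1, e2, e3, e4⟩ := T.exists_top (i - 1) j (by omega) (by omega)
    rw [Finset.sum_eq_single K]
    · rw [gapLim, if_neg h0, if_pos (by omega), one_mul]
      have := hbc.2 (i - 1) j K e1 e2 (by omega) e3 e4
      exact if_congr (by omega) rfl rfl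
    · intro k hk hkK
      rw [Finset.mem_range] at hk
      rw [gapLim, if_neg h0, if_neg, zero_mul]
      rintro ⟨⟨h1, h2⟩, h3, h4⟩
      exact hkK (T.unique (i - 1) j k K (by omega) (by omega) (by omega) h2 e1 e2 h3 h4 e3 e4)
    · intro h
      rw [Finset.mem_range] at h
      omega

/-- The exponents of the gaps in the dihedral coordinates form a matrix inverse to the incidence
matrix of gaps and intervals. -/
theorem IsTree.sum_crossLim_mul (T : IsTree N lo hi) {b c : ℕ} (hbc : Clean N lo hi b c) {i j : ℕ}
    (hij : i < j) : ∑ k ∈ Finset.range (N - 1), crossLim N lo hi i j k *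
      (if b ≤ k ∧ k < c then 1 else 0) = if i = b ∧ j = c then 1 else 0 := by
  simp only [crossLim, sub_mul, add_mul, Finset.sum_add_distrib, Finset.sum_sub_distrib]
  rw [T.sum_gapLim_mul hbc (show i + 1 ≤ j by omega), T.sum_gapLim_mul hbc (show i ≤ j + 1 by omega),
    T.sum_gapLim_mul hbc (show i + 1 ≤ j + 1 by omega), T.sum_gapLim_mul hbc hij.le]
  split_ifs <;> omega

end LogDerivatives

/-! ### The Jacobian of the coordinates -/

section Jacobian
variable {m : ℕ}

/-- The matrix of the gaps `σ_{a(k)} - σ_{a(k+1)}` as linear functions of `σ_2, …, σ_{n-1}`, for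
`σ_1 = 0`. -/
def gapMatrix (a : Equiv.Perm (Fin (m + 2))) : Matrix (Fin (m + 1)) (Fin (m + 1)) ℤ :=
  Matrix.of fun k l => (if a k.castSucc = l.succ then 1 else 0) - if a k.succ = l.succ then 1 else 0

theorem sum_gapMatrix_mul {R : Type*} [CommRing R] (a : Equiv.Perm (Fin (m + 2)))
    (d : Fin (m + 2) → R) (h0 : d 0 = 0) (k : Fin (m + 1)) :
    ∑ l, (gapMatrix a k l : R) * d l.succ = d (a k.castSucc) - d (a k.succ) := by
  have h : ∀ i : Fin (m + 2), ∑ l : Fin (m + 1), (if i = l.succ then 1 else 0) * d l.succ = d i := by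
    intro i
    have := Fin.sum_univ_succ fun l => (if i = l then 1 else 0) * d l
    rw [h0, mul_zero, zero_add] at this
    rw [← this]
    simp
  rw [← h (a k.castSucc), ← h (a k.succ), ← Finset.sum_sub_distrib]
  refine Finset.sum_congr rfl fun l _ => ?_
  simp only [gapMatrix, Matrix.of_apply]
  push_cast
  ring

theorem isUnit_det_gapMatrix (a : Equiv.Perm (Fin (m + 2))) : IsUnit (gapMatrix a).det := by
  have : gapMatrix a * Matrix.of (fun l k : Fin (m + 1) =>
      ((if a.symm l.succ ≤ k.castSucc then 1 else 0) -
        if a.symm 0 ≤ k.castSucc then 1 else 0 : ℤ)) = 1 := by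
    ext k k'
    have h := sum_gapMatrix_mul a (fun l => ((if a.symm l ≤ k'.castSucc then 1 else 0) -
        if a.symm 0 ≤ k'.castSucc then 1 else 0 : ℤ)) (sub_self _) k
    rw [Matrix.mul_apply]
    simp only [Matrix.of_apply]
    refine h.trans ?_
    simp only [Equiv.symm_apply_apply, Fin.le_def, Matrix.one_apply, Fin.ext_iff, Fin.val_castSucc,
      Fin.val_succ]
    split_ifs <;> omega
  exact IsUnit.of_mul_eq_one _ (by rw [← Matrix.det_mul, this, Matrix.det_one])

theorem den_ofFn (σ : Fin (m + 2) → ℂ) (a : Equiv.Perm (Fin (m + 2))) :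
    den σ (List.ofFn a) = ∏ k : Fin (m + 1), (σ (a k.castSucc) - σ (a k.succ)) := by
  have h : ∀ n (f : Fin (n + 1) → Fin (m + 2)), den σ (List.ofFn f) =
      ∏ k : Fin n, (σ (f k.castSucc) - σ (f k.succ)) := by
    intro n
    induction n with
    | zero => intro f; simp [den]
    | succ n ih =>
      intro f
      rw [List.ofFn_succ, List.ofFn_succ, den, Fin.prod_univ_succ]
      have := ih fun i => f i.succ
      rw [List.ofFn_succ] at this
      rw [this]
      rfl
  exact h (m + 1) a

variable {t : FreeMagma (Fin (m + 2))} {a : Equiv.Perm (Fin (m + 2))} {prop : Fin m → Chord m}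
  {r : ℝ} {chart : (Fin m → ℂ) → Fin m → ℂ}

/-- The positions of the letters `1` and `n - 1`, in increasing order. -/
def ends (a : Equiv.Perm (Fin (m + 2))) : ℕ × ℕ :=
  (((min (a.symm 0) (a.symm (Fin.last (m + 1))) : Fin (m + 2)) : ℕ),
    ((max (a.symm 0) (a.symm (Fin.last (m + 1))) : Fin (m + 2)) : ℕ))

/-- The logarithmic derivatives, with respect to the gaps, of the coordinates `u_{I_p}` and of
`σ_{n-1} - σ_1`. -/
def logMatrix (a : Equiv.Perm (Fin (m + 2))) (prop : Fin m → Chord m) (z : Fin m → ℂ) :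
    Matrix (Fin (m + 1)) (Fin (m + 1)) ℂ :=
  Matrix.of (Fin.snoc (α := fun _ => Fin (m + 1) → ℂ)
    (fun p k => crossLog (m + 2) (line a z) (prop p).1.1 (prop p).1.2 k)
    fun k => gapLog (m + 2) (line a z) ((ends a).1 + 1) (ends a).2 k)

/-- The limit of `logMatrix`. -/
def logLim (lo hi : ℕ → ℕ) (a : Equiv.Perm (Fin (m + 2))) (prop : Fin m → Chord m) :
    Matrix (Fin (m + 1)) (Fin (m + 1)) ℤ :=
  Matrix.of (Fin.snoc (α := fun _ => Fin (m + 1) → ℤ)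
    (fun p k => crossLim (m + 2) lo hi (prop p).1.1 (prop p).1.2 k)
    fun k => gapLim (m + 2) lo hi ((ends a).1 + 1) (ends a).2 k)

theorem ends_lt (a : Equiv.Perm (Fin (m + 2))) :
    (ends a).1 < (ends a).2 ∧ (ends a).2 < m + 2 := by
  have h : a.symm 0 ≠ a.symm (Fin.last (m + 1)) := fun h => by
    simpa [Fin.ext_iff] using a.symm.injective h
  refine ⟨?_, (max (a.symm 0) (a.symm (Fin.last (m + 1)))).is_lt⟩
  change (min _ _ : Fin (m + 2)) < (max _ _ : Fin (m + 2))
  exact min_lt_max.2 h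

theorem IsTreeChart.isUnit_det_logLim (I : IsTreeChart t a prop r chart) :
    IsUnit (logLim (lo t) (hi t) a prop).det := by
  have T := I.isTree
  let B : Fin (m + 1) → ℕ × ℕ := Fin.snoc (α := fun _ => ℕ × ℕ)
    (fun p => (((prop p).1.1 : ℕ), ((prop p).1.2 : ℕ))) (0, m + 1)
  have hB : ∀ p, Clean (m + 2) (lo t) (hi t) (B p).1 (B p).2 := by
    intro p
    refine Fin.lastCases ?_ (fun p => ?_) p
    · simpa [B] using clean_root (N := m + 2) (by omega)
    · obtain ⟨k, hk, h1, h2⟩ := (I.mem_range_prop (prop p)).1 ⟨p, rfl⟩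
      have := T.clean hk
      rw [h1, h2] at this
      simpa [B] using this
  let M : Matrix (Fin (m + 1)) (Fin (m + 1)) ℤ :=
    Matrix.of fun k p => if (B p).1 ≤ (k : ℕ) ∧ (k : ℕ) < (B p).2 then 1 else 0
  have hsum : ∀ (f : ℕ → ℤ) p, ∑ k : Fin (m + 1), f k * M k p =
      ∑ k ∈ Finset.range (m + 2 - 1), f k * (if (B p).1 ≤ k ∧ k < (B p).2 then 1 else 0) := by
    intro f p
    rw [show m + 2 - 1 = m + 1 from rfl, Finset.sum_range]
    rfl
  -- the product is unipotent, only its last row being nontrivial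
  have hdet : (logLim (lo t) (hi t) a prop * M).det = 1 := by
    have hp : ∀ p p', (logLim (lo t) (hi t) a prop * M) (Fin.castSucc p) p' =
        if ((prop p).1.1 : ℕ) = (B p').1 ∧ ((prop p).1.2 : ℕ) = (B p').2 then 1 else 0 := by
      intro p p'
      rw [Matrix.mul_apply, ← T.sum_crossLim_mul (hB p') (prop p).2.1, ← hsum]
      simp [logLim]
    have hl : ∀ p', (logLim (lo t) (hi t) a prop * M) (Fin.last m) p' =
        if (B p').1 + 1 ≤ (ends a).1 + 1 ∧ (ends a).2 ≤ (B p').2 then 1 else 0 := by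
      intro p'
      have := (ends_lt a).1
      rw [Matrix.mul_apply, ← T.sum_gapLim_mul (hB p') (show (ends a).1 + 1 ≤ (ends a).2 by omega),
        ← hsum]
      simp [logLim]
    rw [Matrix.det_of_isLowerTriangular]
    · refine Finset.prod_eq_one fun p _ => ?_
      refine Fin.lastCases ?_ (fun p => ?_) p
      · have := ends_lt a
        rw [hl, if_pos]
        simp [B]
        omega
      · rw [hp, if_pos]
        simp [B]
    · intro p p' hpp
      have hlt : p < p' := hpp
      obtain ⟨p, rfl⟩ := Fin.exists_castSucc_eq.2 (Fin.ne_last_of_lt hlt)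
      rw [hp, if_neg]
      refine Fin.lastCases (fun _ => ?_) (fun p' hlt => ?_) p' hlt
      · have := (prop p).2.2
        simp only [B, Fin.snoc_last]
        rintro ⟨h1, h2⟩
        exact this (Prod.ext (Fin.ext h1) (Fin.ext h2))
      · simp only [B, Fin.snoc_castSucc]
        rintro ⟨h1, h2⟩
        have : prop p = prop p' := Subtype.ext (Prod.ext (Fin.ext h1) (Fin.ext h2))
        rw [I.prop_injective this] at hlt
        exact lt_irrefl _ hlt
  rw [Matrix.det_mul] at hdet
  exact IsUnit.of_mul_eq_one _ hdet

theorem posLin_zero' (u : Fin m → ℂ) : posLin m u 0 = 0 := by simp [posLin]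

theorem posLin_last (u : Fin m → ℂ) : posLin m u (Fin.last (m + 1)) = 0 := by
  simp [posLin, ← Fin.succ_last]

/-- The logarithmic Jacobian matrix `x_q ∂_q z_i` of a chart. -/
def jac (chart : (Fin m → ℂ) → Fin m → ℂ) (x : Fin m → ℂ) : Matrix (Fin m) (Fin m) ℂ :=
  Matrix.of fun i q => x q * fderiv ℂ chart x (Pi.single q 1) i

theorem isOpen_puncturedPolydisc (m : ℕ) (r : ℝ) : IsOpen (puncturedPolydisc m r) := by
  have : puncturedPolydisc m r = ⋂ p, {x : Fin m → ℂ | 0 < ‖x p‖ ∧ ‖x p‖ < r} := by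
    ext x; simp [puncturedPolydisc]
  rw [this]
  refine isOpen_iInter_of_finite fun p => ?_
  have h : Continuous fun x : Fin m → ℂ => ‖x p‖ := by fun_prop
  exact (isOpen_lt continuous_const h).inter (isOpen_lt h continuous_const)

theorem line_add (a : Equiv.Perm (Fin (m + 2))) {z : ℂ → Fin m → ℂ} {z' : Fin m → ℂ}
    (h : HasDerivAt z z' 0) (k : ℕ) : HasDerivAt (fun s => line a (z s) k)
      (if h : k < m + 2 then posLin m z' (a ⟨k, h⟩) else 0) 0 := by
  by_cases hk : k < m + 2
  · simp only [line, dif_pos hk]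
    have e : (fun s => pos (z s) (a ⟨k, hk⟩)) = fun s => pos 0 (a ⟨k, hk⟩) +
        LinearMap.toContinuousLinearMap (LinearMap.proj (a ⟨k, hk⟩) ∘ₗ posLin m) (z s) := by
      funext s; rw [pos_eq (z s)]; rfl
    rw [e]
    exact ((LinearMap.toContinuousLinearMap
      (LinearMap.proj (a ⟨k, hk⟩) ∘ₗ posLin m)).hasFDerivAt.comp_hasDerivAt 0 h).const_add _
  · simp only [line, dif_neg hk]
    exact hasDerivAt_const _ _

/-- The Jacobian of the chart in terms of logarithmic derivatives. -/
theorem IsTreeChart.det_logMatrix_mul (I : IsTreeChart t a prop r chart) {x : Fin m → ℂ}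
    (hx : x ∈ puncturedPolydisc m r) : (logMatrix a prop (chart x)).det *
      ((gapMatrix a).det : ℂ) * (jac chart x).det = den (pos (chart x)) (List.ofFn a) := by
  have hz := I.chart_mem x hx
  set z := chart x with hzdef
  have hne : ∀ i j, i < j → j < m + 2 → line a z i - line a z j ≠ 0 := line_ne hz
  let D : Fin (m + 1) → Fin (m + 2) → ℂ := Fin.snoc (α := fun _ => Fin (m + 2) → ℂ)
    (fun q => posLin m (x q • fderiv ℂ chart x (Pi.single q 1))) (pos z)
  have hD0 : ∀ q, D q 0 = 0 := fun q => by
    refine Fin.lastCases ?_ (fun q => ?_) q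
    · simp [D]
    · simp only [D, Fin.snoc_castSucc]; exact posLin_zero' _
  let d : Fin (m + 1) → ℕ → ℂ := fun q k => if h : k < m + 2 then D q (a ⟨k, h⟩) else 0
  let B : Matrix (Fin (m + 1)) (Fin (m + 1)) ℂ := Matrix.of fun l q => D q l.succ
  have hB : B.det = (jac chart x).det := by
    rw [Matrix.det_succ_row B (Fin.last m), Finset.sum_eq_single (Fin.last m)]
    · have e1 : B (Fin.last m) (Fin.last m) = 1 := by simp [B, D]
      have e2 : B.submatrix (Fin.last m).succAbove (Fin.last m).succAbove = jac chart x := by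
        ext i q
        simp only [Matrix.submatrix_apply, Fin.succAbove_last, B, Matrix.of_apply, D,
          Fin.snoc_castSucc, jac]
        exact posLin_moving _ i
      rw [e1, e2, ← two_mul, pow_mul]
      simp
    · intro q _ hq
      obtain ⟨q, rfl⟩ := Fin.exists_castSucc_eq.2 hq
      have : B (Fin.last m) q.castSucc = 0 := by
        simp only [B, Matrix.of_apply, D, Fin.snoc_castSucc, Fin.succ_last]
        exact posLin_last _
      rw [this]; ring
    · simp
  let g : Fin (m + 1) → ℂ := fun k => line a z k - line a z (k + 1)
  have hg : ∀ k, g k ≠ 0 := fun k => hne k (k + 1) (by omega) (by omega)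
  have hGB : ∀ k q, ((gapMatrix a).map (Int.cast : ℤ → ℂ) * B) k q = d q k - d q (k + 1) := by
    intro k q
    have h := sum_gapMatrix_mul a (D q) (hD0 q) k
    rw [Matrix.mul_apply]
    refine h.trans ?_
    simp only [d]
    rw [dif_pos (by omega), dif_pos (by omega)]
    rfl
  have hprod : logMatrix a prop z * Matrix.diagonal (fun k => (g k)⁻¹) *
      ((gapMatrix a).map (Int.cast : ℤ → ℂ) * B) = 1 := by
    have hentry : ∀ p q, (logMatrix a prop z * Matrix.diagonal (fun k => (g k)⁻¹) *
        ((gapMatrix a).map (Int.cast : ℤ → ℂ) * B)) p q =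
        ∑ k : Fin (m + 1), logMatrix a prop z p k * ((d q k - d q (k + 1)) /
          (line a z k - line a z (k + 1))) := by
      intro p q
      rw [Matrix.mul_apply]
      refine Finset.sum_congr rfl fun k _ => ?_
      rw [Matrix.mul_diagonal, hGB, div_eq_mul_inv]
      ring
    ext p q
    rw [hentry]
    refine Fin.lastCases ?_ (fun p => ?_) p
    · -- the coordinate `σ_{n-1} - σ_1` is constant in the directions of the moduli space
      have h1 := sum_gapLog_mul hne (d q) (i := (ends a).1 + 1) (j := (ends a).2)
        (by have := (ends_lt a).1; omega)
      rw [show m + 2 - 1 = m + 1 from rfl, Finset.sum_range, if_neg (by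
        have := (ends_lt a).2; omega)] at h1
      simp only [logMatrix, Matrix.of_apply, Fin.snoc_last]
      rw [h1, Nat.add_sub_cancel]
      have hdl : ∀ i : Fin (m + 2), d q i = D q (a i) := fun i => by
        simp only [d]; rw [dif_pos i.2]
      have hne2 := hne _ _ (ends_lt a).1 (ends_lt a).2
      rw [ends] at hne2 ⊢
      simp only at hne2 ⊢
      rw [line_val, line_val] at hne2 ⊢
      rw [hdl, hdl]
      refine Fin.lastCases ?_ (fun q => ?_) q
      · simp only [D, Fin.snoc_last]
        rw [div_self hne2, Matrix.one_apply_eq]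
      · rw [Matrix.one_apply_ne (Fin.castSucc_lt_last q).ne']
        have hD1 : D q.castSucc (Fin.last (m + 1)) = 0 := by
          simp only [D, Fin.snoc_castSucc]; exact posLin_last _
        rcases le_total (a.symm 0) (a.symm (Fin.last (m + 1))) with h | h
        · rw [min_eq_left h, max_eq_right h]
          simp [hD0, hD1]
        · rw [min_eq_right h, max_eq_left h]
          simp [hD0, hD1]
    · simp only [logMatrix, Matrix.of_apply, Fin.snoc_castSucc]
      refine Fin.lastCases ?_ (fun q => ?_) q
      · rw [Matrix.one_apply_ne (Fin.castSucc_lt_last p).ne]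
        have h1 := sum_crossLog hne (prop p).2.1 (prop p).1.2.2 (by
          have := (prop p).2.2
          rintro ⟨h1, h2⟩
          exact this (Prod.ext (Fin.ext h1) (Fin.ext (by simp; omega))))
        rw [show m + 2 - 1 = m + 1 from rfl, Finset.sum_range] at h1
        rw [← h1]
        refine Finset.sum_congr rfl fun k _ => ?_
        have e : ∀ k : ℕ, d (Fin.last m) k = line a z k := fun k => by
          simp only [d, D, Fin.snoc_last]; rfl
        rw [e, e, div_self (hg k), mul_one]
      · -- the logarithmic derivative of `u_p` along `x_q ∂_q` is `δ_pq`
        let c : ℂ → Fin m → ℂ := fun s => x + s • (x q • Pi.single q (1 : ℂ))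
        have hc : HasDerivAt c (x q • Pi.single q (1 : ℂ)) 0 := by
          have := ((hasDerivAt_id (0 : ℂ)).smul_const (x q • Pi.single q (1 : ℂ))).const_add x
          rwa [one_smul] at this
        have hc0 : c 0 = x := by simp [c]
        have hd : HasFDerivAt chart (fderiv ℂ chart x) (c 0) := by
          rw [hc0]
          exact ((I.chart_holo x hx).differentiableAt
            ((isOpen_puncturedPolydisc m r).mem_nhds hx)).hasFDerivAt
        have h1 : HasDerivAt (fun s => chart (c s)) (x q • fderiv ℂ chart x (Pi.single q 1)) 0 := by
          have := hd.comp_hasDerivAt 0 hc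
          rwa [map_smul] at this
        have hu : HasDerivAt (fun s => crossU (m + 2) (line a (chart (c s))) (prop p).1.1
            (prop p).1.2) (x q * Pi.single (M := fun _ => ℂ) q (1 : ℂ) p) 0 := by
          have h2 : HasDerivAt (fun s => c s p) (x q * Pi.single (M := fun _ => ℂ) q (1 : ℂ) p) 0 :=
            hasDerivAt_pi.1 hc p
          refine h2.congr_of_eventuallyEq ?_
          have : ∀ᶠ s in 𝓝 (0 : ℂ), c s ∈ puncturedPolydisc m r :=
            hc.continuousAt.eventually (by
              rw [hc0]; exact (isOpen_puncturedPolydisc m r).mem_nhds hx)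
          filter_upwards [this] with s hs
          rw [← dihedral_eq, I.dihedral_prop _ hs]
        have h3 := sum_crossLog_mul_of_hasDerivAt (N := m + 2) (y := fun s => line a (chart (c s)))
          (line_add a h1) (by simpa only [hc0] using hne) (prop p).2.1 hu
        rw [show m + 2 - 1 = m + 1 from rfl, Finset.sum_range] at h3
        simp only [hc0] at h3
        rw [← dihedral_eq, I.dihedral_prop x hx] at h3
        have hxp : x p ≠ 0 := norm_pos_iff.1 (hx p).1
        have e : ∀ k : ℕ, d q.castSucc k = if h : k < m + 2 then
            posLin m (x q • fderiv ℂ chart x (Pi.single q 1)) (a ⟨k, h⟩) else 0 := fun k => by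
          simp only [d, D, Fin.snoc_castSucc]
        simp only [e]
        refine h3.trans ?_
        by_cases hpq : p = q
        · subst hpq
          rw [Pi.single_eq_same, mul_one, div_self hxp, Matrix.one_apply_eq]
        · rw [Pi.single_eq_of_ne hpq, mul_zero, zero_div, Matrix.one_apply_ne]
          exact fun h => hpq (Fin.castSucc_injective _ h)
  have hdet := congrArg Matrix.det hprod
  rw [Matrix.det_mul, Matrix.det_mul, Matrix.det_mul, Matrix.det_diagonal, Matrix.det_one, hB,
    Finset.prod_inv_distrib] at hdet
  have hgp : ∏ k, g k = den (pos z) (List.ofFn a) := by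
    rw [den_ofFn]
    refine Finset.prod_congr rfl fun k _ => ?_
    have h1 := line_val a z k.castSucc
    have h2 := line_val a z k.succ
    simp only [Fin.val_castSucc, Fin.val_succ] at h1 h2
    rw [← h1, ← h2]
  have hgp0 : ∏ k, g k ≠ 0 := Finset.prod_ne_zero_iff.2 fun k _ => hg k
  have hcast : ((gapMatrix a).map (Int.cast : ℤ → ℂ)).det = ((gapMatrix a).det : ℂ) :=
    ((Int.castRingHom ℂ).map_det (gapMatrix a)).symm
  rw [hcast] at hdet
  rw [← hgp]
  field_simp at hdet
  linear_combination hdet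

theorem IsTreeChart.tendsto_det_logMatrix (I : IsTreeChart t a prop r chart) :
    Tendsto (fun x => (logMatrix a prop (chart x)).det) (𝓝[puncturedPolydisc m r] 0)
      (𝓝 ((logLim (lo t) (hi t) a prop).det : ℂ)) := by
  have hcast : ((logLim (lo t) (hi t) a prop).map (Int.cast : ℤ → ℂ)).det =
      ((logLim (lo t) (hi t) a prop).det : ℂ) :=
    ((Int.castRingHom ℂ).map_det (logLim (lo t) (hi t) a prop)).symm
  rw [← hcast]
  have h : Tendsto (fun x => logMatrix a prop (chart x)) (𝓝[puncturedPolydisc m r] 0)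
      (𝓝 ((logLim (lo t) (hi t) a prop).map (Int.cast : ℤ → ℂ))) := by
    refine tendsto_pi_nhds.2 fun p => tendsto_pi_nhds.2 fun k => ?_
    refine Fin.lastCases ?_ (fun p => ?_) p
    · simp only [logMatrix, logLim, Matrix.map_apply, Matrix.of_apply, Fin.snoc_last]
      exact I.degenerates.tendsto_gapLog _ _ _
    · simp only [logMatrix, logLim, Matrix.map_apply, Matrix.of_apply, Fin.snoc_castSucc]
      exact I.degenerates.tendsto_crossLog _ _ _
  exact (Continuous.matrix_det continuous_id).continuousAt.tendsto.comp h

theorem differentiableOn_line (I : IsTreeChart t a prop r chart) (k : ℕ) :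
    DifferentiableOn ℂ (fun x => line a (chart x) k) (puncturedPolydisc m r) := by
  by_cases hk : k < m + 2
  · simp only [line, dif_pos hk]
    intro x hx
    exact (DifferentiableAt.comp_differentiableWithinAt (g := fun z : Fin m → ℂ => pos z (a ⟨k, hk⟩))
      x (differentiableAt_pos _ _) (I.chart_holo x hx))
  · simp only [line, dif_neg hk]
    exact differentiableOn_const _

theorem differentiableOn_gapLog (I : IsTreeChart t a prop r chart) {i j : ℕ} (hij : i ≤ j) (k : ℕ) :
    DifferentiableOn ℂ (fun x => gapLog (m + 2) (line a (chart x)) i j k)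
      (puncturedPolydisc m r) := by
  unfold gapLog
  split_ifs with h0 h1
  · exact differentiableOn_const _
  · simp only [div_eq_mul_inv]
    exact ((differentiableOn_line I k).sub (differentiableOn_line I (k + 1))).mul
      (((differentiableOn_line I (i - 1)).sub (differentiableOn_line I j)).inv
        fun x hx => line_ne (I.chart_mem x hx) (i - 1) j (by omega) (by omega))
  · exact differentiableOn_const _

theorem differentiableOn_det_logMatrix (I : IsTreeChart t a prop r chart) :
    DifferentiableOn ℂ (fun x => (logMatrix a prop (chart x)).det) (puncturedPolydisc m r) := by
  have h : ∀ p k, DifferentiableOn ℂ (fun x => logMatrix a prop (chart x) p k)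
      (puncturedPolydisc m r) := by
    intro p k
    refine Fin.lastCases ?_ (fun p => ?_) p
    · simp only [logMatrix, Matrix.of_apply, Fin.snoc_last]
      exact differentiableOn_gapLog I (by have := (ends_lt a).1; omega) _
    · simp only [logMatrix, Matrix.of_apply, Fin.snoc_castSucc, crossLog]
      have := (prop p).2.1
      rw [Fin.lt_def] at this
      exact (((differentiableOn_gapLog I (by omega) _).add
        (differentiableOn_gapLog I (by omega) _)).sub (differentiableOn_gapLog I (by omega) _)).sub
        (differentiableOn_gapLog I (by omega) _)
  simp only [Matrix.det_apply]
  refine DifferentiableOn.fun_sum fun τ _ => ?_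
  refine DifferentiableOn.const_smul ?_ _
  exact fun x hx => (HasFDerivWithinAt.finsetProd fun p _ =>
    (h _ _ x hx).hasFDerivWithinAt).differentiableWithinAt

/-- In the coordinates `u_{I_p}` the Parke-Taylor form of a planar order has logarithmic poles
with residue `± 1` at the boundary point: its coefficient with respect to `⋀ du_p / u_p` is
holomorphic and tends to `± 1`. -/
theorem IsTreeChart.exists_residue (I : IsTreeChart t a prop r chart) : ∃ δ : ℤˣ,
    DifferentiableOn ℂ (fun x => (jac chart x).det / den (pos (chart x)) (List.ofFn a))
      (puncturedPolydisc m r) ∧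
    Tendsto (fun x => (jac chart x).det / den (pos (chart x)) (List.ofFn a))
      (𝓝[puncturedPolydisc m r] 0) (𝓝 ((δ : ℤ) : ℂ)) := by
  obtain ⟨δ₁, h1⟩ := I.isUnit_det_logLim
  obtain ⟨δ₂, h2⟩ := isUnit_det_gapMatrix a
  have hne : ∀ x ∈ puncturedPolydisc m r, den (pos (chart x)) (List.ofFn a) ≠ 0 := fun x hx =>
    den_ne_zero (I.chart_mem x hx) (List.nodup_ofFn.2 a.injective)
  have hU : ∀ x ∈ puncturedPolydisc m r, (logMatrix a prop (chart x)).det *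
      ((δ₂ : ℤ) : ℂ) ≠ 0 := fun x hx h => by
    have := I.det_logMatrix_mul hx
    rw [← h2, h, zero_mul] at this
    exact hne x hx this.symm
  have key : ∀ x ∈ puncturedPolydisc m r, (jac chart x).det / den (pos (chart x)) (List.ofFn a) =
      ((logMatrix a prop (chart x)).det * ((δ₂ : ℤ) : ℂ))⁻¹ := fun x hx => by
    have e := I.det_logMatrix_mul hx
    rw [← h2] at e
    rw [div_eq_iff (hne x hx), ← e, inv_mul_cancel_left₀ (hU x hx)]
  refine ⟨δ₁ * δ₂, ?_, ?_⟩
  · exact (((differentiableOn_det_logMatrix I).mul_const _).inv hU).congr key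
  · have h3 := I.tendsto_det_logMatrix
    rw [← h1] at h3
    have h4 := (h3.mul_const ((δ₂ : ℤ) : ℂ)).inv₀ (by simp)
    have h5 : (((δ₁ : ℤ) : ℂ) * ((δ₂ : ℤ) : ℂ))⁻¹ = (((δ₁ * δ₂ : ℤˣ) : ℤ) : ℂ) := by
      rcases Int.units_eq_one_or δ₁ with rfl | rfl <;> rcases Int.units_eq_one_or δ₂ with rfl | rfl <;>
        norm_num
    rw [h5] at h4
    refine h4.congr' ?_
    filter_upwards [self_mem_nhdsWithin] with x hx
    exact (key x hx).symm

end Jacobian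

/-! ### Integrals over the tori -/

section TorusIntegrals
variable {m : ℕ} {r : ℝ}

open MeasureTheory in
/-- The mean value of `h` on the circle `|λ| = 1` of the line through `x`. -/
theorem integral_circle_eq {h : (Fin m → ℂ) → ℂ} {L : ℂ}
    (hh : DifferentiableOn ℂ h (puncturedPolydisc m r))
    (hL : Tendsto h (𝓝[puncturedPolydisc m r] 0) (𝓝 L)) {x : Fin m → ℂ}
    (hx : x ∈ puncturedPolydisc m r) :
    ∫ α in (0 : ℝ)..2 * Real.pi, h (fun p => Complex.exp (α * Complex.I) * x p) =
      2 * Real.pi * L := by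
  have hmem : ∀ c : ℂ, c ≠ 0 → ‖c‖ ≤ 1 → c • x ∈ puncturedPolydisc m r := fun c h0 h1 p => by
    have := hx p
    rw [Pi.smul_apply, smul_eq_mul, norm_mul]
    have hc := norm_pos_iff.2 h0
    exact ⟨mul_pos hc this.1, by nlinarith⟩
  have hd : ∀ c : ℂ, c ≠ 0 → ‖c‖ ≤ 1 → DifferentiableAt ℂ (fun c : ℂ => h (c • x)) c :=
    fun c h0 h1 => ((hh _ (hmem c h0 h1)).differentiableAt
      ((isOpen_puncturedPolydisc m r).mem_nhds (hmem c h0 h1))).comp c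
        (differentiableAt_id.smul_const x)
  have hlim : Tendsto (fun c : ℂ => h (c • x)) (𝓝[{0}ᶜ] 0) (𝓝 L) := by
    refine hL.comp (tendsto_nhdsWithin_iff.2 ⟨?_, ?_⟩)
    · have : Tendsto (fun c : ℂ => c • x) (𝓝 0) (𝓝 ((0 : ℂ) • x)) :=
        (continuous_id.smul continuous_const).tendsto 0
      rw [zero_smul] at this
      exact this.mono_left nhdsWithin_le_nhds
    · have : ∀ᶠ c : ℂ in 𝓝 0, ‖c‖ < 1 := by
        filter_upwards [Metric.ball_mem_nhds (0 : ℂ) one_pos] with c hc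
        simpa using hc
      filter_upwards [self_mem_nhdsWithin, nhdsWithin_le_nhds this] with c hc h1
      exact hmem c hc h1.le
  have key := Complex.circleIntegral_sub_center_inv_smul_of_differentiable_on_off_countable_of_tendsto
    (c := 0) (R := 1) one_pos (f := fun c : ℂ => h (c • x)) (y := L) Set.countable_empty
    (fun c hc => (hd c (by simpa using hc.2) (by simpa using hc.1)).continuousAt.continuousWithinAt)
    (fun c hc => hd c (by simpa using hc.1.2) (by simpa using (mem_ball_zero_iff.1 hc.1.1).le)) hlim
  rw [circleIntegral] at key
  have e : ∀ α : ℝ, deriv (circleMap 0 1) α • ((circleMap 0 1 α - 0)⁻¹ •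
      h (circleMap 0 1 α • x)) = Complex.I * h (fun p => Complex.exp (α * Complex.I) * x p) := by
    intro α
    have h1 : circleMap 0 1 α = Complex.exp (α * Complex.I) := by simp [circleMap]
    have h2 : (fun p => Complex.exp (α * Complex.I) * x p) = circleMap 0 1 α • x := by
      rw [h1]; rfl
    rw [h2, deriv_circleMap, sub_zero, smul_eq_mul, smul_eq_mul, h1]
    field_simp [Complex.exp_ne_zero]
  simp only [e] at key
  rw [intervalIntegral.integral_const_mul, smul_eq_mul] at key
  refine mul_left_cancel₀ Complex.I_ne_zero (key.trans ?_)
  ring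

open MeasureTheory in
/-- A function on a punctured polydisc that is holomorphic and has a limit at the origin has this
limit as its mean value on the tori. -/
theorem integral_torus_eq {h : (Fin m → ℂ) → ℂ} {L : ℂ}
    (hh : DifferentiableOn ℂ h (puncturedPolydisc m r))
    (hL : Tendsto h (𝓝[puncturedPolydisc m r] 0) (𝓝 L)) {ε : Fin m → ℝ}
    (hε : ∀ p, 0 < ε p ∧ ε p < r) :
    ∫ θ in Set.Icc (0 : Fin m → ℝ) (fun _ => 2 * Real.pi), h (torusMap 0 ε θ) =
      (2 * Real.pi) ^ m * L := by
  have : Fact (0 < 2 * Real.pi) := ⟨Real.two_pi_pos⟩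
  let T : (Fin m → AddCircle (2 * Real.pi)) → Fin m → ℂ :=
    fun ω p => ε p * (AddCircle.toCircle (ω p) : ℂ)
  have hT : ∀ ω, T ω ∈ puncturedPolydisc m r := fun ω p => by
    have h1 := hε p
    have : ‖T ω p‖ = ε p := by
      simp [T, abs_of_pos h1.1, Circle.norm_coe]
    rw [this]
    exact h1
  have hTc : Continuous T := continuous_pi fun p => continuous_const.mul
    (continuous_subtype_val.comp (AddCircle.continuous_toCircle.comp (continuous_apply p)))
  have hF : Continuous fun ω => h (T ω) :=
    hh.continuousOn.comp_continuous hTc hT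
  have hexp : ∀ α : ℝ, ((AddCircle.toCircle (α : AddCircle (2 * Real.pi)) : Circle) : ℂ) =
      Complex.exp (α * Complex.I) := fun α => by
    rw [AddCircle.toCircle_apply_mk, div_self Real.two_pi_pos.ne', one_mul, Circle.coe_exp]
  have e1 : ∫ θ in Set.Icc (0 : Fin m → ℝ) (fun _ => 2 * Real.pi), h (torusMap 0 ε θ) =
      ∫ ω, h (T ω) := by
    have mp : MeasurePreserving (fun (θ : Fin m → ℝ) p => (θ p : AddCircle (2 * Real.pi)))
        (volume.restrict (Set.univ.pi fun _ => Set.Ioc 0 (0 + 2 * Real.pi))) volume := by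
      rw [volume_pi, volume_pi, Measure.restrict_pi_pi]
      exact measurePreserving_pi _ _ fun _ => AddCircle.measurePreserving_mk (2 * Real.pi) 0
    rw [volume_pi, ← setIntegral_congr_set Measure.univ_pi_Ioc_ae_eq_Icc, ← volume_pi,
      ← mp.map_eq, integral_map mp.aemeasurable (by
        rw [mp.map_eq]; exact hF.aestronglyMeasurable)]
    simp only [zero_add, Pi.zero_apply]
    refine integral_congr_ae (Eventually.of_forall fun θ => ?_)
    have : torusMap 0 ε θ = T fun p => (θ p : AddCircle (2 * Real.pi)) := by
      funext p
      simp only [T, hexp, torusMap, Pi.zero_apply, zero_add]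
    simp only [this]
  rw [e1]
  -- rotate all the coordinates simultaneously
  let G : AddCircle (2 * Real.pi) → (Fin m → AddCircle (2 * Real.pi)) → ℂ :=
    fun α ω => h (T (ω + fun _ => α))
  have hG : Continuous (Function.uncurry G) :=
    hF.comp (continuous_snd.add (continuous_pi fun _ => continuous_fst))
  have swap := integral_integral_swap_of_hasCompactSupport (μ := volume) (ν := volume) hG
    (HasCompactSupport.of_compactSpace _)
  have l1 : ∀ α, ∫ ω, G α ω = ∫ ω, h (T ω) := fun α =>
    integral_add_right_eq_self (fun ω => h (T ω)) _
  have l2 : ∀ ω, ∫ α, G α ω = 2 * Real.pi * L := fun ω => by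
    rw [← AddCircle.intervalIntegral_preimage (2 * Real.pi) 0, zero_add,
      ← integral_circle_eq hh hL (hT ω)]
    refine intervalIntegral.integral_congr fun α _ => ?_
    have : T (ω + fun _ => (α : AddCircle (2 * Real.pi))) =
        fun p => Complex.exp (α * Complex.I) * T ω p := by
      funext p
      simp only [T, Pi.add_apply, AddCircle.toCircle_add, Circle.coe_mul, hexp]
      ring
    simp only [G, this]
  simp only [l1, l2, integral_const] at swap
  have v1 : (volume : Measure (AddCircle (2 * Real.pi))).real Set.univ = 2 * Real.pi := by
    rw [measureReal_def, AddCircle.measure_univ, ENNReal.toReal_ofReal Real.two_pi_pos.le]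
  have v2 : (volume : Measure (Fin m → AddCircle (2 * Real.pi))).real Set.univ =
      (2 * Real.pi) ^ m := by
    rw [measureReal_def, volume_pi, Measure.pi_univ]
    simp [AddCircle.measure_univ, ENNReal.toReal_ofReal Real.pi_pos.le]
  rw [v1, v2, Complex.real_smul, Complex.real_smul] at swap
  have hpi : (2 * Real.pi : ℂ) ≠ 0 := by
    simp [Real.pi_ne_zero]
  push_cast at swap
  refine mul_left_cancel₀ hpi (swap.trans ?_)
  ring

end TorusIntegrals

section CycleIntegrals
variable {m : ℕ} {t : FreeMagma (Fin (m + 2))} {a : Equiv.Perm (Fin (m + 2))}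
  {prop : Fin m → Chord m} {r : ℝ} {chart : (Fin m → ℂ) → Fin m → ℂ}

theorem torusMap_mem {ε : Fin m → ℝ} (hε : ∀ p, 0 < ε p ∧ ε p < r) (θ : Fin m → ℝ) :
    torusMap 0 ε θ ∈ puncturedPolydisc m r := fun p => by
  have : ‖torusMap 0 ε θ p‖ = ε p := by
    simp [torusMap, Complex.norm_exp_ofReal_mul_I, abs_of_pos (hε p).1]
  rw [this]
  exact hε p

theorem parkeTaylor_eq (b : Equiv.Perm (Fin (m + 2))) (z : Fin m → ℂ) :
    parkeTaylor b z = (((2 * Real.pi * Complex.I) ^ m)⁻¹ * (den (pos z) (List.ofFn b))⁻¹) •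
      dSigma m := by
  rw [parkeTaylor, den_ofFn]

/-- The integrand of `∫ PT_b` over the torus. -/
theorem IsTreeChart.parkeTaylor_fderiv (I : IsTreeChart t a prop r chart) {ε : Fin m → ℝ}
    (hε : ∀ p, 0 < ε p ∧ ε p < r) (b : Equiv.Perm (Fin (m + 2))) (θ : Fin m → ℝ) :
    (parkeTaylor b (chart (torusMap 0 ε θ)) fun p =>
      fderiv ℝ (fun θ => chart (torusMap 0 ε θ)) θ (Pi.single p 1)) = ((2 * (Real.pi : ℂ)) ^ m)⁻¹ *
      ((jac chart (torusMap 0 ε θ)).det / den (pos (chart (torusMap 0 ε θ))) (List.ofFn b)) := by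
  set x := torusMap 0 ε θ with hx
  have hmem : x ∈ puncturedPolydisc m r := torusMap_mem hε θ
  have hd : HasFDerivAt chart (fderiv ℂ chart x) x :=
    ((I.chart_holo x hmem).differentiableAt
      ((isOpen_puncturedPolydisc m r).mem_nhds hmem)).hasFDerivAt
  have h1 : ∀ p, fderiv ℝ (fun θ => chart (torusMap 0 ε θ)) θ (Pi.single p 1) =
      Complex.I • fun i => jac chart x i p := by
    intro p
    have hT : DifferentiableAt ℝ (fun θ : Fin m → ℝ => torusMap 0 ε θ) θ := by
      unfold torusMap
      refine differentiableAt_pi.2 fun q => ?_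
      have : DifferentiableAt ℝ (fun θ : Fin m → ℝ => ((θ q : ℝ) : ℂ)) θ :=
        (Complex.ofRealCLM.comp (ContinuousLinearMap.proj (R := ℝ) (φ := fun _ => ℝ) q)).differentiableAt
      exact ((this.mul_const _).cexp.const_mul _).const_add _
    have hdT : DifferentiableAt ℝ (fun θ => chart (torusMap 0 ε θ)) θ :=
      (hd.restrictScalars ℝ).differentiableAt.comp θ hT
    have hl : HasDerivAt (fun s : ℝ => θ + s • (Pi.single p 1 : Fin m → ℝ)) (Pi.single p 1) 0 := by
      have := ((hasDerivAt_id (0 : ℝ)).smul_const (Pi.single p 1 : Fin m → ℝ)).const_add θ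
      rwa [one_smul] at this
    have e0 : θ + (0 : ℝ) • (Pi.single p 1 : Fin m → ℝ) = θ := by simp
    have d1 : HasDerivAt (fun s : ℝ => chart (torusMap 0 ε (θ + s • (Pi.single p 1 : Fin m → ℝ))))
        (fderiv ℝ (fun θ => chart (torusMap 0 ε θ)) θ (Pi.single p 1)) 0 := by
      have h0 : HasFDerivAt (fun θ => chart (torusMap 0 ε θ))
          (fderiv ℝ (fun θ => chart (torusMap 0 ε θ)) θ)
          (θ + (0 : ℝ) • (Pi.single p 1 : Fin m → ℝ)) := by
        rw [e0]; exact hdT.hasFDerivAt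
      exact h0.comp_hasDerivAt 0 hl
    have d2 : HasDerivAt (fun s : ℝ => torusMap 0 ε (θ + s • (Pi.single p 1 : Fin m → ℝ)))
        (Complex.I • x p • Pi.single p (1 : ℂ)) 0 := by
      refine hasDerivAt_pi.2 fun q => ?_
      have hq : HasDerivAt (fun s : ℝ => ((θ q + s * (Pi.single p 1 : Fin m → ℝ) q : ℝ) : ℂ))
          (((Pi.single p 1 : Fin m → ℝ) q : ℝ) : ℂ) 0 := by
        have := (((hasDerivAt_id (0 : ℝ)).mul_const ((Pi.single p 1 : Fin m → ℝ) q)).const_add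
          (θ q)).ofReal_comp
        simpa using this
      have := (((hq.mul_const Complex.I).cexp).const_mul ((ε q : ℝ) : ℂ)).const_add (0 : ℂ)
      refine this.congr_deriv ?_
      rw [hx]
      by_cases hqp : q = p
      · subst hqp
        simp [torusMap]
        ring
      · simp [Pi.single_eq_of_ne hqp]
    have d3 : HasDerivAt (fun s : ℝ => chart (torusMap 0 ε (θ + s • (Pi.single p 1 : Fin m → ℝ))))
        (fderiv ℂ chart x (Complex.I • x p • Pi.single p (1 : ℂ))) 0 := by
      have h0 : HasFDerivAt chart ((fderiv ℂ chart x).restrictScalars ℝ)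
          (torusMap 0 ε (θ + (0 : ℝ) • (Pi.single p 1 : Fin m → ℝ))) := by
        rw [e0]; exact hd.restrictScalars ℝ
      exact h0.comp_hasDerivAt 0 d2
    rw [d1.unique d3, map_smul, map_smul]
    rfl
  simp only [h1]
  have h2 : (dSigma m fun p => Complex.I • fun i => jac chart x i p) =
      Complex.I ^ m * (jac chart x).det := by
    rw [dSigma_eq, detForm_apply]
    have : (Matrix.of fun i j => (LinearMap.proj i : (Fin m → ℂ) →ₗ[ℝ] ℂ)
        (Complex.I • fun i => jac chart x i j)) = Complex.I • jac chart x := by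
      ext i j; rfl
    rw [this, Matrix.det_smul, Fintype.card_fin]
  rw [parkeTaylor_eq, AlternatingMap.smul_apply, h2, smul_eq_mul, mul_pow, mul_inv]
  have hI : (Complex.I ^ m) ≠ 0 := pow_ne_zero _ Complex.I_ne_zero
  field_simp

/-- The coefficients of the Parke-Taylor forms with respect to `⋀ du_p / u_p` are holomorphic, and
their values at the boundary point are, up to a common sign, the coefficients of the Lie
monomial. -/
theorem IsTreeChart.exists_residue_word (I : IsTreeChart t a prop r chart) :
    ∃ δ : ℤˣ, ∀ b : Equiv.Perm (Fin (m + 2)),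
      DifferentiableOn ℂ (fun x => (jac chart x).det / den (pos (chart x)) (List.ofFn b))
        (puncturedPolydisc m r) ∧
      Tendsto (fun x => (jac chart x).det / den (pos (chart x)) (List.ofFn b))
        (𝓝[puncturedPolydisc m r] 0) (𝓝 (((δ : ℤ) : ℂ) * cf (expand t) (List.ofFn b))) := by
  obtain ⟨δ, h1, h2⟩ := I.exists_residue
  refine ⟨δ, fun b => ?_⟩
  have hne : ∀ b : Equiv.Perm (Fin (m + 2)), ∀ x ∈ puncturedPolydisc m r,
      den (pos (chart x)) (List.ofFn b) ≠ 0 := fun b x hx =>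
    den_ne_zero (I.chart_mem x hx) (List.nodup_ofFn.2 b.injective)
  have hden : ∀ b : Equiv.Perm (Fin (m + 2)),
      DifferentiableOn ℂ (fun x => den (pos (chart x)) (List.ofFn b)) (puncturedPolydisc m r) := by
    intro b
    simp only [den_ofFn]
    have hp : ∀ i, DifferentiableOn ℂ (fun x => pos (chart x) i) (puncturedPolydisc m r) :=
      fun i x hx => DifferentiableAt.comp_differentiableWithinAt (g := fun z : Fin m → ℂ => pos z i)
        x (differentiableAt_pos _ _) (I.chart_holo x hx)
    exact fun x hx => (HasFDerivWithinAt.finsetProd fun p _ =>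
      ((hp _ x hx).sub (hp _ x hx)).hasFDerivWithinAt).differentiableWithinAt
  have key : ∀ x ∈ puncturedPolydisc m r,
      (jac chart x).det / den (pos (chart x)) (List.ofFn b) =
      (jac chart x).det / den (pos (chart x)) (List.ofFn a) *
        (den (pos (chart x)) (List.ofFn a) * (den (pos (chart x)) (List.ofFn b))⁻¹) :=
    fun x hx => by
      have := hne a x hx
      field_simp
  refine ⟨(h1.mul ((hden a).mul ((hden b).inv (hne b)))).congr key, ?_⟩
  refine (h2.mul (I.tendsto_den_div b)).congr' ?_
  filter_upwards [self_mem_nhdsWithin] with x hx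
  rw [div_eq_mul_inv (den _ (List.ofFn a)) (den _ _)]
  exact (key x hx).symm

/-- The integrals of the Parke-Taylor forms over a torus around the boundary point of a tree are,
up to a sign, the coefficients of the Lie monomial. -/
theorem IsTreeChart.exists_torusInt_eq (I : IsTreeChart t a prop r chart) {ε : Fin m → ℝ}
    (hε : ∀ p, 0 < ε p ∧ ε p < r) : ∃ δ : ℤˣ, ∀ b : Equiv.Perm (Fin (m + 2)),
      torusInt (fun θ => chart (torusMap 0 ε θ)) (parkeTaylor b) =
        ((δ : ℤ) : ℂ) * cf (expand t) (List.ofFn b) := by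
  obtain ⟨δ, hδ⟩ := I.exists_residue_word
  refine ⟨δ, fun b => ?_⟩
  have := integral_torus_eq (hδ b).1 (hδ b).2 hε
  rw [torusInt]
  simp only [I.parkeTaylor_fderiv hε]
  rw [MeasureTheory.integral_const_mul, this]
  have hpi : ((2 * Real.pi : ℂ)) ^ m ≠ 0 := pow_ne_zero _ (by simp [Real.pi_ne_zero])
  rw [inv_mul_cancel_left₀ hpi]

theorem IsTreeChart.integrableOn_parkeTaylor (I : IsTreeChart t a prop r chart) {ε : Fin m → ℝ}
    (hε : ∀ p, 0 < ε p ∧ ε p < r) (b : Equiv.Perm (Fin (m + 2))) :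
    MeasureTheory.IntegrableOn (fun θ => parkeTaylor b (chart (torusMap 0 ε θ)) fun p =>
      fderiv ℝ (fun θ => chart (torusMap 0 ε θ)) θ (Pi.single p 1))
      (Set.Icc (0 : Fin m → ℝ) fun _ => 2 * Real.pi) := by
  obtain ⟨δ, hδ⟩ := I.exists_residue_word
  simp only [I.parkeTaylor_fderiv hε]
  have hT : Continuous fun θ : Fin m → ℝ => torusMap 0 ε θ := by
    unfold torusMap
    fun_prop
  exact (continuous_const.mul ((hδ b).1.continuousOn.comp_continuous hT
    (torusMap_mem hε))).continuousOn.integrableOn_compact isCompact_Icc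

end CycleIntegrals

/-! ### Existence of the cycles -/

section BlowUp
variable {m N : ℕ} (b c : Fin m → ℕ)

/-- The product of the coordinates `t_p` of the intervals `p ⊇ [i - 1, j]`, which is the order of
magnitude of `y_{i-1} - y_j`. -/
def leading (t : Fin m → ℂ) (i j : ℕ) : ℂ := ∏ p, if b p + 1 ≤ i ∧ j ≤ c p then t p else 1

/-- The quotient of `y_{i-1} - y_j` by its order of magnitude. -/
def correction (N : ℕ) (t : Fin m → ℂ) (i j : ℕ) : ℂ :=
  if i = 0 ∨ N ≤ j then 1 else ∑ k ∈ Finset.Ico (i - 1) j,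
    ∏ p, if (b p ≤ k ∧ k < c p) ∧ ¬ (b p + 1 ≤ i ∧ j ≤ c p) then t p else 1

/-- The configuration of points in which the gap `k` is the product of the coordinates `t_p` of all
the intervals `p` that contain it. -/
def blowUp (t : Fin m → ℂ) (i : ℕ) : ℂ :=
  -∑ k ∈ Finset.range i, ∏ p, if b p ≤ k ∧ k < c p then t p else 1

variable {b c}

theorem blowUp_gap (t : Fin m → ℂ) (k : ℕ) : blowUp b c t k - blowUp b c t (k + 1) =
    ∏ p, if b p ≤ k ∧ k < c p then t p else 1 := by
  rw [blowUp, blowUp, Finset.sum_range_succ]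
  ring

theorem rho_blowUp (hc : ∀ p, c p < N) (t : Fin m → ℂ) {i j : ℕ} (hij : i ≤ j) :
    rho N (blowUp b c t) i j = leading b c t i j * correction b c N t i j := by
  by_cases h0 : i = 0 ∨ N ≤ j
  · rw [rho, correction, if_pos h0, if_pos h0, mul_one, leading]
    refine (Finset.prod_eq_one fun p _ => if_neg ?_).symm
    have := hc p
    omega
  · rw [rho, correction, if_neg h0, if_neg h0, sub_eq_sum_gap _ (show i - 1 ≤ j by omega),
      Finset.mul_sum]
    refine Finset.sum_congr rfl fun k hk => ?_
    rw [Finset.mem_Ico] at hk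
    rw [blowUp_gap, leading, ← Finset.prod_mul_distrib]
    refine Finset.prod_congr rfl fun p _ => ?_
    by_cases h1 : b p + 1 ≤ i ∧ j ≤ c p
    · rw [if_pos (by omega), if_pos h1, if_neg (by omega), mul_one]
    · rw [if_neg h1, one_mul]
      exact if_congr (by omega) rfl rfl

theorem leading_ne_zero {t : Fin m → ℂ} (ht : ∀ p, t p ≠ 0) (i j : ℕ) : leading b c t i j ≠ 0 :=
  Finset.prod_ne_zero_iff.2 fun p _ => by
    split_ifs
    · exact ht p
    · exact one_ne_zero

theorem leading_mul (t : Fin m → ℂ) {i j : ℕ} : leading b c t (i + 1) j * leading b c t i (j + 1) =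
    (∏ p, if b p = i ∧ c p = j then t p else 1) *
      (leading b c t (i + 1) (j + 1) * leading b c t i j) := by
  simp only [leading]
  rw [← Finset.prod_mul_distrib, ← Finset.prod_mul_distrib, ← Finset.prod_mul_distrib]
  refine Finset.prod_congr rfl fun p _ => ?_
  by_cases h1 : b p + 1 ≤ i <;> by_cases h2 : j + 1 ≤ c p
  · rw [if_pos (by omega), if_pos (by omega), if_neg (by omega), if_pos (by omega),
      if_pos (by omega), one_mul]
  · by_cases h3 : c p = j
    · rw [if_pos (by omega), if_neg (by omega), if_neg (by omega), if_neg (by omega),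
        if_pos (by omega)]
      ring
    · rw [if_neg (by omega), if_neg (by omega), if_neg (by omega), if_neg (by omega),
        if_neg (by omega)]
      ring
  · by_cases h3 : b p = i
    · rw [if_pos (by omega), if_neg (by omega), if_neg (by omega), if_pos (by omega),
        if_neg (by omega)]
      ring
    · rw [if_neg (by omega), if_neg (by omega), if_neg (by omega), if_neg (by omega),
        if_neg (by omega)]
      ring
  · by_cases h3 : b p = i ∧ c p = j
    · rw [if_pos (by omega), if_neg (by omega), if_pos h3, if_neg (by omega), if_neg (by omega)]
      ring
    · rw [if_neg (by omega), if_neg (by omega), if_neg h3, if_neg (by omega), if_neg (by omega)]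
      ring

/-- The dihedral coordinate of `[i, j]` up to the factor `t_p` if `[i, j]` is the interval `p`. -/
def crossCorrection (b c : Fin m → ℕ) (N : ℕ) (t : Fin m → ℂ) (i j : ℕ) : ℂ :=
  correction b c N t (i + 1) j * correction b c N t i (j + 1) *
    (correction b c N t (i + 1) (j + 1) * correction b c N t i j)⁻¹

theorem crossU_blowUp (hc : ∀ p, c p < N) {t : Fin m → ℂ} (ht : ∀ p, t p ≠ 0) {i j : ℕ}
    (hij : i < j) : crossU N (blowUp b c t) i j =
      (∏ p, if b p = i ∧ c p = j then t p else 1) * crossCorrection b c N t i j := by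
  have h1 := leading_ne_zero (b := b) (c := c) ht (i + 1) (j + 1)
  have h2 := leading_ne_zero (b := b) (c := c) ht i j
  rw [crossU, rho_blowUp hc t (by omega), rho_blowUp hc t (by omega), rho_blowUp hc t (by omega),
    rho_blowUp hc t (by omega), crossCorrection, mul_mul_mul_comm, leading_mul, mul_mul_mul_comm
    (leading b c t (i + 1) (j + 1)), mul_assoc, mul_div_assoc, mul_div_mul_left _ _
    (mul_ne_zero h1 h2), div_eq_mul_inv]

theorem contDiff_prod_ite (P : Fin m → Prop) [DecidablePred P] :
    ContDiff ℂ 1 fun t : Fin m → ℂ => ∏ p, if P p then t p else 1 := by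
  refine contDiff_prod fun p _ => ?_
  split_ifs
  · exact contDiff_apply ℂ ℂ p
  · exact contDiff_const

theorem contDiff_blowUp (i : ℕ) : ContDiff ℂ 1 fun t => blowUp b c t i :=
  (ContDiff.sum fun _ _ => contDiff_prod_ite _).neg

theorem contDiff_correction (i j : ℕ) : ContDiff ℂ 1 fun t => correction b c N t i j := by
  unfold correction
  split_ifs
  · exact contDiff_const
  · exact ContDiff.sum fun _ _ => contDiff_prod_ite _

/-- An interval `[i - 1, j]` contains a single gap, that of its lowest common ancestor, which lies
only in vertex intervals that contain `[i - 1, j]`. -/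
theorem correction_zero {lo hi : ℕ → ℕ} (T : IsTree N lo hi) {κ : Fin m → ℕ}
    (hκ : ∀ p, κ p + 1 < N) (hκr : ∀ k, k + 1 < N → (∃ p, κ p = k) ∨ (lo k = 0 ∧ hi k = N - 1))
    {i j : ℕ} (hij : i ≤ j) :
    correction (fun p => lo (κ p)) (fun p => hi (κ p)) N 0 i j = 1 := by
  by_cases h0 : i = 0 ∨ N ≤ j
  · rw [correction, if_pos h0]
  · rw [correction, if_neg h0]
    obtain ⟨K, e1, e2, e3, e4⟩ := T.exists_top (i - 1) j (by omega) (by omega)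
    rw [Finset.sum_eq_single K]
    · refine Finset.prod_eq_one fun p _ => if_neg ?_
      have := T.top_mem_iff (by omega) e1 e2 e3 e4 (hκ p)
      rintro ⟨h1, h2⟩
      have := this.1 h1
      omega
    · intro k hk hkK
      rw [Finset.mem_Ico] at hk
      have hne : ¬ (lo k ≤ i - 1 ∧ j ≤ hi k) := fun h =>
        hkK (T.unique (i - 1) j k K (by omega) (by omega) hk.1 hk.2 e1 e2 h.1 h.2 e3 e4)
      have hkN : k + 1 < N := by omega
      rcases hκr k hkN with ⟨p, hp⟩ | hr
      · have a1 := T.lo_le k hkN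
        have a2 := T.lt_hi k hkN
        refine Finset.prod_eq_zero (Finset.mem_univ p) ?_
        rw [hp, if_pos (by omega)]
        rfl
      · omega
    · intro h
      rw [Finset.mem_Ico] at h
      omega

end BlowUp

section Affine
variable {N : ℕ}

/-- The dihedral coordinates are invariant under affine transformations. -/
theorem crossU_affine {y y' : ℕ → ℂ} {α β : ℂ} (hβ : β ≠ 0) (h : ∀ k, k < N → y' k = (y k - α) / β)
    {i j : ℕ} (hij : i < j) (hj : j < N) (hr : ¬ (i = 0 ∧ j + 1 = N)) :
    crossU N y' i j = crossU N y i j := by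
  have key : ∀ i j, i ≤ j → rho N y' i j = rho N y i j * if i = 0 ∨ N ≤ j then 1 else β⁻¹ := by
    intro i j hij
    rw [rho, rho]
    split_ifs with h0
    · rw [mul_one]
    · rw [h _ (by omega), h _ (by omega), ← sub_div, div_eq_mul_inv]
      ring
  have hβ' := inv_ne_zero hβ
  rw [crossU, crossU, key _ _ (by omega), key _ _ (by omega), key _ _ (by omega),
    key _ _ (by omega)]
  by_cases h4 : i = 0
  · rw [if_neg (by omega), if_pos (by omega), if_neg (by omega), if_pos (by omega), mul_one, mul_one,
      mul_right_comm, mul_right_comm _ β⁻¹, mul_div_mul_right _ _ hβ']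
  · by_cases h5 : j + 1 = N
    · rw [if_neg (by omega), if_pos (by omega), if_pos (by omega), if_neg (by omega), mul_one,
        mul_one, mul_right_comm, ← mul_assoc, mul_div_mul_right _ _ hβ']
    · rw [if_neg (by omega), if_neg (by omega), if_neg (by omega), if_neg (by omega),
        mul_mul_mul_comm, mul_mul_mul_comm (rho N y (i + 1) (j + 1)),
        mul_div_mul_right _ _ (mul_ne_zero hβ' hβ')]

end Affine

section Existence
variable {m : ℕ}

/-- The point of the moduli space, in the gauge `(σ_1, σ_{n-1}, σ_n) = (0, 1, ∞)`, of the
configuration with `σ_{a(i)} = y_i`. -/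
def gauge (a : Equiv.Perm (Fin (m + 2))) (y : ℕ → ℂ) (i : Fin m) : ℂ :=
  (y (a.symm (moving i)) - y (a.symm 0)) / (y (a.symm (Fin.last (m + 1))) - y (a.symm 0))

theorem line_gauge (a : Equiv.Perm (Fin (m + 2))) {y : ℕ → ℂ}
    (h : y (a.symm (Fin.last (m + 1))) - y (a.symm 0) ≠ 0) {k : ℕ} (hk : k < m + 2) :
    line a (gauge a y) k =
      (y k - y (a.symm 0)) / (y (a.symm (Fin.last (m + 1))) - y (a.symm 0)) := by
  have key : ∀ l : Fin (m + 2), pos (gauge a y) l =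
      (y (a.symm l) - y (a.symm 0)) / (y (a.symm (Fin.last (m + 1))) - y (a.symm 0)) := by
    intro l
    refine Fin.cases ?_ (fun l => ?_) l
    · simp
    · refine Fin.lastCases ?_ (fun l => ?_) l
      · rw [Fin.succ_last, pos_last, div_self h]
      · exact pos_moving _ _
  rw [line, dif_pos hk, key, Equiv.symm_apply_apply]

/-- The gaps of a tree other than that of the root. -/
theorem IsTree.exists_enum {lo hi : ℕ → ℕ} (T : IsTree (m + 2) lo hi) : ∃ κ : Fin m → ℕ,
    Function.Injective κ ∧ (∀ p, κ p + 1 < m + 2) ∧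
      (∀ p, ¬ (lo (κ p) = 0 ∧ hi (κ p) = m + 1)) ∧
      ∀ k, k + 1 < m + 2 → (∃ p, κ p = k) ∨ (lo k = 0 ∧ hi k = m + 1) := by
  obtain ⟨K, e1, e2, e3, e4⟩ := T.exists_top 0 (m + 1) (by omega) (by omega)
  let R : Fin (m + 1) := ⟨K, by omega⟩
  refine ⟨fun p => R.succAbove p, fun p q h => R.succAbove_right_injective (Fin.ext h),
    fun p => Nat.succ_lt_succ (R.succAbove p).2, fun p hp => ?_, fun k hk => ?_⟩
  · have hlt := (R.succAbove p).2
    dsimp only at hp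
    have := T.unique 0 (m + 1) (R.succAbove p) K (by omega) (by omega) (by omega) (by omega)
      (by omega) (by omega) (by omega) (by omega) e3 e4
    exact Fin.succAbove_ne R p (Fin.ext this)
  · by_cases hkK : (⟨k, by omega⟩ : Fin (m + 1)) = R
    · have : k = K := congrArg Fin.val hkK
      have h3 := T.hi_lt K (by omega)
      subst this
      right
      omega
    · obtain ⟨p, hp⟩ := Fin.exists_succAbove_eq hkK
      exact Or.inl ⟨p, congrArg Fin.val hp⟩

/-- Vertex intervals determine the vertex. -/
theorem IsTree.gap_injective {N : ℕ} {lo hi : ℕ → ℕ} (T : IsTree N lo hi) {k k' : ℕ}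
    (hk : k + 1 < N) (hk' : k' + 1 < N) (h1 : lo k = lo k') (h2 : hi k = hi k') : k = k' := by
  have a1 := T.lo_le k hk
  have a2 := T.lt_hi k hk
  have b1 := T.lo_le k' hk'
  have b2 := T.lt_hi k' hk'
  exact T.unique (lo k) (hi k) k k' hk hk' a1 a2 (by omega) (by omega) le_rfl le_rfl (by omega)
    (by omega)

/-- The dihedral coordinates `u_{I_p}` are local coordinates at the boundary point of a tree: in the
coordinates `t_p` of `blowUp` they are `t_p` up to a unit with value `1`, and the inverse function
theorem applies. -/
theorem exists_isTreeChart {t : FreeMagma (Fin (m + 2))} {a : Equiv.Perm (Fin (m + 2))}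
    (ht : leaves t = List.ofFn a) : ∃ prop r chart, IsTreeChart t a prop r chart := by
  have T := isTree t
  rw [ht, List.length_ofFn] at T
  obtain ⟨κ, hinj, hκ, hnr, hκr⟩ := T.exists_enum
  set b : Fin m → ℕ := fun p => lo t (κ p) with hb
  set c : Fin m → ℕ := fun p => hi t (κ p) with hc
  have hbc : ∀ p, b p < c p := fun p => (T.lo_le _ (hκ p)).trans_lt (T.lt_hi _ (hκ p))
  have hcN : ∀ p, c p < m + 2 := fun p => T.hi_lt _ (hκ p)
  have hS0 : ∀ i j, i ≤ j → correction b c (m + 2) 0 i j = 1 := fun i j hij =>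
    correction_zero T hκ hκr hij
  let prop : Fin m → Chord m := fun p => ⟨(⟨b p, (hbc p).trans (hcN p)⟩, ⟨c p, hcN p⟩), hbc p,
    fun e => hnr p ⟨congrArg (fun x : Fin (m + 2) × Fin (m + 2) => (x.1 : ℕ)) e,
      congrArg (fun x : Fin (m + 2) × Fin (m + 2) => (x.2 : ℕ)) e⟩⟩
  have hprop : ∀ p q, b p = b q ∧ c p = c q → p = q := fun p q h =>
    hinj (T.gap_injective (hκ p) (hκ q) h.1 h.2)
  have hV0 : ∀ i j, i < j → crossCorrection b c (m + 2) 0 i j = 1 := fun i j hij => by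
    rw [crossCorrection, hS0 _ _ (by omega), hS0 _ _ (by omega), hS0 _ _ (by omega),
      hS0 _ _ (by omega)]
    simp
  have hVc : ∀ i j, i < j → ContDiffAt ℂ 1 (fun x => crossCorrection b c (m + 2) x i j) 0 :=
    fun i j hij => ((contDiff_correction _ _).mul (contDiff_correction _ _)).contDiffAt.mul
      (((contDiff_correction _ _).mul (contDiff_correction _ _)).contDiffAt.inv (by
        rw [hS0 _ _ (by omega), hS0 _ _ (by omega)]; simp))
  let Φ : (Fin m → ℂ) → Fin m → ℂ := fun x p => x p * crossCorrection b c (m + 2) x (b p) (c p)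
  have hΦ0 : Φ 0 = 0 := by funext p; simp [Φ]
  have hΦc : ContDiffAt ℂ 1 Φ 0 := contDiffAt_pi.2 fun p =>
    (contDiff_apply ℂ ℂ p).contDiffAt.mul (hVc _ _ (hbc p))
  have hΦd : HasFDerivAt Φ ((ContinuousLinearEquiv.refl ℂ (Fin m → ℂ) :
      (Fin m → ℂ) ≃L[ℂ] (Fin m → ℂ)) : (Fin m → ℂ) →L[ℂ] (Fin m → ℂ)) 0 := by
    refine hasFDerivAt_pi'.2 fun p => ?_
    have h1 : HasFDerivAt (fun x : Fin m → ℂ => x p)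
        (ContinuousLinearMap.proj (R := ℂ) (φ := fun _ => ℂ) p) 0 :=
      (ContinuousLinearMap.proj (R := ℂ) (φ := fun _ => ℂ) p).hasFDerivAt
    have h2 := h1.mul ((hVc _ _ (hbc p)).differentiableAt one_ne_zero).hasFDerivAt
    refine h2.congr_fderiv ?_
    rw [hV0 _ _ (hbc p)]
    ext v
    simp
  set Ψ := hΦc.localInverse hΦd one_ne_zero with hΨ
  have hΨ0 : Ψ 0 = 0 := by
    have := hΦc.localInverse_apply_image hΦd one_ne_zero
    rwa [hΦ0] at this
  have hΨc : ContDiffAt ℂ 1 Ψ 0 := by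
    have := hΦc.to_localInverse hΦd one_ne_zero
    rwa [hΦ0] at this
  have hright : ∀ᶠ x in 𝓝 0, Φ (Ψ x) = x := by
    have := (hΦc.hasStrictFDerivAt' hΦd one_ne_zero).eventually_right_inverse
    rwa [hΦ0] at this
  have hSne : ∀ᶠ x in 𝓝 0, ∀ i : Fin (m + 2), ∀ j : Fin (m + 2), i < j →
      correction b c (m + 2) (Ψ x) (i + 1) j ≠ 0 := by
    refine eventually_all.2 fun i => eventually_all.2 fun j => ?_
    by_cases hij : i < j
    · have h1 : ContinuousAt (fun x => correction b c (m + 2) (Ψ x) (i + 1) j) 0 :=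
        (contDiff_correction _ _).continuous.continuousAt.comp hΨc.continuousAt
      have := h1.eventually_ne (y := 0) (by
        rw [hΨ0, hS0 _ _ (by rw [Fin.lt_def] at hij; omega)]; exact one_ne_zero)
      filter_upwards [this] with x hx _ using hx
    · exact Eventually.of_forall fun x h => absurd h hij
  have hdiff : ∀ᶠ x in 𝓝 0, DifferentiableAt ℂ Ψ x := by
    filter_upwards [hΨc.eventually (by simp)] with x hx
    exact hx.differentiableAt one_ne_zero
  obtain ⟨r, r_pos, hr⟩ := Metric.eventually_nhds_iff.1 (hright.and (hSne.and hdiff))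
  have hball : ∀ x ∈ puncturedPolydisc m r, dist x 0 < r := fun x hx => by
    rw [dist_zero_right, pi_norm_lt_iff r_pos]
    exact fun p => (hx p).2
  -- in the punctured polydisc the coordinates `t_p` do not vanish
  have hΨne : ∀ x ∈ puncturedPolydisc m r, ∀ p, Ψ x p ≠ 0 := fun x hx p h => by
    have h1 := congrFun (hr (hball x hx)).1 p
    simp only [Φ, h, zero_mul] at h1
    have := (hx p).1
    rw [← h1, norm_zero] at this
    exact lt_irrefl _ this
  have hYne : ∀ x ∈ puncturedPolydisc m r, ∀ i j, i < j → j < m + 2 →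
      blowUp b c (Ψ x) i - blowUp b c (Ψ x) j ≠ 0 := fun x hx i j hij hj => by
    rw [← rho_succ _ hj, rho_blowUp hcN _ (by omega)]
    exact mul_ne_zero (leading_ne_zero (hΨne x hx) _ _)
      ((hr (hball x hx)).2.1 ⟨i, by omega⟩ ⟨j, hj⟩ hij)
  have hYne' : ∀ x ∈ puncturedPolydisc m r, ∀ i j : Fin (m + 2), i ≠ j →
      blowUp b c (Ψ x) i - blowUp b c (Ψ x) j ≠ 0 := fun x hx i j hij => by
    rcases lt_or_gt_of_ne hij with h | h
    · exact hYne x hx i j h j.2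
    · rw [← neg_sub]
      exact neg_ne_zero.2 (hYne x hx j i h i.2)
  have hβ : ∀ x ∈ puncturedPolydisc m r, blowUp b c (Ψ x) (a.symm (Fin.last (m + 1))) -
      blowUp b c (Ψ x) (a.symm 0) ≠ 0 := fun x hx =>
    hYne' x hx _ _ fun h => by simpa [Fin.ext_iff] using a.symm.injective h
  let chart : (Fin m → ℂ) → Fin m → ℂ := fun x => gauge a (blowUp b c (Ψ x))
  have hdih : ∀ x ∈ puncturedPolydisc m r, ∀ d : Chord m, dihedral a d (chart x) =
      (∏ p, if b p = d.1.1 ∧ c p = d.1.2 then Ψ x p else 1) *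
        crossCorrection b c (m + 2) (Ψ x) d.1.1 d.1.2 := fun x hx d => by
    have hd : (d.1.1 : ℕ) < d.1.2 := d.2.1
    rw [dihedral_eq, crossU_affine (hβ x hx) (fun k hk => line_gauge a (hβ x hx) hk) hd d.1.2.2
      (by
        rintro ⟨h1, h2⟩
        exact d.2.2 (Prod.ext (Fin.ext h1) (Fin.ext (by simp; omega)))),
      crossU_blowUp hcN (hΨne x hx) hd]
  have hmem : ∀ d : Chord m, d ∈ Set.range prop ↔
      IsNode (m + 2) (lo t) (hi t) d.1.1 d.1.2 := by
    intro d
    constructor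
    · rintro ⟨p, rfl⟩
      exact ⟨κ p, hκ p, rfl, rfl⟩
    · rintro ⟨k, hk, h1, h2⟩
      rcases hκr k hk with ⟨p, rfl⟩ | ⟨h3, h4⟩
      · exact ⟨p, Subtype.ext (Prod.ext (Fin.ext h1) (Fin.ext h2))⟩
      · rw [h3] at h1
        rw [h4] at h2
        exact absurd (Prod.ext (Fin.ext h1.symm) (Fin.ext h2.symm)) d.2.2
  refine ⟨prop, r, chart, ⟨ht, fun p q h => hprop p q ?_, hmem, r_pos, ?_, ?_, ?_, ?_⟩⟩
  · exact ⟨congrArg (fun x : Chord m => (x.1.1 : ℕ)) h, congrArg (fun x : Chord m => (x.1.2 : ℕ)) h⟩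
  · intro x hx
    have hd := (hr (hball x hx)).2.2
    have hY : ∀ i, DifferentiableAt ℂ (fun x => blowUp b c (Ψ x) i) x := fun i =>
      DifferentiableAt.comp (g := fun u => blowUp b c u i) x
        ((contDiff_blowUp i).differentiable one_ne_zero _) hd
    refine (differentiableAt_pi.2 fun i => ?_).differentiableWithinAt
    simp only [chart, gauge, div_eq_mul_inv]
    exact ((hY _).sub (hY _)).mul (((hY _).sub (hY _)).inv (hβ x hx))
  · intro x hx
    have key : ∀ i : Fin (m + 2), pos (chart x) (a i) =
        (blowUp b c (Ψ x) i - blowUp b c (Ψ x) (a.symm 0)) /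
          (blowUp b c (Ψ x) (a.symm (Fin.last (m + 1))) - blowUp b c (Ψ x) (a.symm 0)) := fun i => by
      rw [← line_val, line_gauge a (hβ x hx) i.2]
    intro i j hij
    obtain ⟨i, rfl⟩ := a.surjective i
    obtain ⟨j, rfl⟩ := a.surjective j
    rw [key, key, div_left_inj' (hβ x hx)] at hij
    by_contra hne
    refine hYne' x hx i j (fun h => hne (by rw [h])) ?_
    linear_combination hij
  · intro x hx p
    rw [hdih x hx, Finset.prod_eq_single p]
    · rw [if_pos ⟨rfl, rfl⟩]
      exact congrFun (hr (hball x hx)).1 p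
    · intro q _ hq
      exact if_neg fun h => hq (hprop q p h)
    · simp
  · intro d hd
    rw [← hmem] at hd
    have hij : (d.1.1 : ℕ) < d.1.2 := d.2.1
    have h1 : Tendsto (fun x => crossCorrection b c (m + 2) (Ψ x) d.1.1 d.1.2)
        (𝓝[puncturedPolydisc m r] 0) (𝓝 1) := by
      have h2 : ContinuousAt (fun x => crossCorrection b c (m + 2) (Ψ x) d.1.1 d.1.2) 0 := by
        refine ContinuousAt.comp (g := fun u => crossCorrection b c (m + 2) u d.1.1 d.1.2) ?_
          hΨc.continuousAt
        rw [hΨ0]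
        exact (hVc _ _ hij).continuousAt
      have h3 := h2.tendsto
      rw [hΨ0, hV0 _ _ hij] at h3
      exact h3.mono_left nhdsWithin_le_nhds
    refine h1.congr' ?_
    filter_upwards [self_mem_nhdsWithin] with x hx
    rw [hdih x hx, Finset.prod_eq_one, one_mul]
    intro p _
    exact if_neg fun h => hd ⟨p, Subtype.ext (Prod.ext (Fin.ext h.1) (Fin.ext h.2))⟩

/-- The integrals of the Parke-Taylor forms over the oriented cycle of a Lie monomial. -/
theorem TreeCycle.sign_mul_torusInt {Γ : LieMonomial m} (C : TreeCycle Γ)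
    (b : Equiv.Perm (Fin (m + 2))) :
    ((C.sign : ℤ) : ℂ) * torusInt (fun θ => C.chart (torusMap 0 C.ε θ)) (parkeTaylor b) =
      wordDual b Γ.toLie := by
  obtain ⟨t, ⟨ε, hε⟩, I⟩ := C.exists_isTreeChart
  obtain ⟨δ, hδ⟩ := I.exists_torusInt_eq C.ε_mem
  have hw : ∀ b, wordDual b Γ.toLie = ((ε : ℤ) : ℂ) * cf (expand t) (List.ofFn b) := fun b => by
    rw [wordDual_apply, ← cf_smul, ← hε]
    rfl
  have h1 := C.orient
  have h2 := C.planar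
  rw [hδ, hw] at h1
  rw [hw] at h2
  have h3 := mul_right_cancel₀ (right_ne_zero_of_mul h2) ((mul_assoc _ _ _).trans h1)
  rw [hδ, hw, ← mul_assoc, h3]

theorem nonempty_treeCycle (Γ : LieMonomial m) : Nonempty (TreeCycle Γ) := by
  obtain ⟨a, ha⟩ := exists_perm_of_perm_finRange Γ.2
  obtain ⟨prop, r, chart, I⟩ := exists_isTreeChart ha.symm
  have hε : ∀ p : Fin m, 0 < (fun _ => r / 2 : Fin m → ℝ) p ∧ (fun _ => r / 2 : Fin m → ℝ) p < r :=
    fun _ => ⟨half_pos I.r_pos, half_lt_self I.r_pos⟩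
  obtain ⟨δ, hδ⟩ := I.exists_torusInt_eq hε
  have h1 : wordDual a Γ.toLie = 1 := by
    rw [wordDual_apply, ha]
    exact cf_expand_leaves (Γ.2.nodup_iff.2 (List.nodup_finRange _))
  have key : ∀ c, IsPropagator Γ a c ↔ IsNode (m + 2) (lo Γ.1) (hi Γ.1) c.1.1 c.1.2 := fun c =>
    exists_subtree_labels_iff ha.symm c
  exact ⟨{
    a := a
    planar := by rw [h1]; exact one_ne_zero
    prop := prop
    prop_injective := I.prop_injective
    mem_range_prop := fun c => by rw [key, I.mem_range_prop]
    r := r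
    r_pos := I.r_pos
    chart := chart
    chart_holo := I.chart_holo
    chart_mem := I.chart_mem
    dihedral_prop := I.dihedral_prop
    dihedral_other := fun c hc => I.dihedral_other c (by rwa [← key])
    ε := fun _ => r / 2
    ε_mem := hε
    sign := δ
    orient := by
      rw [hδ, ← mul_assoc, h1, ha, cf_expand_leaves (Γ.2.nodup_iff.2 (List.nodup_finRange _))]
      rcases Int.units_eq_one_or δ with rfl | rfl <;> norm_num }⟩

end Existence

/-! ### The decomposition of `q^* ω^{n-3}` -/

section Decomposition
variable {m : ℕ}

/-- The words that start with the first letter; they form a basis of `Lie(n-1)^*`. -/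
abbrev CombWord (m : ℕ) : Type := {a : Equiv.Perm (Fin (m + 2)) // a 0 = 0}

/-- `q^* ω^{n-3}` is a combination of the Parke-Taylor forms of the words that start with the first
letter, with coefficients that are constant forms on `K_n`. -/
theorem exists_qOmegaPow_eq_sum (m : ℕ) : ∃ W : CombWord m → Form (Mandelstam m) m,
    ∀ (s : Mandelstam m) (z : Fin m → ℂ), z ∈ openModuli m →
      qOmegaPow m (s, z) = ∑ a, extWedge (W a) (parkeTaylor a.1 z) := by
  obtain ⟨c, hc⟩ := exists_qOmegaPow_eq m
  obtain ⟨V, hV⟩ := exists_detForm_dScattering_eq m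
  refine ⟨fun a => (c * (2 * Real.pi * Complex.I) ^ m) • V a, fun s z hz => ?_⟩
  have hsum : ∀ f : CombWord m → Form (Mandelstam m) m,
      extWedge (∑ a, f a) (dSigma m) = ∑ a, extWedge (f a) (dSigma m) := fun f => by
    have := map_sum ((extWedgeBilin m).flip (dSigma m)) f Finset.univ
    exact this
  rw [hc s z hz, hV ⟨z, hz⟩, hsum, Finset.smul_sum]
  refine Finset.sum_congr rfl fun a _ => ?_
  rw [parkeTaylor_eq, extWedge_smul_left, extWedge_smul_left, extWedge_smul_right, smul_smul,
    smul_smul]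
  congr 1
  have h : ((2 * Real.pi * Complex.I) ^ m : ℂ) ≠ 0 :=
    pow_ne_zero _ (by simp [Real.pi_ne_zero, Complex.I_ne_zero])
  field_simp

/-- Integration over the fibre picks out the coefficients of the Lie monomial. -/
theorem TreeCycle.fibreIntegral_eq {W : CombWord m → Form (Mandelstam m) m}
    (hW : ∀ (s : Mandelstam m) (z : Fin m → ℂ), z ∈ openModuli m →
      qOmegaPow m (s, z) = ∑ a, extWedge (W a) (parkeTaylor a.1 z))
    {Γ : LieMonomial m} (C : TreeCycle Γ) (s : Mandelstam m) (v : Fin m → Mandelstam m) :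
    C.fibreIntegral s v = ∑ a, wordDual a.1 Γ.toLie * W a v := by
  obtain ⟨t, -, I⟩ := C.exists_isTreeChart
  have h1 : ∀ θ, qOmegaPow m (s, C.chart (torusMap 0 C.ε θ))
      (Fin.append (fun i => ((v i, 0) : Mandelstam m × (Fin m → ℂ))) fun p =>
        ((0, fderiv ℝ (fun θ => C.chart (torusMap 0 C.ε θ)) θ (Pi.single p 1)) :
          Mandelstam m × (Fin m → ℂ))) =
      ∑ a, W a v * parkeTaylor a.1 (C.chart (torusMap 0 C.ε θ)) fun p =>
        fderiv ℝ (fun θ => C.chart (torusMap 0 C.ε θ)) θ (Pi.single p 1) := by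
    intro θ
    rw [hW s _ (C.chart_mem _ (torusMap_mem C.ε_mem θ)), form_sum_apply]
    exact Finset.sum_congr rfl fun a _ => extWedge_apply _ _ _ _
  rw [TreeCycle.fibreIntegral, fibreInt]
  simp only [h1]
  rw [MeasureTheory.integral_finsetSum _ fun a _ =>
    (I.integrableOn_parkeTaylor C.ε_mem a.1).const_mul _, Finset.mul_sum]
  refine Finset.sum_congr rfl fun a _ => ?_
  rw [MeasureTheory.integral_const_mul, ← C.sign_mul_torusInt, torusInt]
  ring

/-- The map `Γ ↦ w_Γ`, given the components of `q^* ω^{n-3}`. -/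
def wMap (W : CombWord m → Form (Mandelstam m) m) : Lie m →ₗ[ℂ] Form (Mandelstam m) m :=
  ∑ a, (wordDual a.1).smulRight (W a)

theorem wMap_apply (W : CombWord m → Form (Mandelstam m) m) (L : Lie m) :
    wMap W L = ∑ a, wordDual a.1 L • W a := by
  simp [wMap]

theorem wMap_comb (W : CombWord m → Form (Mandelstam m) m) (b : CombWord m) :
    wMap W (comb b.1).toLie = W b := by
  simp [wMap_apply, wordDual_comb]

/-- The map `a ↦ PT_a` on `Lie(n-1)^*`. -/
def ptMap (m : ℕ) : Module.Dual ℂ (Lie m) →ₗ[ℂ] (openModuli m → Form (Fin m → ℂ) m) :=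
  ∑ a : CombWord m, (LinearMap.applyₗ (comb a.1).toLie).smulRight fun z => parkeTaylor a.1 z.1

theorem ptMap_apply (φ : Module.Dual ℂ (Lie m)) (z : openModuli m) :
    ptMap m φ z = ∑ a : CombWord m, φ (comb a.1).toLie • parkeTaylor a.1 z.1 := by
  simp [ptMap]

theorem ptMap_wordDual (b : Equiv.Perm (Fin (m + 2))) (z : openModuli m) :
    ptMap m (wordDual b) z = parkeTaylor b z.1 := by
  rw [ptMap_apply, parkeTaylor_eq, inv_den_eq_sum z.2, Finset.mul_sum, Finset.sum_smul]
  refine Finset.sum_congr rfl fun a _ => ?_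
  rw [parkeTaylor_eq, smul_smul]
  congr 1
  ring

variable {ι : Type*} [Fintype ι] [DecidableEq ι] (H : Module.Basis ι ℂ (Lie m))
  (K : Module.Basis ι ℂ (Module.Dual ℂ (Lie m)))

/-- The pairing matrix of two bases is invertible. -/
theorem pairing_mul_inv : pairing H K * (pairing H K)⁻¹ = 1 := by
  have h : pairing H K * Matrix.of (fun j l => K.repr (H.coord l) j) = 1 := by
    ext i l
    have := congrArg (fun φ : Module.Dual ℂ (Lie m) => φ (H i)) (K.sum_repr (H.coord l))
    simp only [LinearMap.sum_apply, LinearMap.smul_apply, smul_eq_mul] at this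
    rw [Matrix.mul_apply]
    simp only [pairing, Matrix.of_apply]
    rw [Module.Basis.coord_apply, Module.Basis.repr_self, Finsupp.single_apply] at this
    rw [Matrix.one_apply, ← this]
    exact Finset.sum_congr rfl fun j _ => mul_comm _ _
  rw [Matrix.inv_eq_right_inv h, h]

/-- The canonical element of `Lie(n-1) ⊗ Lie(n-1)^*` in terms of a pair of bases. -/
theorem sum_inv_pairing_smul (L : Lie m) :
    ∑ i, ∑ j, ((pairing H K)⁻¹ j i * K j L) • H i = L := by
  have h : ∑ i, ∑ j, (pairing H K)⁻¹ j i • (K j).smulRight (H i) = LinearMap.id := by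
    refine H.ext fun l => ?_
    simp only [LinearMap.sum_apply, LinearMap.smul_apply, LinearMap.smulRight_apply, smul_smul,
      LinearMap.id_apply, ← Finset.sum_smul]
    have hl : ∀ i, ∑ j, (pairing H K)⁻¹ j i * K j (H l) = if l = i then 1 else 0 := fun i => by
      rw [← Matrix.one_apply, ← pairing_mul_inv H K, Matrix.mul_apply]
      exact Finset.sum_congr rfl fun j _ => mul_comm _ _
    simp only [hl, ite_smul, one_smul, zero_smul, Finset.sum_ite_eq, Finset.mem_univ, if_true]
  have := congrArg (fun f : Lie m →ₗ[ℂ] Lie m => f L) h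
  simpa only [LinearMap.sum_apply, LinearMap.smul_apply, LinearMap.smulRight_apply, smul_smul,
    LinearMap.id_apply] using this

/-- The sum over a pair of bases does not depend on the bases. -/
theorem sum_pairing_extWedge (W : CombWord m → Form (Mandelstam m) m) (z : openModuli m) :
    ∑ i, ∑ j, (pairing H K)⁻¹ j i • extWedge (wMap W (H i)) (ptMap m (K j) z) =
      ∑ a, extWedge (W a) (parkeTaylor a.1 z.1) := by
  let B : Lie m →ₗ[ℂ] Form (Fin m → ℂ) m →ₗ[ℂ] Form (Mandelstam m × (Fin m → ℂ)) (m + m) :=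
    extWedgeBilin m ∘ₗ wMap W
  have hB : ∀ L η, extWedge (wMap W L) η = B L η := fun _ _ => rfl
  have h : ∀ a, extWedge (W a) (parkeTaylor a.1 z.1) =
      ∑ i, ∑ j, (pairing H K)⁻¹ j i • K j (comb a.1).toLie • B (H i) (parkeTaylor a.1 z.1) := by
    intro a
    conv_lhs => rw [← wMap_comb W a, hB, ← sum_inv_pairing_smul H K (comb a.1).toLie]
    simp only [map_sum, map_smul, LinearMap.sum_apply, LinearMap.smul_apply, mul_smul]
  simp only [h, hB, ptMap_apply, map_sum, map_smul, Finset.smul_sum]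
  rw [Finset.sum_comm]
  conv_rhs => rw [Finset.sum_comm]
  rw [Finset.sum_comm]
  refine Finset.sum_congr rfl fun i _ => ?_
  exact Finset.sum_comm

end Decomposition
end LiePT

end

theorem mainTheorem2 (m : ℕ) :
    ∃ (w : LiePT.Lie m →ₗ[ℂ] LiePT.Form (LiePT.Mandelstam m) m)
      (PT : Module.Dual ℂ (LiePT.Lie m) →ₗ[ℂ]
        (LiePT.openModuli m → LiePT.Form (Fin m → ℂ) m)),
      (∀ Γ : LiePT.LieMonomial m, Nonempty (LiePT.TreeCycle Γ) ∧
        ∀ (C : LiePT.TreeCycle Γ) (s : LiePT.Mandelstam m) (v : Fin m → LiePT.Mandelstam m),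
          C.fibreIntegral s v = w Γ.toLie v) ∧
      (∀ (a : Equiv.Perm (Fin (m + 2))) (z : LiePT.openModuli m),
        PT (LiePT.wordDual a) z = LiePT.parkeTaylor a z) ∧
      (∀ (ι : Type) [Fintype ι] [DecidableEq ι] (H : Module.Basis ι ℂ (LiePT.Lie m))
        (K : Module.Basis ι ℂ (Module.Dual ℂ (LiePT.Lie m))),
        (∀ (s : LiePT.Mandelstam m) (z : LiePT.openModuli m),
          LiePT.qOmegaPow m (s, z) =
            ∑ i, ∑ j, (LiePT.pairing H K)⁻¹ j i • LiePT.extWedge (w (H i)) (PT (K j) z)) ∧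
        (LiePT.pairing H K * (LiePT.pairing H K).transpose = 1 →
          ∀ (s : LiePT.Mandelstam m) (z : LiePT.openModuli m),
            LiePT.qOmegaPow m (s, z) =
              ∑ i, ∑ j, (K j (H i)) • LiePT.extWedge (w (H i)) (PT (K j) z))) ∧
      (∀ (s : LiePT.Mandelstam m) (z : LiePT.openModuli m),
        LiePT.qOmegaPow m (s, z) =
          ∑ a : {a : Equiv.Perm (Fin (m + 2)) // a 0 = 0},
            LiePT.extWedge (w (LiePT.comb a.1).toLie) (LiePT.parkeTaylor a.1 z)) := by
  obtain ⟨W, hW⟩ := LiePT.exists_qOmegaPow_eq_sum m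
  refine ⟨LiePT.wMap W, LiePT.ptMap m, fun Γ => ⟨LiePT.nonempty_treeCycle Γ, fun C s v => ?_⟩,
    LiePT.ptMap_wordDual, fun ι _ _ H K => ⟨fun s z => ?_, fun hG s z => ?_⟩, fun s z => ?_⟩
  · rw [C.fibreIntegral_eq hW, LiePT.wMap_apply, LiePT.form_sum_apply]
    rfl
  · rw [LiePT.sum_pairing_extWedge, hW s z z.2]
  · have h := LiePT.sum_pairing_extWedge H K W z
    rw [Matrix.inv_eq_right_inv hG] at h
    rw [hW s z z.2]
    exact h.symm
  · rw [hW s z z.2]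
    exact Finset.sum_congr rfl fun a _ => by rw [LiePT.wMap_comb]
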